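/- **Setting.** Let $\sigma>0$, let $P$ be a Borel probability measure on $\mathbb R^d$, let $X_1,X_2,\dots$ be i.i.d. with law $P$ on a probability space $(\Omega,\mathcal F,\mathbb P)$, and let $P_t=\frac1t\sum_{i=1}^t\delta_{X_i}$. Let $\mathcal K_\sigma$ be the measure on $\mathbb R^d$ with Lebesgue density $\sigma^{-d}K(x/\sigma)$, where $K(x)=(2\pi)^{-d/2}e^{-\|x\|_2^2/2}$, and set $$\|P_t-P\|^\sigma_{\mathrm{TV}}=\sup_{A}\big|(P_t\star\mathcal K_\sigma)(A)-(P\star\mathcal K_\sigma)(A)\big|,\qquad W_1^\sigma(P_t,P)=W_1(P_t\star\mathcal K_\sigma,\,P\star\mathcal K_\sigma),$$ where $A$ ranges over the Borel sets and $W_1(\mu,\nu)=\inf_\pi\int\|x-y\|_2\,d\pi(x,y)$ over all couplings $\pi$ of $\mu$ and $\nu$. A random vector $Y$ is $v$-sub-Gaussian if $\mathbb E\exp(\lambda^\top(Y-\mathbb EY))\le\exp(\|\lambda\|_2^2v/2)$ for all vectors $\lambda$; a distribution is $v$-sub-Gaussian if a random vector with that law is. $P$ satisfies $T_1(v)$ if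 it has a finite first moment and $W_1(\nu,P)\le\sqrt{2v\,\mathrm{KL}(\nu\|P)}$ for all Borel probability measures $\nu$ on $\mathbb R^d$ with a finite first moment. Let $\ell:[0,\infty)\to[1,\infty)$ satisfy $\sum_{k=1}^\infty 1/\ell(k)\le1$ and $\ell(x)=\ell(1)$ for $x\in[0,1]$. For $\tau>0$ and $\delta\in(0,1)$ put $$c_d=\sqrt2\Big(\tfrac1{\sqrt2}+\tfrac\tau\sigma\Big)^{d/2}e^{3d/16},\qquad C_d=2\sqrt{d\sigma^2}\Big(\tfrac1{\sqrt2}+\tfrac\tau\sigma\Big)c_d,$$ $$\beta_t=c_d\,t^{-1/2}+4\sqrt{\tfrac2t\big[\log\ell(\log_2t)+\log(1/\delta)\big]},\qquad \gamma_t=\frac{C_d}{\sqrt t}+2\sqrt{\tfrac{\tau^2}t\big[\log\ell(\log_2t)+\log(1/\delta)\big]},\qquad t\ge1.$$ **Proposition.** Let $\tau>0$. (i) Suppose $P$ is $\tau^2$-sub-Gaussian. Then, for all $\delta\in(0,1)$ such that $\ell$ is nondecreasing or the sequence $(\beta_t)_{t\ge1}$ is nonincreasing, $$\mathbb P\big(\exists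 t\ge1:\ \|P_t-P\|^\sigma_{\mathrm{TV}}\ge\beta_t\big)\le\delta .$$ (ii) Suppose $P$ satisfies $T_1(\tau^2)$. Then, for every $t\ge1$, $W_1^\sigma(P_t,P)$ is finite and $(\tau^2/t)$-sub-Gaussian. Furthermore, for all $\delta\in(0,1)$ such that $\ell$ is nondecreasing or the sequence $(\gamma_t)_{t\ge1}$ is nonincreasing, $$\mathbb P\big(\exists t\ge1:\ W_1^\sigma(P_t,P)\ge\gamma_t\big)\le\delta .$$ -/

import Mathlib

open MeasureTheory ProbabilityTheory
open scoped ENNReal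

namespace SmoothedDivergence

noncomputable section

/-- A stitching function `ℓ : [0, ∞) → [1, ∞)`: the sum over the integers `k ≥ 1` of `1 / ℓ k`
is at most one, and `ℓ` is constant on `[0, 1]`. Only the values of `ℓ` on `[0, ∞)` matter. -/
structure IsStitching (ℓ : ℝ → ℝ) : Prop where
  one_le : ∀ x, 0 ≤ x → 1 ≤ ℓ x
  summable : Summable fun k : ℕ => 1 / ℓ ((k : ℝ) + 1)
  tsum_le_one : ∑' k : ℕ, 1 / ℓ ((k : ℝ) + 1) ≤ 1
  eq_of_le_one : ∀ x, 0 ≤ x → x ≤ 1 → ℓ x = ℓ 1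

/-- The random vector `Y` is `v`-sub-Gaussian under `μ`:
`𝔼 exp ⟪u, Y - 𝔼 Y⟫ ≤ exp (‖u‖² v / 2)` for all vectors `u`. For `E = ℝ` this is the usual
definition for real random variables. -/
def IsSubGaussian {Ω E : Type*} [MeasurableSpace Ω] [NormedAddCommGroup E]
    [InnerProductSpace ℝ E] (Y : Ω → E) (v : ℝ) (μ : Measure Ω) : Prop :=
  Integrable Y μ ∧ ∀ u : E,
    Integrable (fun ω => Real.exp (inner ℝ u (Y ω - ∫ ω', Y ω' ∂μ))) μ ∧
    ∫ ω, Real.exp (inner ℝ u (Y ω - ∫ ω', Y ω' ∂μ)) ∂μ ≤ Real.exp (‖u‖ ^ 2 * v / 2)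

/-- The total variation distance `sup_A |μ A - ν A|` (for probability measures), the supremum
being over all measurable sets. -/
def tvDistance {α : Type*} [MeasurableSpace α] (μ ν : Measure α) : ℝ :=
  ⨆ A : {A : Set α // MeasurableSet A}, |μ.real A - ν.real A|

/-- The optimal transport cost: the infimum of `∫ c dπ` over all couplings `π` of `μ` and `ν`. -/
def transportCost {α : Type*} [MeasurableSpace α] (c : α → α → ℝ≥0∞) (μ ν : Measure α) : ℝ≥0∞ :=
  ⨅ (π : Measure (α × α)) (_ : π.map Prod.fst = μ) (_ : π.map Prod.snd = ν),
    ∫⁻ z, c z.1 z.2 ∂π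

/-- The 1-Wasserstein distance for the metric of `α`. -/
def wasserstein1 {α : Type*} [MeasurableSpace α] [PseudoEMetricSpace α] (μ ν : Measure α) : ℝ≥0∞ :=
  transportCost edist μ ν

/-- Finiteness of the first moment. -/
def FiniteFirstMoment {α : Type*} [MeasurableSpace α] [PseudoEMetricSpace α] (μ : Measure α) :
    Prop :=
  ∃ x₀ : α, ∫⁻ x, edist x x₀ ∂μ ≠ ∞

/-- The `T₁(v)` transportation inequality with respect to the metric of `α`: `P` has a finite first
moment, and `W₁(ν, P) ≤ √(2 v KL(ν ‖ P))` for all probability measures `ν` with a finite first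
moment. -/
def SatisfiesT1 {α : Type*} [MeasurableSpace α] [PseudoEMetricSpace α] (P : Measure α) (v : ℝ) :
    Prop :=
  FiniteFirstMoment P ∧ ∀ ν : Measure α, IsProbabilityMeasure ν → FiniteFirstMoment ν →
    wasserstein1 ν P ≤ (ENNReal.ofReal (2 * v) * InformationTheory.klDiv ν P) ^ (1 / 2 : ℝ)

/-- The density of the standard Gaussian distribution on `ℝᵈ`. -/
def stdKernel (d : ℕ) (x : EuclideanSpace ℝ (Fin d)) : ℝ :=
  (2 * Real.pi) ^ (-(d : ℝ) / 2) * Real.exp (-‖x‖ ^ 2 / 2)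

/-- The measure with Lebesgue density `x ↦ σ⁻ᵈ K(x / σ)`, for `K` the standard Gaussian density. -/
def gaussianKernel (d : ℕ) (σ : ℝ) : Measure (EuclideanSpace ℝ (Fin d)) :=
  volume.withDensity fun x => ENNReal.ofReal ((1 / σ ^ d) * stdKernel d (σ⁻¹ • x))

/-- The total variation distance between the Gaussian convolutions of `P` and `Q`. -/
def smoothedTV {d : ℕ} (σ : ℝ) (P Q : Measure (EuclideanSpace ℝ (Fin d))) : ℝ :=
  tvDistance (P ∗ gaussianKernel d σ) (Q ∗ gaussianKernel d σ)

/-- The 1-Wasserstein distance between the Gaussian convolutions of `P` and `Q`. -/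
def smoothedW1 {d : ℕ} (σ : ℝ) (P Q : Measure (EuclideanSpace ℝ (Fin d))) : ℝ≥0∞ :=
  wasserstein1 (P ∗ gaussianKernel d σ) (Q ∗ gaussianKernel d σ)

/-- The empirical measure `(1 / t) ∑ δ_{X_i}` of the first `t` observations. -/
def empiricalMeasure {Ω α : Type*} [MeasurableSpace α] (X : ℕ → Ω → α) (t : ℕ) (ω : Ω) :
    Measure α :=
  (t : ℝ≥0∞)⁻¹ • ∑ i ∈ Finset.range t, Measure.dirac (X i ω)

/-- The constant `c_d = √2 (1/√2 + τ/σ)^(d/2) e^(3d/16)`. -/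
def constTV (d : ℕ) (σ τ : ℝ) : ℝ :=
  √2 * (1 / √2 + τ / σ) ^ ((d : ℝ) / 2) * Real.exp (3 * d / 16)

/-- The constant `C_d = 2 √(d σ²) (1/√2 + τ/σ) c_d`. -/
def constW1 (d : ℕ) (σ τ : ℝ) : ℝ :=
  2 * √(d * σ ^ 2) * (1 / √2 + τ / σ) * constTV d σ τ

/-- `c_d / √t + 4 √((2 / t) [log ℓ(log₂ t) + log (1 / δ)])`. -/
def boundaryTV (ℓ : ℝ → ℝ) (d : ℕ) (σ τ δ : ℝ) (t : ℕ) : ℝ :=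
  constTV d σ τ / √t + 4 * √(2 / t * (Real.log (ℓ (Real.logb 2 t)) + Real.log (1 / δ)))

/-- `C_d / √t + 2 √((τ² / t) [log ℓ(log₂ t) + log (1 / δ)])`. -/
def boundaryW1 (ℓ : ℝ → ℝ) (d : ℕ) (σ τ δ : ℝ) (t : ℕ) : ℝ :=
  constW1 d σ τ / √t + 2 * √(τ ^ 2 / t * (Real.log (ℓ (Real.logb 2 t)) + Real.log (1 / δ)))

end

end SmoothedDivergence

/-! Each smoothed distance is handled through a symmetric functional F_t of the first t observations
that is convex in the empirical measure: the smoothed W₁ distance itself, and for total variation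
the dominating half L¹ error of the kernel density estimator. Since P_{t+1} averages its t + 1
leave-one-out empirical measures, F_{t+1} is at most the average of the leave-one-out values of F_t.
Thus F_t, and by Jensen exp(r F_t) for r ≥ 0, is a reverse submartingale for the exchangeable
filtration, and Doob's inequality in reversed time (`maximal_ineq`) controls all t ≥ s by the
exponential moment at time s alone.

For that moment, replacing one observation changes F_t by at most ρ(x_i, y)/t, with ρ = 1 for total
variation and ρ the distance for W₁. A one-point Laplace bound tensorizes (`LaplaceBound.pi`), so
F_t is (v/t)-sub-Gaussian: v = 1/4 by Hoeffding's lemma, v = τ² by the Bobkov–Götze argument from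
T₁.

The mean is at most a/√t (`lintegral_weighted_error_le`). The pointwise L² error of the density
estimator is integrated by Cauchy–Schwarz against a Gaussian weight of variance σ² + 2τ² centred at
the mean of P, and sub-Gaussianity makes the result finite. For W₁ the L¹ error is further weighted
by the distance to the mean.

Finally the tail bounds are stitched over dyadic epochs (`stitched_bound`), with error δ/ℓ(k) for
the k-th. The constants c_d and C_d exceed √2 a, which pays for the factor √2 lost within an epoch
and leaves a gain of e^{-1/3} ≤ 18/25 in every epoch. The remaining 7/25 pays for t = 1 when ℓ is
nondecreasing. -/

namespace SmoothedDivergence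

/-! ### Maximal inequality in reversed time for exchangeable sequences. -/

section Exchangeable

variable {E : Type*} [MeasurableSpace E] (P : Measure E) [IsProbabilityMeasure P]

theorem measurePreserving_comp_perm (e : Equiv.Perm ℕ) :
    MeasurePreserving (fun (x : ℕ → E) i => x (e i)) (Measure.infinitePi fun _ => P)
      (Measure.infinitePi fun _ => P) :=
  ⟨by fun_prop, Measure.map_infinitePi_infinitePi_of_inj (P := fun _ : ℕ => P) e.injective⟩

theorem measurePreserving_comp_fin (n : ℕ) :
    MeasurePreserving (fun (x : ℕ → E) (i : Fin n) => x i) (Measure.infinitePi fun _ => P)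
      (Measure.pi fun _ => P) :=
  ⟨by fun_prop, by
    rw [Measure.map_infinitePi_infinitePi_of_inj (P := fun _ : ℕ => P) Fin.val_injective,
      Measure.infinitePi_eq_pi]⟩

/-- Invariance of a function of a sequence under transpositions of the first `n` indices. -/
def SwapInvariant {E β : Type*} (n : ℕ) (f : (ℕ → E) → β) : Prop :=
  ∀ i j, i < n → j < n → ∀ x : ℕ → E, f (fun k => x (Equiv.swap i j k)) = f x

theorem SwapInvariant.mono {E β : Type*} {m n : ℕ} {f : (ℕ → E) → β} (h : SwapInvariant n f)
    (hmn : m ≤ n) : SwapInvariant m f :=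
  fun i j hi hj => h i j (hi.trans_le hmn) (hj.trans_le hmn)

variable {f : ℕ → (ℕ → E) → ℝ≥0∞}

/-- A swap of i and n preserves both the product law and B, so all terms of the average have the
same integral over B. This replaces conditioning on the exchangeable σ-algebra. -/
theorem setLIntegral_succ_le {n : ℕ} (hm : Measurable (f n))
    (hsub : ∀ x, f (n + 1) x ≤ ((n + 1 : ℕ) : ℝ≥0∞)⁻¹ *
      ∑ i ∈ Finset.range (n + 1), f n (fun k => x (Equiv.swap i n k)))
    {B : Set (ℕ → E)} (hB : MeasurableSet B) (hBinv : SwapInvariant (n + 1) (· ∈ B)) :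
    ∫⁻ x in B, f (n + 1) x ∂(Measure.infinitePi fun _ => P) ≤
      ∫⁻ x in B, f n x ∂(Measure.infinitePi fun _ => P) := by
  set Q := Measure.infinitePi fun _ : ℕ => P
  have hswap : ∀ i ∈ Finset.range (n + 1),
      ∫⁻ x in B, f n (fun k => x (Equiv.swap i n k)) ∂Q = ∫⁻ x in B, f n x ∂Q := by
    intro i hi
    have hmp := measurePreserving_comp_perm P (Equiv.swap i n)
    have h := hmp.setLIntegral_comp_preimage hB hm
    rw [← h]
    congr 2
    ext x
    exact (iff_of_eq (hBinv i n (Finset.mem_range.1 hi) n.lt_succ_self x)).symm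
  calc ∫⁻ x in B, f (n + 1) x ∂Q
      ≤ ∫⁻ x in B, ((n + 1 : ℕ) : ℝ≥0∞)⁻¹ *
          ∑ i ∈ Finset.range (n + 1), f n (fun k => x (Equiv.swap i n k)) ∂Q :=
        lintegral_mono hsub
    _ = ((n + 1 : ℕ) : ℝ≥0∞)⁻¹ * ∑ i ∈ Finset.range (n + 1), ∫⁻ x in B, f n x ∂Q := by
        rw [lintegral_const_mul _ (by fun_prop), lintegral_finsetSum _ (fun i _ => by fun_prop),
          Finset.sum_congr rfl hswap]
    _ = ∫⁻ x in B, f n x ∂Q := by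
        rw [Finset.sum_const, Finset.card_range, nsmul_eq_mul, ← mul_assoc,
          ENNReal.inv_mul_cancel (by simp) (by simp), one_mul]

theorem setLIntegral_antitone {s : ℕ} (hm : ∀ t, s ≤ t → Measurable (f t))
    (hsub : ∀ t, s ≤ t → ∀ x, f (t + 1) x ≤ ((t + 1 : ℕ) : ℝ≥0∞)⁻¹ *
      ∑ i ∈ Finset.range (t + 1), f t (fun k => x (Equiv.swap i t k)))
    {n : ℕ} (hn : s ≤ n) {B : Set (ℕ → E)} (hB : MeasurableSet B)
    (hBinv : SwapInvariant n (· ∈ B)) :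
    ∫⁻ x in B, f n x ∂(Measure.infinitePi fun _ => P) ≤
      ∫⁻ x in B, f s x ∂(Measure.infinitePi fun _ => P) := by
  induction n, hn using Nat.le_induction with
  | base => exact le_rfl
  | succ n hn ih =>
    exact (setLIntegral_succ_le P (hm n hn) (hsub n hn) hB hBinv).trans
      (ih (hBinv.mono n.le_succ))

/-- Doob's argument: split according to the last time t ≤ n with c ≤ f t. That event is invariant
under swaps of the first t indices, so after Markov's inequality at time t the integrand may be
replaced by f s. The set B is arbitrary so that the induction can discard the part already treated.
-/
theorem maximal_ineq_finite {s : ℕ} (hm : ∀ t, s ≤ t → Measurable (f t))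
    (hinv : ∀ t, s ≤ t → SwapInvariant t (f t))
    (hsub : ∀ t, s ≤ t → ∀ x, f (t + 1) x ≤ ((t + 1 : ℕ) : ℝ≥0∞)⁻¹ *
      ∑ i ∈ Finset.range (t + 1), f t (fun k => x (Equiv.swap i t k)))
    (c : ℝ≥0∞) {n : ℕ} (hn : s ≤ n) {B : Set (ℕ → E)} (hB : MeasurableSet B)
    (hBinv : SwapInvariant n (· ∈ B)) :
    c * (Measure.infinitePi fun _ => P) (B ∩ {x | ∃ t, s ≤ t ∧ t ≤ n ∧ c ≤ f t x}) ≤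
      ∫⁻ x in B, f s x ∂(Measure.infinitePi fun _ => P) := by
  set Q := Measure.infinitePi fun _ : ℕ => P
  have markov : ∀ t, s ≤ t → ∀ C, MeasurableSet C →
      c * Q (C ∩ {x | c ≤ f t x}) ≤ ∫⁻ x in C ∩ {x | c ≤ f t x}, f t x ∂Q := by
    intro t ht C hC
    rw [← setLIntegral_const]
    exact setLIntegral_mono (hm t ht) (fun x hx => hx.2)
  induction n, hn using Nat.le_induction generalizing B with
  | base =>
    have : {x | ∃ t, s ≤ t ∧ t ≤ s ∧ c ≤ f t x} = {x | c ≤ f s x} := by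
      ext x
      constructor
      · rintro ⟨t, h1, h2, h3⟩
        obtain rfl := le_antisymm h1 h2
        exact h3
      · exact fun h => ⟨s, le_rfl, le_rfl, h⟩
    rw [this]
    exact (markov s le_rfl B hB).trans (lintegral_mono_set Set.inter_subset_left)
  | succ n hn ih =>
    have hsn : s ≤ n + 1 := hn.trans n.le_succ
    have hS : MeasurableSet {x | c ≤ f (n + 1) x} := measurableSet_le measurable_const (hm _ hsn)
    have h1 : c * Q (B ∩ {x | c ≤ f (n + 1) x}) ≤
        ∫⁻ x in B ∩ {x | c ≤ f (n + 1) x}, f s x ∂Q := by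
      refine (markov _ hsn B hB).trans (setLIntegral_antitone P hm hsub hsn (hB.inter hS) ?_)
      intro i j hi hj x
      simp only [Set.mem_inter_iff, Set.mem_ofPred_eq, hinv _ hsn i j hi hj x]
      exact congrArg (· ∧ _) (hBinv i j hi hj x)
    have h2 := ih (hB.diff hS) (by
      intro i j hi hj x
      have hi' := hi.trans n.lt_succ_self
      have hj' := hj.trans n.lt_succ_self
      simp only [Set.mem_sdiff, Set.mem_ofPred_eq, hinv _ hsn i j hi' hj' x]
      exact congrArg (· ∧ _) (hBinv i j hi' hj' x))
    have hcover : B ∩ {x | ∃ t, s ≤ t ∧ t ≤ n + 1 ∧ c ≤ f t x} ⊆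
        (B ∩ {x | c ≤ f (n + 1) x}) ∪
          ((B \ {x | c ≤ f (n + 1) x}) ∩ {x | ∃ t, s ≤ t ∧ t ≤ n ∧ c ≤ f t x}) := by
      rintro x ⟨hxB, t, h1, h2, h3⟩
      by_cases hx : c ≤ f (n + 1) x
      · exact Or.inl ⟨hxB, hx⟩
      · refine Or.inr ⟨⟨hxB, hx⟩, t, h1, ?_, h3⟩
        rcases Nat.le_succ_iff.1 h2 with h | h
        · exact h
        · subst h; exact absurd h3 hx
    calc c * Q (B ∩ {x | ∃ t, s ≤ t ∧ t ≤ n + 1 ∧ c ≤ f t x})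
        ≤ c * (Q (B ∩ {x | c ≤ f (n + 1) x}) +
          Q ((B \ {x | c ≤ f (n + 1) x}) ∩ {x | ∃ t, s ≤ t ∧ t ≤ n ∧ c ≤ f t x})) :=
          mul_le_mul_right ((measure_mono hcover).trans (measure_union_le _ _)) _
      _ ≤ ∫⁻ x in B ∩ {x | c ≤ f (n + 1) x}, f s x ∂Q +
          ∫⁻ x in B \ {x | c ≤ f (n + 1) x}, f s x ∂Q := by
          rw [mul_add]; exact add_le_add h1 h2
      _ = ∫⁻ x in B, f s x ∂Q := lintegral_inter_add_sdiff _ _ hS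

/-- Maximal inequality for reverse submartingales generated by exchangeable observations. -/
theorem maximal_ineq {s : ℕ} (hm : ∀ t, s ≤ t → Measurable (f t))
    (hinv : ∀ t, s ≤ t → SwapInvariant t (f t))
    (hsub : ∀ t, s ≤ t → ∀ x, f (t + 1) x ≤ ((t + 1 : ℕ) : ℝ≥0∞)⁻¹ *
      ∑ i ∈ Finset.range (t + 1), f t (fun k => x (Equiv.swap i t k)))
    (c : ℝ≥0∞) :
    c * (Measure.infinitePi fun _ => P) {x | ∃ t, s ≤ t ∧ c ≤ f t x} ≤
      ∫⁻ x, f s x ∂(Measure.infinitePi fun _ => P) := by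
  have hU : {x | ∃ t, s ≤ t ∧ c ≤ f t x} =
      ⋃ n : ℕ, {x | ∃ t, s ≤ t ∧ t ≤ s + n ∧ c ≤ f t x} := by
    ext x
    simp only [Set.mem_ofPred_eq, Set.mem_iUnion]
    constructor
    · rintro ⟨t, h1, h2⟩
      exact ⟨t, t, h1, by omega, h2⟩
    · rintro ⟨n, t, h1, -, h2⟩
      exact ⟨t, h1, h2⟩
  have hmono : Monotone fun n : ℕ => {x | ∃ t, s ≤ t ∧ t ≤ s + n ∧ c ≤ f t x} := by
    rintro a b hab x ⟨t, h1, h2, h3⟩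
    exact ⟨t, h1, by omega, h3⟩
  rw [hU, hmono.measure_iUnion, ENNReal.mul_iSup]
  refine iSup_le fun n => ?_
  have := maximal_ineq_finite P hm hinv hsub c (Nat.le_add_right s n) MeasurableSet.univ
    (fun i j _ _ x => by simp)
  simpa using this

end Exchangeable

/-! ### Laplace bounds and their tensorization. -/

section Laplace

variable {E : Type*} [MeasurableSpace E]

/-- Functions that are `c`-Lipschitz for the cost `ρ` are sub-Gaussian with parameter `c² v`. -/
def LaplaceBound (P : Measure E) (ρ : E → E → ℝ) (v : ℝ) : Prop :=
  ∀ (c : ℝ) (f : E → ℝ), 0 ≤ c → Measurable f → (∀ x y, |f x - f y| ≤ c * ρ x y) →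
    Integrable f P ∧ Integrable (fun x => Real.exp (f x)) P ∧
      ∫ x, Real.exp (f x) ∂P ≤ Real.exp (∫ x, f x ∂P + c ^ 2 * v / 2)

theorem integrable_of_integrable_exp {α : Type*} [MeasurableSpace α] {μ : Measure α} {f : α → ℝ}
    (hf : AEStronglyMeasurable f μ) (h1 : Integrable (fun x => Real.exp (f x)) μ)
    (h2 : Integrable (fun x => Real.exp (-f x)) μ) : Integrable f μ := by
  refine (h1.add h2).mono' hf (Filter.Eventually.of_forall fun x => ?_)
  rw [Real.norm_eq_abs, abs_le]
  have a := Real.add_one_le_exp (f x)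
  have b := Real.add_one_le_exp (-f x)
  have a' := Real.exp_pos (f x)
  have b' := Real.exp_pos (-f x)
  simp only [Pi.add_apply]
  constructor <;> linarith

variable {P : Measure E} [IsProbabilityMeasure P] {ρ : E → E → ℝ} {v : ℝ}

/-- Tensorization of the Laplace bound. -/
theorem LaplaceBound.pi (hP : LaplaceBound P ρ v) {c : ℝ} (hc : 0 ≤ c) (n : ℕ)
    (F : (Fin n → E) → ℝ) (hF : Measurable F)
    (hbd : ∀ x i y, |F x - F (Function.update x i y)| ≤ c * ρ (x i) y) :
    Integrable F (Measure.pi fun _ => P) ∧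
      Integrable (fun x => Real.exp (F x)) (Measure.pi fun _ => P) ∧
      ∫ x, Real.exp (F x) ∂(Measure.pi fun _ => P) ≤
        Real.exp (∫ x, F x ∂(Measure.pi fun _ => P) + n * (c ^ 2 * v / 2)) := by
  induction n with
  | zero =>
    have : IsProbabilityMeasure (Measure.pi fun _ : Fin 0 => P) := inferInstance
    have hconst : F = fun _ => F default := by
      ext x; congr 1; exact Subsingleton.elim _ _
    rw [hconst]
    simp
  | succ n ih =>
    set ν := Measure.pi fun _ : Fin n => P
    set e := MeasurableEquiv.piFinSuccAbove (fun _ : Fin (n + 1) => E) 0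
    have he : MeasurePreserving e (Measure.pi fun _ : Fin (n + 1) => P) (P.prod ν) :=
      measurePreserving_piFinSuccAbove (fun _ : Fin (n + 1) => P) 0
    have hes : ∀ a z, e.symm (a, z) = Fin.cons a z := fun a z => by
      simp [e, MeasurableEquiv.piFinSuccAbove_symm_apply, Fin.insertNthEquiv]
    -- One coordinate is integrated out at a time: its Laplace bound costs c²v/2, and the average G
    -- inherits the increment bounds. The claim is made for every F because it is also applied to
    -- −F: integrability of exp F and exp (−F) yields that of F.
    have key : ∀ F : (Fin (n + 1) → E) → ℝ, Measurable F →
        (∀ x i y, |F x - F (Function.update x i y)| ≤ c * ρ (x i) y) →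
        let G : (Fin n → E) → ℝ := fun z => ∫ a, F (Fin.cons a z) ∂P
        Integrable (fun q => Real.exp (F (e.symm q))) (P.prod ν) ∧
        ∫ q, Real.exp (F (e.symm q)) ∂(P.prod ν) ≤
          Real.exp (∫ z, G z ∂ν + ((n + 1 : ℕ) : ℝ) * (c ^ 2 * v / 2)) := by
      intro F hF hbd G
      have hH : Measurable fun q => F (e.symm q) := hF.comp e.symm.measurable
      have hHe : Measurable fun q => Real.exp (F (e.symm q)) := hH.exp
      have hHc : Measurable fun q : E × (Fin n → E) => F (Fin.cons q.1 q.2) := by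
        simpa only [← hes] using hH
      have hslice : ∀ z : Fin n → E, _ := fun z => hP c (fun a => F (Fin.cons a z)) hc
        (hHc.comp (by fun_prop : Measurable fun a => (a, z))) (fun a b => by
          have := hbd (Fin.cons a z) 0 b
          rwa [Fin.update_cons_zero, Fin.cons_zero] at this)
      have hG : Measurable G := by
        have : StronglyMeasurable fun z => ∫ a, F (Fin.cons a z) ∂P :=
          StronglyMeasurable.integral_prod_left' (f := fun q => F (Fin.cons q.1 q.2))
            hHc.stronglyMeasurable
        exact this.measurable
      have hGbd : ∀ x i y, |G x - G (Function.update x i y)| ≤ c * ρ (x i) y := by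
        intro x i y
        simp only [G]
        rw [← integral_sub (hslice x).1 (hslice _).1]
        have := norm_integral_le_of_norm_le_const (μ := P)
          (f := fun a => F (Fin.cons a x) - F (Fin.cons a (Function.update x i y)))
          (C := c * ρ (x i) y) (Filter.Eventually.of_forall fun a => by
            have := hbd (Fin.cons a x) i.succ y
            rwa [← Fin.cons_update, Fin.cons_succ] at this)
        simpa using this
      obtain ⟨hG1, hG2, hG3⟩ := ih G hG hGbd
      have hGc : Integrable (fun z => Real.exp (G z + c ^ 2 * v / 2)) ν := by
        simp_rw [Real.exp_add]; exact hG2.mul_const _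
      have hint : Integrable (fun q => Real.exp (F (e.symm q))) (P.prod ν) := by
        rw [integrable_prod_iff' hHe.aestronglyMeasurable]
        refine ⟨Filter.Eventually.of_forall fun z => ?_, ?_⟩
        · simp only [hes]; exact (hslice z).2.1
        · refine hGc.mono' ?_ (Filter.Eventually.of_forall fun z => ?_)
          · have : StronglyMeasurable fun z => ∫ a, ‖Real.exp (F (e.symm (a, z)))‖ ∂P :=
              StronglyMeasurable.integral_prod_left'
                (f := fun q : E × (Fin n → E) => ‖Real.exp (F (e.symm q))‖)
                hHe.norm.stronglyMeasurable
            exact this.aestronglyMeasurable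
          · simp only [hes, Real.norm_eq_abs, Real.abs_exp]
            rw [abs_of_nonneg (integral_nonneg fun a => (Real.exp_pos _).le)]
            exact (hslice z).2.2
      refine ⟨hint, ?_⟩
      rw [integral_prod_symm _ hint]
      calc ∫ z, ∫ a, Real.exp (F (e.symm (a, z))) ∂P ∂ν
          ≤ ∫ z, Real.exp (G z + c ^ 2 * v / 2) ∂ν := by
            refine integral_mono hint.integral_prod_right hGc fun z => ?_
            simp only [hes]; exact (hslice z).2.2
        _ = (∫ z, Real.exp (G z) ∂ν) * Real.exp (c ^ 2 * v / 2) := by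
            simp_rw [Real.exp_add]; rw [integral_mul_const]
        _ ≤ _ := by
            refine (mul_le_mul_of_nonneg_right hG3 (Real.exp_pos _).le).trans_eq ?_
            rw [← Real.exp_add]; push_cast; ring_nf
    have hcomp : ∀ F : (Fin (n + 1) → E) → ℝ,
        (fun x => F (e.symm (e x))) = F := fun F => by ext x; simp
    obtain ⟨h1, h2⟩ := key F hF hbd
    obtain ⟨h3, -⟩ := key (fun x => -F x) hF.neg (fun x i y => by
      rw [neg_sub_neg, abs_sub_comm]; exact hbd x i y)
    have hint : Integrable (fun q => F (e.symm q)) (P.prod ν) :=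
      integrable_of_integrable_exp (hF.comp e.symm.measurable).aestronglyMeasurable h1 h3
    have t1 : Integrable F (Measure.pi fun _ => P) := by
      rw [← hcomp F]; exact he.integrable_comp_of_integrable hint
    have t2 : Integrable (fun x => Real.exp (F x)) (Measure.pi fun _ => P) := by
      rw [← hcomp F]; exact he.integrable_comp_of_integrable h1
    refine ⟨t1, t2, ?_⟩
    have e1 : ∫ x, Real.exp (F x) ∂(Measure.pi fun _ : Fin (n + 1) => P) =
        ∫ q, Real.exp (F (e.symm q)) ∂(P.prod ν) := by
      rw [← he.integral_comp e.measurableEmbedding]; simp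
    have e2 : ∫ x, F x ∂(Measure.pi fun _ : Fin (n + 1) => P) =
        ∫ z, ∫ a, F (Fin.cons a z) ∂P ∂ν := by
      rw [← he.symm.integral_comp e.symm.measurableEmbedding, integral_prod_symm _ hint]
      simp only [hes]
    rw [e1, e2]
    exact h2

/-- Only the first n coordinates matter, so the finite product suffices after padding with an
arbitrary point of E. -/
theorem LaplaceBound.infinitePi [Nonempty E] (hP : LaplaceBound P ρ v) {c : ℝ} (hc : 0 ≤ c) (n : ℕ)
    (F : (ℕ → E) → ℝ) (hF : Measurable F)
    (hdep : ∀ x y : ℕ → E, (∀ i < n, x i = y i) → F x = F y)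
    (hbd : ∀ x, ∀ i < n, ∀ y, |F x - F (Function.update x i y)| ≤ c * ρ (x i) y) :
    Integrable F (Measure.infinitePi fun _ => P) ∧
      Integrable (fun x => Real.exp (F x)) (Measure.infinitePi fun _ => P) ∧
      ∫ x, Real.exp (F x) ∂(Measure.infinitePi fun _ => P) ≤
        Real.exp (∫ x, F x ∂(Measure.infinitePi fun _ => P) + n * (c ^ 2 * v / 2)) := by
  obtain ⟨e0⟩ := ‹Nonempty E›
  let ext : (Fin n → E) → ℕ → E := fun z i => if h : i < n then z ⟨i, h⟩ else e0
  have hext : Measurable ext := by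
    refine measurable_pi_lambda _ fun i => ?_
    by_cases h : i < n
    · simp only [ext, h, dite_true]; fun_prop
    · simp only [ext, h, dite_false]; fun_prop
  have hmp := measurePreserving_comp_fin P n
  have hG : Measurable fun z => F (ext z) := hF.comp hext
  have hcomp : ∀ x : ℕ → E, F (ext fun i : Fin n => x i) = F x := fun x =>
    hdep _ _ fun i hi => by simp [ext, hi]
  obtain ⟨h1, h2, h3⟩ := hP.pi hc n (fun z => F (ext z)) hG (fun z i y => by
    have h := hbd (ext z) i i.2 y
    have e1 : ext (Function.update z i y) = Function.update (ext z) i y := by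
      ext k
      by_cases hk : k = i
      · subst hk; simp [ext]
      · rw [Function.update_of_ne hk]
        by_cases hkn : k < n
        · simp only [ext, hkn, dite_true]
          rw [Function.update_of_ne]
          intro h; exact hk (by rw [← h])
        · simp [ext, hkn]
    have e2 : ext z i = z i := by simp [ext]
    rw [e1, ← e2]; exact h)
  have i1 := hmp.integrable_comp_of_integrable h1
  have i2 := hmp.integrable_comp_of_integrable h2
  simp only [Function.comp_def, hcomp] at i1 i2
  refine ⟨i1, i2, ?_⟩
  have e1 : ∫ z, Real.exp (F (ext z)) ∂(Measure.pi fun _ : Fin n => P) =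
      ∫ x, Real.exp (F x) ∂(Measure.infinitePi fun _ => P) := by
    rw [← hmp.map_eq, integral_map hmp.aemeasurable
      hG.exp.aestronglyMeasurable]
    simp only [hcomp]
  have e2 : ∫ z, F (ext z) ∂(Measure.pi fun _ : Fin n => P) =
      ∫ x, F x ∂(Measure.infinitePi fun _ => P) := by
    rw [← hmp.map_eq, integral_map hmp.aemeasurable hG.aestronglyMeasurable]
    simp only [hcomp]
  rwa [e1, e2] at h3

end Laplace

/-! ### Time-uniform tail bounds. -/

section TimeUniform

variable {E : Type*} [MeasurableSpace E] {P : Measure E} [IsProbabilityMeasure P]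

/-- Time-uniform Chernoff bound for reverse submartingales. -/
theorem time_uniform_chernoff {F : ℕ → (ℕ → E) → ℝ} {s : ℕ}
    (hm : ∀ t, s ≤ t → Measurable (F t)) (hinv : ∀ t, s ≤ t → SwapInvariant t (F t))
    (hsub : ∀ t, s ≤ t → ∀ x, F (t + 1) x ≤ ((t + 1 : ℕ) : ℝ)⁻¹ *
      ∑ i ∈ Finset.range (t + 1), F t (fun k => x (Equiv.swap i t k)))
    {a w : ℝ} (hw : 0 < w)
    (hmgf : ∀ r : ℝ, 0 ≤ r → ∫⁻ x, ENNReal.ofReal (Real.exp (r * F s x))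
      ∂(Measure.infinitePi fun _ => P) ≤ ENNReal.ofReal (Real.exp (r * a + r ^ 2 * w / 2)))
    {u : ℝ} (hu : 0 ≤ u) :
    (Measure.infinitePi fun _ => P) {x | ∃ t, s ≤ t ∧ a + u ≤ F t x} ≤
      ENNReal.ofReal (Real.exp (-(u ^ 2 / (2 * w)))) := by
  -- This r minimizes −r u + r² w / 2.
  set r := u / w with hr
  have hr0 : 0 ≤ r := by positivity
  have hmax := maximal_ineq P (f := fun t x => ENNReal.ofReal (Real.exp (r * F t x))) (s := s)
    (fun t ht => ((hm t ht).const_mul r).exp.ennreal_ofReal)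
    (fun t ht i j hi hj x => by simp only [hinv t ht i j hi hj x])
    (fun t ht x => by
      have hpos : (0 : ℝ) < ((t + 1 : ℕ) : ℝ) := by positivity
      have hjensen := convexOn_exp.map_sum_le (t := Finset.range (t + 1))
        (w := fun _ => ((t + 1 : ℕ) : ℝ)⁻¹)
        (p := fun i => r * F t (fun k => x (Equiv.swap i t k)))
        (fun _ _ => by positivity) (by simp; field_simp) (fun _ _ => Set.mem_univ _)
      simp only [smul_eq_mul, ← Finset.mul_sum] at hjensen
      have h1 : Real.exp (r * F (t + 1) x) ≤ ((t + 1 : ℕ) : ℝ)⁻¹ *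
          ∑ i ∈ Finset.range (t + 1), Real.exp (r * F t (fun k => x (Equiv.swap i t k))) := by
        refine le_trans (Real.exp_le_exp.2 ?_) hjensen
        rw [mul_left_comm]
        exact mul_le_mul_of_nonneg_left (hsub t ht x) hr0
      refine (ENNReal.ofReal_le_ofReal h1).trans_eq ?_
      rw [ENNReal.ofReal_mul (by positivity), ENNReal.ofReal_inv_of_pos hpos,
        ENNReal.ofReal_natCast, ENNReal.ofReal_sum_of_nonneg (fun _ _ => (Real.exp_pos _).le)])
    (ENNReal.ofReal (Real.exp (r * (a + u))))
  have hsubset : {x | ∃ t, s ≤ t ∧ a + u ≤ F t x} ⊆ {x | ∃ t, s ≤ t ∧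
      ENNReal.ofReal (Real.exp (r * (a + u))) ≤ ENNReal.ofReal (Real.exp (r * F t x))} := by
    rintro x ⟨t, ht, h⟩
    exact ⟨t, ht, ENNReal.ofReal_le_ofReal (Real.exp_le_exp.2 (mul_le_mul_of_nonneg_left h hr0))⟩
  have hc0 : ENNReal.ofReal (Real.exp (r * (a + u))) ≠ 0 := by simp [Real.exp_pos]
  refine (measure_mono hsubset).trans ?_
  have := (hmax.trans (hmgf r hr0))
  rw [mul_comm, ← ENNReal.le_div_iff_mul_le (Or.inl hc0) (Or.inl ENNReal.ofReal_ne_top),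
    ← ENNReal.ofReal_div_of_pos (Real.exp_pos _), ← Real.exp_sub] at this
  refine this.trans_eq ?_
  congr 2
  rw [hr]; field_simp; ring

/-- Time-uniform deviation bound for symmetric convex functionals with bounded increments. -/
theorem time_uniform_tail [Nonempty E] {ρ : E → E → ℝ} {v : ℝ} (hv : 0 < v)
    (hP : LaplaceBound P ρ v) {F : ℕ → (ℕ → E) → ℝ}
    (hm : ∀ t, 1 ≤ t → Measurable (F t)) (hinv : ∀ t, 1 ≤ t → SwapInvariant t (F t))
    (hdep : ∀ t, 1 ≤ t → ∀ x y : ℕ → E, (∀ i < t, x i = y i) → F t x = F t y)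
    (hbd : ∀ t, 1 ≤ t → ∀ x, ∀ i < t, ∀ y,
      |F t x - F t (Function.update x i y)| ≤ (t : ℝ)⁻¹ * ρ (x i) y)
    (hsub : ∀ t, 1 ≤ t → ∀ x, F (t + 1) x ≤ ((t + 1 : ℕ) : ℝ)⁻¹ *
      ∑ i ∈ Finset.range (t + 1), F t (fun k => x (Equiv.swap i t k)))
    {a : ℝ} (hmean : ∀ t, 1 ≤ t → ∫ x, F t x ∂(Measure.infinitePi fun _ => P) ≤ a / √t)
    {s : ℕ} (hs : 1 ≤ s) {u : ℝ} (hu : 0 ≤ u) :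
    (Measure.infinitePi fun _ => P) {x | ∃ t, s ≤ t ∧ a / √s + u ≤ F t x} ≤
      ENNReal.ofReal (Real.exp (-(u ^ 2 * s / (2 * v)))) := by
  have hs0 : (0 : ℝ) < s := by exact_mod_cast hs
  have h := time_uniform_chernoff (P := P) (F := F) (s := s) (a := a / √s) (w := v / s)
    (fun t ht => hm t (hs.trans ht)) (fun t ht => hinv t (hs.trans ht))
    (fun t ht => hsub t (hs.trans ht)) (by positivity) (fun r hr => by
      -- The s increments of r F_s have constant r/s each, for a total of s (r/s)² v/2: the variance
      -- proxy is v/s.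
      obtain ⟨-, h2, h3⟩ := hP.infinitePi (c := r / s) (by positivity) s (fun x => r * F s x)
        ((hm s hs).const_mul r) (fun x y hxy => by rw [hdep s hs x y hxy]) (fun x i hi y => by
          rw [← mul_sub, abs_mul, abs_of_nonneg hr, div_eq_mul_inv, mul_assoc]
          exact mul_le_mul_of_nonneg_left (hbd s hs x i hi y) hr)
      rw [← ofReal_integral_eq_lintegral_ofReal h2
        (Filter.Eventually.of_forall fun _ => (Real.exp_pos _).le)]
      refine ENNReal.ofReal_le_ofReal (h3.trans (Real.exp_le_exp.2 ?_))
      rw [integral_const_mul]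
      have e : (s : ℝ) * ((r / s) ^ 2 * v / 2) = r ^ 2 * (v / s) / 2 := by field_simp
      rw [e]
      exact add_le_add_left (mul_le_mul_of_nonneg_left (hmean s hs) hr) _) hu
  refine h.trans_eq ?_
  congr 3
  field_simp

end TimeUniform

/-! ### Stitching over dyadic epochs. -/

section Stitching

variable {α : Type*} [MeasurableSpace α] {Q : Measure α} {F : ℕ → α → ℝ} {a v : ℝ}

/-- With L = log m + log (1/δ), the deviation satisfies u√s = √(2vq) + √(2vL), whose square is at
least 2v(q + L). The room between the boundary and the mean thus becomes the factor exp (−q). -/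
theorem epoch_bound (hv : 0 < v)
    (htail : ∀ s : ℕ, 1 ≤ s → ∀ u : ℝ, 0 ≤ u → Q {x | ∃ t, s ≤ t ∧ a / √s + u ≤ F t x} ≤
      ENNReal.ofReal (Real.exp (-(u ^ 2 * s / (2 * v)))))
    {b : ℕ → ℝ} {s : ℕ} (hs : 1 ≤ s) {S : Set ℕ} (hS : ∀ t ∈ S, s ≤ t) {q m δ : ℝ}
    (hq : 0 ≤ q) (hm : 1 ≤ m) (hδ : 0 < δ) (hδ1 : δ < 1)
    (hb : ∀ t ∈ S, a / √s +
      (√(2 * v * q) + √(2 * v) * √(Real.log m + Real.log (1 / δ))) / √s ≤ b t) :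
    Q {x | ∃ t ∈ S, b t ≤ F t x} ≤ ENNReal.ofReal (Real.exp (-q) * (δ * (1 / m))) := by
  set L := Real.log m + Real.log (1 / δ) with hL
  have hL0 : 0 ≤ L := add_nonneg (Real.log_nonneg hm)
    (Real.log_nonneg (by rw [le_div_iff₀ hδ]; linarith))
  have hs0 : (0 : ℝ) < s := by exact_mod_cast hs
  have hm0 : 0 < m := by linarith
  set u := (√(2 * v * q) + √(2 * v) * √L) / √s with hu
  have hsub : {x | ∃ t ∈ S, b t ≤ F t x} ⊆ {x | ∃ t, s ≤ t ∧ a / √s + u ≤ F t x} := by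
    rintro x ⟨t, ht, h⟩
    exact ⟨t, hS t ht, (hb t ht).trans h⟩
  refine (measure_mono hsub).trans ((htail s hs u (by positivity)).trans ?_)
  refine ENNReal.ofReal_le_ofReal ?_
  have e : δ * (1 / m) = Real.exp (-L) := by
    rw [hL, Real.exp_neg, Real.exp_add, Real.exp_log hm0, Real.exp_log (by positivity)]
    field_simp
  rw [e, ← Real.exp_add, Real.exp_le_exp]
  have h1 : u ^ 2 * s = (√(2 * v * q) + √(2 * v) * √L) ^ 2 := by
    rw [hu, div_pow, Real.sq_sqrt hs0.le]; field_simp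
  have h2 : 2 * v * (q + L) ≤ (√(2 * v * q) + √(2 * v) * √L) ^ 2 := by
    have a1 : √(2 * v * q) ^ 2 = 2 * v * q := Real.sq_sqrt (by positivity)
    have a2 : (√(2 * v) * √L) ^ 2 = 2 * v * L := by
      rw [mul_pow, Real.sq_sqrt (by positivity), Real.sq_sqrt hL0]
    have a3 : 0 ≤ √(2 * v * q) * (√(2 * v) * √L) := by positivity
    nlinarith
  have h3 : q + L ≤ u ^ 2 * s / (2 * v) := by
    rw [le_div_iff₀ (by positivity), h1]; linarith
  linarith

/-- The second-order Taylor bound gives e^{1/3} ≥ 25/18 here and e^{3/2} ≥ 29/8 ≥ 25/7 below. The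
resulting bounds 18/25 and 7/25 add up to exactly 1. -/
theorem exp_neg_third_le : Real.exp (-(1 / 3)) ≤ 18 / 25 := by
  have h := Real.quadratic_le_exp_of_nonneg (x := 1 / 3) (by norm_num)
  rw [Real.exp_neg, inv_le_comm₀ (Real.exp_pos _) (by norm_num)]
  refine le_trans ?_ h
  norm_num

theorem exp_neg_three_halves_le : Real.exp (-(3 / 2)) ≤ 7 / 25 := by
  have h := Real.quadratic_le_exp_of_nonneg (x := 3 / 2) (by norm_num)
  rw [Real.exp_neg, inv_le_comm₀ (Real.exp_pos _) (by norm_num)]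
  refine le_trans ?_ h
  norm_num

/-- Stitching the tail bounds over dyadic epochs. -/
theorem stitched_bound (hv : 0 < v)
    (htail : ∀ s : ℕ, 1 ≤ s → ∀ u : ℝ, 0 ≤ u → Q {x | ∃ t, s ≤ t ∧ a / √s + u ≤ F t x} ≤
      ENNReal.ofReal (Real.exp (-(u ^ 2 * s / (2 * v)))))
    {ℓ : ℝ → ℝ} (hℓ : IsStitching ℓ) {c k δ : ℝ} (hδ : 0 < δ) (hδ1 : δ < 1) (hc : 0 ≤ c)
    (hk : 2 * √v ≤ k) (hca : √(3 * v) ≤ c - a) (hca' : √(2 * v / 3) ≤ c / √2 - a)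
    {b : ℕ → ℝ} (hb : ∀ t : ℕ, 1 ≤ t → b t = c / √t +
      k * √((Real.log (ℓ (Real.logb 2 t)) + Real.log (1 / δ)) / t))
    (h : MonotoneOn ℓ (Set.Ici 0) ∨ AntitoneOn b (Set.Ici 1)) :
    Q {x | ∃ t : ℕ, 1 ≤ t ∧ b t ≤ F t x} ≤ ENNReal.ofReal δ := by
  have hk0 : 0 ≤ k := le_trans (by positivity) hk
  have hlogδ : 0 ≤ Real.log (1 / δ) := Real.log_nonneg (by rw [le_div_iff₀ hδ]; linarith)
  have hℓ1 : ∀ j : ℕ, 1 ≤ ℓ ((j : ℝ) + 1) := fun j => hℓ.one_le _ (by positivity)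
  have hsumδ : ∑' j : ℕ, ENNReal.ofReal (Real.exp (-(1 / 3)) * (δ * (1 / ℓ ((j : ℝ) + 1)))) ≤
      ENNReal.ofReal (18 / 25 * δ) := by
    rw [← ENNReal.ofReal_tsum_of_nonneg (fun j => by have := hℓ1 j; positivity)
      ((hℓ.summable.mul_left δ).mul_left _), tsum_mul_left, tsum_mul_left]
    refine ENNReal.ofReal_le_ofReal ?_
    have h0 : 0 ≤ ∑' j : ℕ, 1 / ℓ ((j : ℝ) + 1) :=
      tsum_nonneg fun j => by have := hℓ1 j; positivity
    have := hℓ.tsum_le_one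
    exact mul_le_mul exp_neg_third_le (by nlinarith) (by positivity) (by norm_num)
  -- The tail bound starts at 2^i while the boundary is compared with its value at 2^(i+1). This
  -- costs √2, whence c/√2 in `hca'` and 2√v rather than √(2v) in `hk`. The room granted by `hca'`
  -- corresponds to q = 1/3.
  have hepoch : ∀ (i : ℕ) (m : ℝ), 1 ≤ m →
      (∀ t : ℕ, 2 ^ i ≤ t → t < 2 ^ (i + 1) → c / √(2 ^ (i + 1) : ℝ) +
        k * √((Real.log m + Real.log (1 / δ)) / 2 ^ (i + 1)) ≤ b t) →
      Q {x | ∃ t ∈ {t : ℕ | 2 ^ i ≤ t ∧ t < 2 ^ (i + 1)}, b t ≤ F t x} ≤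
        ENNReal.ofReal (Real.exp (-(1 / 3)) * (δ * (1 / m))) := by
    intro i m hm hbt
    refine epoch_bound hv htail (s := 2 ^ i) Nat.one_le_two_pow (fun t ht => ht.1) (by norm_num)
      hm hδ hδ1 fun t ht => le_trans ?_ (hbt t ht.1 ht.2)
    set L := Real.log m + Real.log (1 / δ)
    have hL0 : 0 ≤ L := add_nonneg (Real.log_nonneg hm) hlogδ
    have e1 : √(2 ^ (i + 1) : ℝ) = √2 * √(2 ^ i : ℝ) := by
      rw [pow_succ', Real.sqrt_mul (by norm_num)]
    have hpos : 0 < √(2 ^ i : ℝ) := by positivity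
    rw [Real.sqrt_div hL0, e1, Nat.cast_pow, Nat.cast_ofNat, ← add_div]
    have e2 : c / (√2 * √(2 ^ i : ℝ)) + k * (√L / (√2 * √(2 ^ i : ℝ))) =
        (c / √2 + k / √2 * √L) / √(2 ^ i : ℝ) := by
      field_simp
    rw [e2]
    refine div_le_div_of_nonneg_right ?_ hpos.le
    have e3 : √(2 * v * (1 / 3)) = √(2 * v / 3) := by congr 1; ring
    have e4 : √(2 * v) ≤ k / √2 := by
      rw [le_div_iff₀ (by positivity), Real.sqrt_mul (by norm_num)]
      have := Real.mul_self_sqrt (show (0 : ℝ) ≤ 2 by norm_num)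
      nlinarith
    have := mul_le_mul_of_nonneg_right e4 (Real.sqrt_nonneg L)
    rw [e3]
    linarith
  have hlog : ∀ t : ℕ, 1 ≤ t → 2 ^ Nat.log 2 t ≤ t ∧ t < 2 ^ (Nat.log 2 t + 1) := fun t ht =>
    ⟨Nat.pow_log_le_self 2 (by omega), Nat.lt_pow_succ_log_self (by norm_num) t⟩
  rcases h with hmono | hanti
  -- For nondecreasing ℓ the epoch starting at 2^(j+1) has ℓ(log₂ t) ≥ ℓ(j+1) and uses up the weight
  -- 1/ℓ(j+1). The epoch {1} is left over and needs its own budget.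
  · have hcover : {x | ∃ t : ℕ, 1 ≤ t ∧ b t ≤ F t x} ⊆
        {x | ∃ t ∈ ({1} : Set ℕ), b t ≤ F t x} ∪
          ⋃ j : ℕ, {x | ∃ t ∈ {t : ℕ | 2 ^ (j + 1) ≤ t ∧ t < 2 ^ (j + 1 + 1)}, b t ≤ F t x} := by
      rintro x ⟨t, ht, hx⟩
      rcases eq_or_lt_of_le ht with h1 | h1
      · exact Or.inl ⟨t, h1.symm, hx⟩
      · refine Or.inr (Set.mem_iUnion.2 ⟨Nat.log 2 t - 1, t, ?_, hx⟩)
        have h2 : 1 ≤ Nat.log 2 t := Nat.log_pos (by norm_num) h1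
        rw [Set.mem_ofPred_eq, Nat.sub_add_cancel h2]
        exact hlog t ht
    -- At t = 1 no factor √2 is lost, so `hca` affords q = 3/2. The relevant weight is ℓ(log₂ 1) =
    -- ℓ(0) = ℓ(1).
    have hfirst : Q {x | ∃ t ∈ ({1} : Set ℕ), b t ≤ F t x} ≤
        ENNReal.ofReal (Real.exp (-(3 / 2)) * (δ * (1 / ℓ 1))) := by
      refine epoch_bound hv htail (s := 1) le_rfl (fun t ht => (show t = 1 from ht).ge)
        (by norm_num) (hℓ.one_le 1 (by norm_num)) hδ hδ1 fun t ht => ?_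
      obtain rfl : t = 1 := ht
      rw [hb 1 le_rfl]
      simp only [Nat.cast_one, Real.logb_one, Real.sqrt_one, div_one,
        hℓ.eq_of_le_one 0 le_rfl zero_le_one]
      have e3 : √(2 * v * (3 / 2)) = √(3 * v) := by congr 1; ring
      have e4 : √(2 * v) ≤ k := by
        refine le_trans ?_ hk
        rw [Real.sqrt_mul (by norm_num)]
        exact mul_le_mul_of_nonneg_right (by rw [Real.sqrt_le_left] <;> norm_num)
          (Real.sqrt_nonneg _)
      have := mul_le_mul_of_nonneg_right e4 (Real.sqrt_nonneg (Real.log (ℓ 1) + Real.log (1 / δ)))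
      rw [e3]
      linarith
    have hrest : ∀ j : ℕ,
        Q {x | ∃ t ∈ {t : ℕ | 2 ^ (j + 1) ≤ t ∧ t < 2 ^ (j + 1 + 1)}, b t ≤ F t x} ≤
          ENNReal.ofReal (Real.exp (-(1 / 3)) * (δ * (1 / ℓ ((j : ℝ) + 1)))) := by
      intro j
      refine hepoch (j + 1) _ (hℓ1 j) fun t ht1 ht2 => ?_
      have ht : 1 ≤ t := Nat.one_le_two_pow.trans ht1
      have ht0 : (0 : ℝ) < t := by exact_mod_cast ht
      rw [hb t ht]
      have hle : (t : ℝ) ≤ 2 ^ (j + 1 + 1) := by exact_mod_cast ht2.le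
      have hge : (j : ℝ) + 1 ≤ Real.logb 2 t := by
        rw [Real.le_logb_iff_rpow_le (by norm_num) ht0]
        have : ((2 ^ (j + 1) : ℕ) : ℝ) ≤ t := by exact_mod_cast ht1
        refine le_trans (le_of_eq ?_) this
        push_cast
        rw [← Real.rpow_natCast]; push_cast; rfl
      have hℓle : ℓ ((j : ℝ) + 1) ≤ ℓ (Real.logb 2 t) :=
        hmono (Set.mem_Ici.2 (by positivity)) (Set.mem_Ici.2 (le_trans (by positivity) hge)) hge
      have hlogle : Real.log (ℓ ((j : ℝ) + 1)) ≤ Real.log (ℓ (Real.logb 2 t)) :=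
        Real.log_le_log (by linarith [hℓ1 j]) hℓle
      have hl0 : 0 ≤ Real.log (ℓ ((j : ℝ) + 1)) := Real.log_nonneg (hℓ1 j)
      gcongr
      linarith
    refine (measure_mono hcover).trans ((measure_union_le _ _).trans ?_)
    refine (add_le_add hfirst ((measure_iUnion_le _).trans
      ((ENNReal.tsum_le_tsum hrest).trans hsumδ))).trans ?_
    have hl1 := hℓ.one_le 1 (by norm_num)
    have hl1' : 1 / ℓ 1 ≤ 1 := by rw [div_le_one (by linarith)]; exact hl1
    have hl0 : 0 ≤ 1 / ℓ 1 := by positivity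
    rw [← ENNReal.ofReal_add (by positivity) (by positivity)]
    refine ENNReal.ofReal_le_ofReal ?_
    have := mul_le_mul exp_neg_three_halves_le (show δ * (1 / ℓ 1) ≤ δ by nlinarith)
      (by positivity) (by norm_num)
    linarith
  -- For a nonincreasing boundary, b on the epoch of 2^j is at least its value at 2^(j+1), where
  -- log₂ is exactly j + 1. The weights 1/ℓ(1), 1/ℓ(2), … then serve all epochs, including {1}.
  · have hcover : {x | ∃ t : ℕ, 1 ≤ t ∧ b t ≤ F t x} ⊆
        ⋃ j : ℕ, {x | ∃ t ∈ {t : ℕ | 2 ^ j ≤ t ∧ t < 2 ^ (j + 1)}, b t ≤ F t x} := by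
      rintro x ⟨t, ht, hx⟩
      exact Set.mem_iUnion.2 ⟨Nat.log 2 t, t, hlog t ht, hx⟩
    refine (measure_mono hcover).trans ((measure_iUnion_le _).trans
      ((ENNReal.tsum_le_tsum fun j => hepoch j (ℓ ((j : ℝ) + 1)) (hℓ1 j) ?_).trans
        (hsumδ.trans (ENNReal.ofReal_le_ofReal (by linarith)))))
    intro t ht1 ht2
    have ht : 1 ≤ t := Nat.one_le_two_pow.trans ht1
    refine le_trans (le_of_eq ?_) (hanti (Set.mem_Ici.2 ht)
      (Set.mem_Ici.2 (Nat.one_le_two_pow (n := j + 1))) ht2.le)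
    rw [hb _ Nat.one_le_two_pow]
    have : Real.logb 2 ((2 ^ (j + 1) : ℕ) : ℝ) = (j : ℝ) + 1 := by
      push_cast
      rw [← Real.rpow_natCast, Real.logb_rpow (by norm_num) (by norm_num)]; push_cast; rfl
    rw [this]
    push_cast
    rfl

end Stitching

/-! ### Laplace bounds from bounded oscillation and from T₁. -/

section LaplaceCriteria

open Filter Topology

variable {E : Type*} [MeasurableSpace E] {P : Measure E} [IsProbabilityMeasure P]

/-- Hoeffding's lemma for functions of oscillation at most `c`. -/
theorem laplaceBound_one : LaplaceBound P (fun _ _ => 1) (1 / 4) := by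
  intro c f hc hf hbd
  obtain ⟨x₀⟩ : Nonempty E := nonempty_of_isProbabilityMeasure P
  simp only [mul_one] at hbd
  have hbb : BddBelow (Set.range f) := ⟨f x₀ - c, by
    rintro _ ⟨x, rfl⟩
    have := (abs_le.1 (hbd x x₀)).1
    linarith⟩
  have : Nonempty E := ⟨x₀⟩
  have hmem : ∀ x, f x ∈ Set.Icc (⨅ y, f y) ((⨅ y, f y) + c) := fun x =>
    ⟨ciInf_le hbb x, by
      rw [← sub_le_iff_le_add]
      exact le_ciInf fun y => by have := (abs_le.1 (hbd x y)).2; linarith⟩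
  -- The range lies in an interval of length c, so the variance proxy is (c/2)² = c² · 1/4.
  have hsub := hasSubgaussianMGF_of_mem_Icc (μ := P) hf.aemeasurable (Eventually.of_forall hmem)
  have hint : Integrable f P := by
    refine (integrable_const (|f x₀| + c)).mono' hf.aestronglyMeasurable
      (Eventually.of_forall fun x => ?_)
    have h1 := hbd x x₀
    have h2 := abs_sub_abs_le_abs_sub (f x) (f x₀)
    rw [Real.norm_eq_abs]; linarith
  set m := ∫ x, f x ∂P
  have e : (fun x => Real.exp (f x)) = fun x => Real.exp m * Real.exp (1 * (f x - m)) := by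
    ext x; rw [← Real.exp_add]; ring_nf
  refine ⟨hint, ?_, ?_⟩
  · rw [e]; exact (hsub.integrable_exp_mul 1).const_mul _
  · rw [e, integral_const_mul, Real.exp_add]
    refine mul_le_mul_of_nonneg_left ?_ (Real.exp_pos _).le
    refine (hsub.mgf_le 1).trans_eq ?_
    congr 1
    simp only [add_sub_cancel_left, NNReal.coe_pow, NNReal.coe_div, coe_nnnorm, Real.norm_eq_abs,
      NNReal.coe_ofNat, abs_of_nonneg hc]
    ring

variable [PseudoMetricSpace E]

/-- The easy half of Kantorovich duality: integrate f(x) − f(y) against any coupling. -/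
theorem ofReal_integral_sub_le_wasserstein1 {ν : Measure E} [IsProbabilityMeasure ν]
    {f : E → ℝ} {c : ℝ} (hc : 0 ≤ c) (hf : Measurable f)
    (hbd : ∀ x y, |f x - f y| ≤ c * dist x y) (hν : Integrable f ν) (hP : Integrable f P) :
    ENNReal.ofReal (∫ x, f x ∂ν - ∫ x, f x ∂P) ≤ ENNReal.ofReal c * wasserstein1 ν P := by
  have hmain : ∀ π : Measure (E × E), π.map Prod.fst = ν → π.map Prod.snd = P →
      ENNReal.ofReal (∫ x, f x ∂ν - ∫ x, f x ∂P) ≤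
        ENNReal.ofReal c * ∫⁻ z, edist z.1 z.2 ∂π := by
    rintro π rfl rfl
    rw [integral_map measurable_fst.aemeasurable hf.aestronglyMeasurable,
      integral_map measurable_snd.aemeasurable hf.aestronglyMeasurable]
    have h1 : Integrable (fun z : E × E => f z.1) π := hν.comp_measurable measurable_fst
    have h2 : Integrable (fun z : E × E => f z.2) π := hP.comp_measurable measurable_snd
    rw [← integral_sub h1 h2, ← lintegral_const_mul' _ _ ENNReal.ofReal_ne_top]
    calc ENNReal.ofReal (∫ z, (f z.1 - f z.2) ∂π)
        ≤ ENNReal.ofReal ‖∫ z, (f z.1 - f z.2) ∂π‖ :=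
          ENNReal.ofReal_le_ofReal (Real.le_norm_self _)
      _ ≤ ∫⁻ z, ‖f z.1 - f z.2‖ₑ ∂π := by
          rw [ofReal_norm]; exact enorm_integral_le_lintegral_enorm _
      _ ≤ _ := by
          refine lintegral_mono fun z => ?_
          rw [edist_dist, ← ENNReal.ofReal_mul hc, ← ofReal_norm]
          exact ENNReal.ofReal_le_ofReal (hbd _ _)
  rw [wasserstein1, transportCost]
  -- A zero factor cannot be moved inside the infimum, because the inner infimum over a false
  -- condition is ∞; the product coupling settles that case.
  by_cases h0 : ENNReal.ofReal c = 0
  · have hw := hmain (ν.prod P) (by simp [Measure.map_fst_prod]) (by simp [Measure.map_snd_prod])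
    simpa [h0] using hw
  · rw [ENNReal.mul_iInf_of_ne h0 ENNReal.ofReal_ne_top]
    refine le_iInf fun π => ?_
    rw [ENNReal.mul_iInf_of_ne h0 ENNReal.ofReal_ne_top]
    refine le_iInf fun h1 => ?_
    rw [ENNReal.mul_iInf_of_ne h0 ENNReal.ofReal_ne_top]
    exact le_iInf fun h2 => hmain π h1 h2

/-- Bobkov–Götze argument: for the tilted law ν = e^f P / Z one has K = KL(ν‖P) = ∫ f dν − log Z. T₁
gives ∫ f dν − ∫ f dP ≤ c√(2vK) ≤ c²v/2 + K, and ∫ f dν cancels. Boundedness of f makes the density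
of ν bounded, so ν has a finite first moment. -/
theorem SatisfiesT1.laplace_of_bounded {v : ℝ} (hv : 0 < v) (h : SatisfiesT1 P v) {f : E → ℝ}
    {c M : ℝ} (hc : 0 ≤ c) (hf : Measurable f) (hbd : ∀ x y, |f x - f y| ≤ c * dist x y)
    (hM : ∀ x, |f x| ≤ M) :
    ∫ x, Real.exp (f x) ∂P ≤ Real.exp (∫ x, f x ∂P + c ^ 2 * v / 2) := by
  have hint : ∀ μ : Measure E, IsProbabilityMeasure μ → Integrable f μ := fun μ _ =>
    (integrable_const M).mono' hf.aestronglyMeasurable (Eventually.of_forall hM)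
  have hexp : Integrable (fun x => Real.exp (f x)) P :=
    (integrable_const (Real.exp M)).mono' hf.exp.aestronglyMeasurable
      (Eventually.of_forall fun x => by
        rw [Real.norm_eq_abs, Real.abs_exp]; exact Real.exp_le_exp.2 (le_of_abs_le (hM x)))
  set Z := ∫ x, Real.exp (f x) ∂P with hZ
  have hZ0 : 0 < Z := integral_exp_pos hexp
  set ν := P.tilted f with hν
  have hνp : IsProbabilityMeasure ν := isProbabilityMeasure_tilted hexp
  obtain ⟨⟨x₀, hx₀⟩, hT⟩ := h
  have hmom : FiniteFirstMoment ν := by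
    refine ⟨x₀, ?_⟩
    rw [hν, lintegral_tilted]
    refine ne_top_of_le_ne_top (b := ∫⁻ x, ENNReal.ofReal (Real.exp M / Z) * edist x x₀ ∂P) ?_ ?_
    · rw [lintegral_const_mul' _ _ ENNReal.ofReal_ne_top]
      exact ENNReal.mul_ne_top ENNReal.ofReal_ne_top hx₀
    · refine lintegral_mono fun x => ?_
      refine mul_le_mul_left (ENNReal.ofReal_le_ofReal ?_) _
      exact div_le_div_of_nonneg_right (Real.exp_le_exp.2 (le_of_abs_le (hM x))) hZ0.le
  have hac : ν ≪ P := tilted_absolutelyContinuous P f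
  have hllr : llr ν P =ᵐ[ν] fun x => f x - Real.log Z :=
    hac.ae_le (log_rnDeriv_tilted_left_self hexp)
  have hllri : Integrable (llr ν P) ν :=
    ((hint ν hνp).sub (integrable_const (Real.log Z))).congr hllr.symm
  set K := ∫ x, f x ∂ν - Real.log Z with hK
  have hKeq : ∫ x, llr ν P x ∂ν = K := by
    rw [integral_congr_ae hllr, integral_sub (hint ν hνp) (integrable_const _)]
    simp [hK]
  have hkl : InformationTheory.klDiv ν P = ENNReal.ofReal K := by
    rw [InformationTheory.klDiv_of_ac_of_integrable hac hllri, hKeq]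
    simp
  have hK0 : 0 ≤ K := by
    have := InformationTheory.integral_llr_add_sub_measure_univ_nonneg hac hllri
    rw [hKeq] at this
    simpa using this
  have hW := hT ν hνp hmom
  rw [hkl, ← ENNReal.ofReal_mul (by positivity), ENNReal.ofReal_rpow_of_nonneg (by positivity)
    (by norm_num), ← Real.sqrt_eq_rpow] at hW
  have hΔ := ofReal_integral_sub_le_wasserstein1 (P := P) hc hf hbd (hint ν hνp) (hint P inferInstance)
  have h1 := hΔ.trans (mul_le_mul_right hW _)
  rw [← ENNReal.ofReal_mul hc, ENNReal.ofReal_le_ofReal_iff (by positivity)] at h1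
  have h2 : c * √(2 * v * K) ≤ c ^ 2 * v / 2 + K := by
    have e1 : √(2 * v * K) = √(2 * v) * √K := Real.sqrt_mul (by positivity) _
    have e2 := Real.sq_sqrt (show 0 ≤ 2 * v by positivity)
    have e3 := Real.sq_sqrt hK0
    rw [e1]
    nlinarith [sq_nonneg (c * √(2 * v) / 2 - √K)]
  rw [← Real.log_le_iff_le_exp hZ0]
  linarith

variable [OpensMeasurableSpace E]

theorem SatisfiesT1.integrable_of_lipschitz {v : ℝ} (h : SatisfiesT1 P v) {f : E → ℝ}
    {c : ℝ} (hf : Measurable f) (hbd : ∀ x y, |f x - f y| ≤ c * dist x y) :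
    Integrable f P := by
  obtain ⟨⟨x₀, hx₀⟩, -⟩ := h
  have hd : Integrable (fun x => dist x x₀) P := by
    refine ⟨(continuous_id.dist continuous_const).measurable.aestronglyMeasurable, ?_⟩
    rw [hasFiniteIntegral_iff_ofReal (Eventually.of_forall fun _ => dist_nonneg)]
    simp_rw [← edist_dist]
    exact lt_top_iff_ne_top.2 hx₀
  refine ((integrable_const |f x₀|).add (hd.const_mul c)).mono' hf.aestronglyMeasurable
    (Eventually.of_forall fun x => ?_)
  have h1 := hbd x x₀
  have h2 := abs_sub_abs_le_abs_sub (f x) (f x₀)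
  simp only [Pi.add_apply, Real.norm_eq_abs]; linarith

/-- The transportation inequality `T₁` implies sub-Gaussianity of Lipschitz functions. -/
theorem SatisfiesT1.laplaceBound {v : ℝ} (hv : 0 < v) (h : SatisfiesT1 P v) :
    LaplaceBound P (fun x y => dist x y) v := by
  intro c f hc hf hbd
  have hint := h.integrable_of_lipschitz hf hbd
  -- Truncation keeps the Lipschitz constant. The means converge by domination by |f|; for the
  -- exponentials only Fatou's lemma is available, since exp f is not yet known to be integrable.
  set g : ℕ → E → ℝ := fun n x => max (-(n : ℝ)) (min (n : ℝ) (f x)) with hg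
  have hgm : ∀ n, Measurable (g n) := fun n => measurable_const.max (measurable_const.min hf)
  have hgabs : ∀ n x, |g n x| ≤ |f x| := by
    intro n x
    have hn : (0 : ℝ) ≤ n := n.cast_nonneg
    simp only [hg, abs_le]
    constructor
    · exact le_max_of_le_right (le_min (by have := abs_nonneg (f x); linarith) (neg_abs_le _))
    · exact max_le (by have := abs_nonneg (f x); linarith) (min_le_of_right_le (le_abs_self _))
  have hgn : ∀ n x, |g n x| ≤ n := by
    intro n x
    have hn : (0 : ℝ) ≤ n := n.cast_nonneg
    simp only [hg, abs_le]
    exact ⟨le_max_left _ _, max_le (by linarith) (min_le_left _ _)⟩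
  have hglip : ∀ n x y, |g n x - g n y| ≤ c * dist x y := by
    intro n x y
    refine le_trans ?_ (hbd x y)
    simp only [hg]
    have h1 := abs_max_sub_max_le_abs (min (n : ℝ) (f x)) (min (n : ℝ) (f y)) (-(n : ℝ))
    have h2 := abs_min_sub_min_le_max (n : ℝ) (f x) (n : ℝ) (f y)
    simp only [sub_self, abs_zero] at h2
    rw [max_eq_right (abs_nonneg _)] at h2
    rw [max_comm (-(n : ℝ)), max_comm (-(n : ℝ))]
    exact h1.trans h2
  have hglim : ∀ x, Tendsto (fun n => g n x) atTop (𝓝 (f x)) := by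
    intro x
    refine tendsto_const_nhds.congr' ?_
    filter_upwards [eventually_ge_atTop ⌈|f x|⌉₊] with n hn
    have hn' : |f x| ≤ n := (Nat.le_ceil _).trans (by exact_mod_cast hn)
    simp only [hg]
    rw [min_eq_right (le_of_abs_le hn'), max_eq_right (abs_le.1 hn').1]
  have hmean : Tendsto (fun n => ∫ x, g n x ∂P) atTop (𝓝 (∫ x, f x ∂P)) :=
    tendsto_integral_of_dominated_convergence (fun x => |f x|)
      (fun n => (hgm n).aestronglyMeasurable) hint.abs
      (fun n => Eventually.of_forall fun x => hgabs n x) (Eventually.of_forall hglim)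
  have hfat : ∫⁻ x, ENNReal.ofReal (Real.exp (f x)) ∂P ≤
      ENNReal.ofReal (Real.exp (∫ x, f x ∂P + c ^ 2 * v / 2)) := by
    have e : ∀ x, ENNReal.ofReal (Real.exp (f x)) =
        liminf (fun n => ENNReal.ofReal (Real.exp (g n x))) atTop := fun x =>
      (((ENNReal.continuous_ofReal.comp Real.continuous_exp).tendsto _).comp
        (hglim x)).liminf_eq.symm
    simp_rw [e]
    refine (lintegral_liminf_le fun n => (hgm n).exp.ennreal_ofReal).trans ?_
    have hlim : Tendsto (fun n => ENNReal.ofReal (Real.exp (∫ x, g n x ∂P + c ^ 2 * v / 2))) atTop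
        (𝓝 (ENNReal.ofReal (Real.exp (∫ x, f x ∂P + c ^ 2 * v / 2)))) :=
      ((ENNReal.continuous_ofReal.comp Real.continuous_exp).tendsto _).comp
        (hmean.add_const _)
    rw [← hlim.liminf_eq]
    refine liminf_le_liminf (Eventually.of_forall fun n => ?_)
    have hexp : Integrable (fun x => Real.exp (g n x)) P :=
      (integrable_const (Real.exp n)).mono' (hgm n).exp.aestronglyMeasurable
        (Eventually.of_forall fun x => by
          rw [Real.norm_eq_abs, Real.abs_exp]
          exact Real.exp_le_exp.2 (le_of_abs_le (hgn n x)))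
    rw [← ofReal_integral_eq_lintegral_ofReal hexp
      (Eventually.of_forall fun _ => (Real.exp_pos _).le)]
    exact ENNReal.ofReal_le_ofReal (h.laplace_of_bounded hv hc (hgm n) (hglip n) (hgn n))
  have hexp : Integrable (fun x => Real.exp (f x)) P := by
    refine ⟨hf.exp.aestronglyMeasurable, ?_⟩
    rw [hasFiniteIntegral_iff_ofReal (Eventually.of_forall fun _ => (Real.exp_pos _).le)]
    exact hfat.trans_lt ENNReal.ofReal_lt_top
  refine ⟨hint, hexp, ?_⟩
  rw [← ofReal_integral_eq_lintegral_ofReal hexp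
    (Eventually.of_forall fun _ => (Real.exp_pos _).le)] at hfat
  exact (ENNReal.ofReal_le_ofReal_iff (Real.exp_pos _).le).1 hfat

end LaplaceCriteria

/-! ### Couplings, and bounds on both distances by densities. -/

section Transport

variable {α : Type*} [MeasurableSpace α]

theorem transportCost_le (c : α → α → ℝ≥0∞) {μ ν : Measure α} (π : Measure (α × α))
    (h1 : π.map Prod.fst = μ) (h2 : π.map Prod.snd = ν) :
    transportCost c μ ν ≤ ∫⁻ z, c z.1 z.2 ∂π :=
  iInf_le_of_le π (iInf_le_of_le h1 (iInf_le _ h2))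

theorem exists_coupling_lt {c : α → α → ℝ≥0∞} {μ ν : Measure α} {r : ℝ≥0∞}
    (h : transportCost c μ ν < r) : ∃ π : Measure (α × α), π.map Prod.fst = μ ∧
      π.map Prod.snd = ν ∧ ∫⁻ z, c z.1 z.2 ∂π < r := by
  simp only [transportCost, iInf_lt_iff] at h
  obtain ⟨π, h1, h2, h3⟩ := h
  exact ⟨π, h1, h2, h3⟩

/-- Convexity of the transport cost in its first argument. -/
theorem transportCost_sum_le {c : α → α → ℝ≥0∞} {ι : Type*} (s : Finset ι) {w : ι → ℝ≥0∞}
    (hw : ∑ i ∈ s, w i = 1) (μ : ι → Measure α) (ν : Measure α)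
    (hfin : ∀ i ∈ s, transportCost c (μ i) ν ≠ ∞) :
    transportCost c (∑ i ∈ s, w i • μ i) ν ≤ ∑ i ∈ s, w i * transportCost c (μ i) ν := by
  refine ENNReal.le_of_forall_pos_le_add fun ε hε _ => ?_
  have hε' : (ε : ℝ≥0∞) ≠ 0 := by exact_mod_cast hε.ne'
  have hex : ∀ i : ι, ∃ π : Measure (α × α), i ∈ s → π.map Prod.fst = μ i ∧
      π.map Prod.snd = ν ∧ ∫⁻ z, c z.1 z.2 ∂π < transportCost c (μ i) ν + ε := by
    intro i
    by_cases hi : i ∈ s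
    · obtain ⟨π, h⟩ := exists_coupling_lt (ENNReal.lt_add_right (hfin i hi) hε')
      exact ⟨π, fun _ => h⟩
    · exact ⟨0, fun h => absurd h hi⟩
  choose π hπ using hex
  refine (transportCost_le c (∑ i ∈ s, w i • π i) ?_ ?_).trans ?_
  · rw [Measure.map_finset_sum measurable_fst.aemeasurable]
    exact Finset.sum_congr rfl fun i hi => by rw [Measure.map_smul, (hπ i hi).1]
  · rw [Measure.map_finset_sum measurable_snd.aemeasurable, Finset.sum_congr rfl
      fun i hi => by rw [Measure.map_smul, (hπ i hi).2.1], ← Finset.sum_smul, hw, one_smul]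
  · rw [lintegral_finsetSum_measure]
    simp_rw [lintegral_smul_measure]
    calc ∑ i ∈ s, w i • ∫⁻ z, c z.1 z.2 ∂(π i)
        ≤ ∑ i ∈ s, w i * (transportCost c (μ i) ν + ε) :=
          Finset.sum_le_sum fun i hi => mul_le_mul_right (hπ i hi).2.2.le _
      _ = ∑ i ∈ s, w i * transportCost c (μ i) ν + ε := by
          simp_rw [mul_add]
          rw [Finset.sum_add_distrib, ← Finset.sum_mul, hw, one_mul]

theorem map_fst_withDensity (π : Measure (α × α)) {p : α → ℝ≥0∞} (hp : Measurable p) :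
    (π.withDensity fun z => p z.1).map Prod.fst = (π.map Prod.fst).withDensity p := by
  ext A hA
  rw [Measure.map_apply measurable_fst hA, withDensity_apply _ (measurable_fst hA),
    withDensity_apply _ hA, setLIntegral_map hA hp measurable_fst]

/-- A coupling of `μ₁ + μ₂` and `ν` splits along the decomposition of the first marginal. -/
theorem exists_coupling_split {μ₁ μ₂ : Measure α} [IsFiniteMeasure μ₁] [IsFiniteMeasure μ₂]
    {π : Measure (α × α)} (hπ : π.map Prod.fst = μ₁ + μ₂) :
    ∃ π₁ π₂ : Measure (α × α), π = π₁ + π₂ ∧ π₁.map Prod.fst = μ₁ ∧ π₂.map Prod.fst = μ₂ := by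
  set μ := μ₁ + μ₂ with hμ
  have h1 : μ.withDensity (μ₁.rnDeriv μ) = μ₁ := Measure.withDensity_rnDeriv_eq _ _
    (Measure.absolutelyContinuous_of_le (Measure.le_add_right le_rfl))
  have h2 : μ.withDensity (μ₂.rnDeriv μ) = μ₂ := Measure.withDensity_rnDeriv_eq _ _
    (Measure.absolutelyContinuous_of_le (Measure.le_add_left le_rfl))
  have hp := Measure.measurable_rnDeriv μ₁ μ
  have hq := Measure.measurable_rnDeriv μ₂ μ
  have hsum : ∀ᵐ x ∂μ, μ₁.rnDeriv μ x + μ₂.rnDeriv μ x = 1 := by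
    filter_upwards [Measure.rnDeriv_add' μ₁ μ₂ μ, Measure.rnDeriv_self μ] with x hx hx'
    rw [← hμ, hx', Pi.add_apply] at hx
    exact hx.symm
  -- Each part reweights π by a density in the first coordinate; the two densities sum to 1.
  refine ⟨π.withDensity fun z => μ₁.rnDeriv μ z.1, π.withDensity fun z => μ₂.rnDeriv μ z.1,
    ?_, ?_, ?_⟩
  · rw [← withDensity_add_left (f := fun z : α × α => μ₁.rnDeriv μ z.1) (hp.comp measurable_fst)]
    have : (fun z : α × α => μ₁.rnDeriv μ z.1) + (fun z => μ₂.rnDeriv μ z.1) =ᵐ[π] 1 := by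
      have hsum' : ∀ᵐ x ∂(π.map Prod.fst), μ₁.rnDeriv μ x + μ₂.rnDeriv μ x = 1 := by
        rw [hπ]; exact hsum
      exact ae_of_ae_map measurable_fst.aemeasurable hsum'
    rw [withDensity_congr_ae this, withDensity_one]
  · rw [map_fst_withDensity π hp, hπ, h1]
  · rw [map_fst_withDensity π hq, hπ, h2]

/-- If a and b vanish, the factor is ∞ but multiplies the zero measure, so the diagonal part alone
is the coupling. -/
theorem map_fst_diag_add_prod (D a b : Measure α) [IsFiniteMeasure a] [IsFiniteMeasure b]
    (hab : a Set.univ = b Set.univ) :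
    (D.map (fun x => (x, x)) + (a Set.univ)⁻¹ • a.prod b).map Prod.fst = D + a ∧
    (D.map (fun x => (x, x)) + (a Set.univ)⁻¹ • a.prod b).map Prod.snd = D + b := by
  have hd : Measurable fun x : α => (x, x) := by fun_prop
  have h0 : ∀ m : Measure α, IsFiniteMeasure m → (m Set.univ)⁻¹ • m Set.univ • m = m := by
    intro m _
    by_cases hm : m Set.univ = 0
    · rw [Measure.measure_univ_eq_zero.1 hm]; simp
    · rw [smul_smul, ENNReal.inv_mul_cancel hm (measure_ne_top _ _), one_smul]
  constructor
  · rw [Measure.map_add _ _ measurable_fst, Measure.map_smul, Measure.map_fst_prod,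
      Measure.map_map measurable_fst hd, ← hab, h0 a inferInstance]
    simp [Function.comp_def]
  · rw [Measure.map_add _ _ measurable_snd, Measure.map_smul, Measure.map_snd_prod,
      Measure.map_map measurable_snd hd, hab, h0 b inferInstance]
    simp [Function.comp_def]

section Metric

variable [PseudoEMetricSpace α] [OpensMeasurableSpace α] [SecondCountableTopology α]

/-- In a nearly optimal coupling, T moves only the mass originating from μ₁, so the triangle
inequality is paid on that part alone. -/
theorem wasserstein1_map_add_le {μ₁ μ₂ ν : Measure α} [IsFiniteMeasure μ₁] [IsFiniteMeasure μ₂]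
    {T : α → α} (hT : Measurable T) :
    wasserstein1 (μ₁.map T + μ₂) ν ≤ wasserstein1 (μ₁ + μ₂) ν + ∫⁻ x, edist (T x) x ∂μ₁ := by
  rw [wasserstein1, wasserstein1]
  refine ENNReal.le_of_forall_pos_le_add fun ε hε hlt => ?_
  have hfin : transportCost edist (μ₁ + μ₂) ν ≠ ∞ := (ENNReal.add_lt_top.1 hlt).1.ne
  obtain ⟨π, h1, h2, h3⟩ := exists_coupling_lt
    (ENNReal.lt_add_right hfin (by exact_mod_cast hε.ne' : (ε : ℝ≥0∞) ≠ 0))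
  obtain ⟨π₁, π₂, hsum, hm1, hm2⟩ := exists_coupling_split h1
  have hS : Measurable fun z : α × α => (T z.1, z.2) := by fun_prop
  have hed : Measurable fun z : α × α => edist z.1 z.2 := measurable_edist
  have hedT : Measurable fun x : α => edist (T x) x := hT.edist measurable_id
  refine (transportCost_le edist (π₁.map (fun z => (T z.1, z.2)) + π₂) ?_ ?_).trans ?_
  · rw [Measure.map_add _ _ measurable_fst, Measure.map_map measurable_fst hS, hm2, ← hm1,
      Measure.map_map hT measurable_fst]
    rfl
  · rw [Measure.map_add _ _ measurable_snd, Measure.map_map measurable_snd hS, ← h2, hsum,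
      Measure.map_add _ _ measurable_snd]
    rfl
  · rw [lintegral_add_measure, lintegral_map hed hS]
    calc ∫⁻ z, edist (T z.1) z.2 ∂π₁ + ∫⁻ z, edist z.1 z.2 ∂π₂
        ≤ (∫⁻ z, edist (T z.1) z.1 ∂π₁ + ∫⁻ z, edist z.1 z.2 ∂π₁) + ∫⁻ z, edist z.1 z.2 ∂π₂ := by
          gcongr
          rw [← lintegral_add_right _ hed]
          exact lintegral_mono fun z => edist_triangle _ _ _
      _ = ∫⁻ x, edist (T x) x ∂μ₁ + ∫⁻ z, edist z.1 z.2 ∂π := by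
          rw [hsum, lintegral_add_measure, ← hm1, lintegral_map hedT measurable_fst, add_assoc]
      _ ≤ ∫⁻ x, edist (T x) x ∂μ₁ + (transportCost edist (μ₁ + μ₂) ν + ε) := by gcongr
      _ = _ := by rw [add_comm, add_right_comm]

/-- The Wasserstein distance is bounded by a weighted total variation distance. -/
theorem wasserstein1_withDensity_le {lam : Measure α} [SFinite lam] {f g : α → ℝ}
    (hf : Measurable f)
    (hg : Measurable g) (hfi : ∫⁻ x, ENNReal.ofReal (f x) ∂lam = 1)
    (hgi : ∫⁻ x, ENNReal.ofReal (g x) ∂lam = 1) (m : α) :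
    wasserstein1 (lam.withDensity fun x => ENNReal.ofReal (f x))
      (lam.withDensity fun x => ENNReal.ofReal (g x)) ≤
      ∫⁻ x, edist x m * ENNReal.ofReal |f x - g x| ∂lam := by
  -- The common mass D stays on the diagonal. The excesses a and b have equal mass and are coupled
  -- independently, each pair travelling through m.
  set D := lam.withDensity fun x => min (ENNReal.ofReal (f x)) (ENNReal.ofReal (g x)) with hD
  set da : α → ℝ≥0∞ := fun x => ENNReal.ofReal (f x) - ENNReal.ofReal (g x) with hda
  set db : α → ℝ≥0∞ := fun x => ENNReal.ofReal (g x) - ENNReal.ofReal (f x) with hdb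
  have hf' := hf.ennreal_ofReal
  have hg' := hg.ennreal_ofReal
  have hdam : Measurable da := hf'.sub hg'
  have hdbm : Measurable db := hg'.sub hf'
  set a := lam.withDensity da with ha
  set b := lam.withDensity db with hb
  have hDa : D + a = lam.withDensity fun x => ENNReal.ofReal (f x) := by
    rw [hD, ha, ← withDensity_add_right _ hdam]
    congr 1; ext x
    simp only [Pi.add_apply, hda]
    rcases le_total (ENNReal.ofReal (f x)) (ENNReal.ofReal (g x)) with h | h
    · rw [min_eq_left h, tsub_eq_zero_of_le h, add_zero]
    · rw [min_eq_right h, add_tsub_cancel_of_le h]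
  have hDb : D + b = lam.withDensity fun x => ENNReal.ofReal (g x) := by
    rw [hD, hb, ← withDensity_add_right _ hdbm]
    congr 1; ext x
    simp only [Pi.add_apply, hdb]
    rcases le_total (ENNReal.ofReal (f x)) (ENNReal.ofReal (g x)) with h | h
    · rw [min_eq_left h, add_tsub_cancel_of_le h]
    · rw [min_eq_right h, tsub_eq_zero_of_le h, add_zero]
  have hDa1 : D Set.univ + a Set.univ = 1 := by
    rw [← Measure.add_apply, hDa, withDensity_apply _ MeasurableSet.univ, Measure.restrict_univ, hfi]
  have hDb1 : D Set.univ + b Set.univ = 1 := by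
    rw [← Measure.add_apply, hDb, withDensity_apply _ MeasurableSet.univ, Measure.restrict_univ, hgi]
  have hDtop : D Set.univ ≠ ∞ := ne_top_of_le_ne_top ENNReal.one_ne_top (le_self_add.trans hDa1.le)
  have hatop : a Set.univ ≠ ∞ := ne_top_of_le_ne_top ENNReal.one_ne_top (le_add_self.trans hDa1.le)
  have hab : a Set.univ = b Set.univ := (ENNReal.add_right_inj hDtop).1 (hDa1.trans hDb1.symm)
  have : IsFiniteMeasure a := ⟨lt_top_iff_ne_top.2 hatop⟩
  have : IsFiniteMeasure b := ⟨lt_top_iff_ne_top.2 (hab ▸ hatop)⟩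
  obtain ⟨hm1, hm2⟩ := map_fst_diag_add_prod D a b hab
  have hed : Measurable fun z : α × α => edist z.1 z.2 := measurable_edist
  have hem : Measurable fun x : α => edist x m := measurable_id.edist measurable_const
  refine (transportCost_le edist _ (hm1.trans hDa) (hm2.trans hDb)).trans ?_
  rw [lintegral_add_measure, lintegral_map hed (by fun_prop), lintegral_smul_measure]
  simp only [edist_self, lintegral_zero, zero_add, smul_eq_mul]
  have hprod : ∫⁻ z, edist z.1 z.2 ∂(a.prod b) ≤
      a Set.univ * (∫⁻ x, edist x m ∂a + ∫⁻ x, edist x m ∂b) := by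
    calc ∫⁻ z, edist z.1 z.2 ∂(a.prod b)
        ≤ ∫⁻ z, (edist z.1 m + edist z.2 m) ∂(a.prod b) :=
          lintegral_mono fun z => edist_triangle_right _ _ _
      _ = ∫⁻ z, edist z.1 m ∂(a.prod b) + ∫⁻ z, edist z.2 m ∂(a.prod b) :=
          lintegral_add_left (hem.comp measurable_fst) _
      _ = b Set.univ * ∫⁻ x, edist x m ∂a + a Set.univ * ∫⁻ x, edist x m ∂b := by
          rw [← lintegral_map (f := fun x => edist x m) hem measurable_fst,
            ← lintegral_map (f := fun x => edist x m) hem measurable_snd,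
            Measure.map_fst_prod, Measure.map_snd_prod, lintegral_smul_measure,
            lintegral_smul_measure, smul_eq_mul, smul_eq_mul]
      _ = _ := by rw [← hab, mul_add]
  calc (a Set.univ)⁻¹ * ∫⁻ z, edist z.1 z.2 ∂(a.prod b)
      ≤ (a Set.univ)⁻¹ * (a Set.univ * (∫⁻ x, edist x m ∂a + ∫⁻ x, edist x m ∂b)) :=
        mul_le_mul_right hprod _
    _ ≤ ∫⁻ x, edist x m ∂a + ∫⁻ x, edist x m ∂b := by
        rw [← mul_assoc]
        exact mul_le_of_le_one_left zero_le (ENNReal.inv_mul_le_one _)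
    _ = ∫⁻ x, (edist x m * da x + edist x m * db x) ∂lam := by
        rw [ha, hb, lintegral_withDensity_eq_lintegral_mul _ hdam hem,
          lintegral_withDensity_eq_lintegral_mul _ hdbm hem, ← lintegral_add_left (hdam.mul hem)]
        simp only [Pi.mul_apply, mul_comm]
    _ ≤ ∫⁻ x, edist x m * ENNReal.ofReal |f x - g x| ∂lam := by
        refine lintegral_mono fun x => ?_
        rw [← mul_add]
        refine mul_le_mul_right ?_ _
        simp only [hda, hdb]
        rcases le_total (f x) (g x) with h | h
        · rw [tsub_eq_zero_of_le (ENNReal.ofReal_le_ofReal h), zero_add, abs_sub_comm,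
            abs_of_nonneg (sub_nonneg.2 h), tsub_le_iff_right]
          refine le_trans (ENNReal.ofReal_le_ofReal ?_) ENNReal.ofReal_add_le
          linarith
        · rw [tsub_eq_zero_of_le (ENNReal.ofReal_le_ofReal h), add_zero,
            abs_of_nonneg (sub_nonneg.2 h), tsub_le_iff_right]
          refine le_trans (ENNReal.ofReal_le_ofReal ?_) ENNReal.ofReal_add_le
          linarith

end Metric

/-- Since f − g integrates to zero, its integrals over A and over the complement of A are opposite,
which gives the factor 1/2. -/
theorem tvDistance_withDensity_le {lam : Measure α} {f g : α → ℝ} (hf : Integrable f lam)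
    (hg : Integrable g lam) (hf0 : ∀ x, 0 ≤ f x) (hg0 : ∀ x, 0 ≤ g x)
    (hfg : ∫ x, f x ∂lam = ∫ x, g x ∂lam) :
    tvDistance (lam.withDensity fun x => ENNReal.ofReal (f x))
      (lam.withDensity fun x => ENNReal.ofReal (g x)) ≤ (∫ x, |f x - g x| ∂lam) / 2 := by
  have hreal : ∀ h : α → ℝ, Integrable h lam → (∀ x, 0 ≤ h x) → ∀ A, MeasurableSet A →
      (lam.withDensity fun x => ENNReal.ofReal (h x)).real A = ∫ x in A, h x ∂lam := by
    intro h hh hh0 A hA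
    rw [Measure.real, withDensity_apply _ hA, integral_eq_lintegral_of_nonneg_ae
      (Filter.Eventually.of_forall hh0) hh.aestronglyMeasurable.restrict]
  have : Nonempty {A : Set α // MeasurableSet A} := ⟨⟨∅, MeasurableSet.empty⟩⟩
  refine ciSup_le fun ⟨A, hA⟩ => ?_
  simp only
  rw [hreal f hf hf0 A hA, hreal g hg hg0 A hA,
    ← integral_sub hf.integrableOn hg.integrableOn]
  have hi := hf.sub hg
  have h1 := integral_add_compl hA hi
  have h2 := integral_add_compl hA hi.abs
  have h0 : ∫ x, (f - g) x ∂lam = 0 := by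
    simp only [Pi.sub_apply]; rw [integral_sub hf hg, hfg, sub_self]
  have h3 := abs_integral_le_integral_abs (μ := lam.restrict A) (f := f - g)
  have h4 := abs_integral_le_integral_abs (μ := lam.restrict Aᶜ) (f := f - g)
  simp only [Pi.sub_apply] at h0 h1 h2 h3 h4
  have h5 : ∫ x in Aᶜ, (f x - g x) ∂lam = -∫ x in A, (f x - g x) ∂lam := by linarith
  rw [h5, abs_neg] at h4
  linarith

end Transport

/-! ### Gaussian integrals on Euclidean space. -/

section GaussianIntegrals

variable {d : ℕ}

theorem integrable_exp_neg_sq_add_inner {b : ℝ} (hb : 0 < b) (w : EuclideanSpace ℝ (Fin d)) :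
    Integrable fun x : EuclideanSpace ℝ (Fin d) => Real.exp (-b * ‖x‖ ^ 2 + inner ℝ w x) := by
  have h := (GaussianFourier.integrable_cexp_neg_mul_sq_norm_add (b := (b : ℂ)) (V := EuclideanSpace ℝ (Fin d))
    (by simpa using hb) 1 w).re
  refine h.congr (Filter.Eventually.of_forall fun x => ?_)
  have : (-(b : ℂ) * (‖x‖ : ℂ) ^ 2 + 1 * ((inner ℝ w x : ℝ) : ℂ)) =
      ((-b * ‖x‖ ^ 2 + inner ℝ w x : ℝ) : ℂ) := by push_cast; ring
  change (Complex.exp _).re = _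
  rw [this, ← Complex.ofReal_exp, Complex.ofReal_re]

theorem integral_exp_neg_sq_add_inner {b : ℝ} (hb : 0 < b) (w : EuclideanSpace ℝ (Fin d)) :
    ∫ x : EuclideanSpace ℝ (Fin d), Real.exp (-b * ‖x‖ ^ 2 + inner ℝ w x) =
      (Real.pi / b) ^ ((d : ℝ) / 2) * Real.exp (‖w‖ ^ 2 / (4 * b)) := by
  have h := GaussianFourier.integral_cexp_neg_mul_sq_norm_add (b := (b : ℂ)) (V := EuclideanSpace ℝ (Fin d))
    (by simpa using hb) 1 w
  have e : ∀ x : EuclideanSpace ℝ (Fin d), Complex.exp (-(b : ℂ) * (‖x‖ : ℂ) ^ 2 + 1 * ((inner ℝ w x : ℝ) : ℂ)) =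
      ((Real.exp (-b * ‖x‖ ^ 2 + inner ℝ w x) : ℝ) : ℂ) := by
    intro x; push_cast; ring_nf
  simp_rw [e] at h
  rw [integral_complex_ofReal] at h
  apply Complex.ofReal_injective
  rw [h, finrank_euclideanSpace_fin, Complex.ofReal_mul,
    Complex.ofReal_cpow (by positivity)]
  push_cast
  ring_nf

theorem lintegral_exp_neg_sq_add_inner {b : ℝ} (hb : 0 < b) (w : EuclideanSpace ℝ (Fin d)) :
    ∫⁻ x : EuclideanSpace ℝ (Fin d), ENNReal.ofReal (Real.exp (-b * ‖x‖ ^ 2 + inner ℝ w x)) =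
      ENNReal.ofReal ((Real.pi / b) ^ ((d : ℝ) / 2) * Real.exp (‖w‖ ^ 2 / (4 * b))) := by
  rw [← integral_exp_neg_sq_add_inner hb w, ofReal_integral_eq_lintegral_ofReal
    (integrable_exp_neg_sq_add_inner hb w)
    (Filter.Eventually.of_forall fun _ => (Real.exp_pos _).le)]

theorem integrable_exp_neg_sq {b : ℝ} (hb : 0 < b) :
    Integrable fun x : EuclideanSpace ℝ (Fin d) => Real.exp (-b * ‖x‖ ^ 2) := by
  simpa using integrable_exp_neg_sq_add_inner hb (0 : EuclideanSpace ℝ (Fin d))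

theorem integral_exp_neg_sq {b : ℝ} (hb : 0 < b) :
    ∫ x : EuclideanSpace ℝ (Fin d), Real.exp (-b * ‖x‖ ^ 2) = (Real.pi / b) ^ ((d : ℝ) / 2) := by
  simpa using integral_exp_neg_sq_add_inner hb (0 : EuclideanSpace ℝ (Fin d))

/-- From 1 + εy ≤ exp (εy). At ε = b/2 this dominates the second-moment integrand; as ε → 0 it
bounds the second moment by the derivative of ε ↦ (π/(b − ε))^(d/2) at 0. -/
theorem sq_mul_exp_le {b ε : ℝ} (hε : 0 < ε) (y : ℝ) :
    y * Real.exp (-b * y) ≤ ε⁻¹ * (Real.exp (-(b - ε) * y) - Real.exp (-b * y)) := by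
  have h1 := Real.add_one_le_exp (ε * y)
  have e : Real.exp (-(b - ε) * y) = Real.exp (ε * y) * Real.exp (-b * y) := by
    rw [← Real.exp_add]; ring_nf
  rw [e, le_inv_mul_iff₀ hε]
  nlinarith [Real.exp_pos (-b * y)]

theorem integrable_sq_mul_exp_neg_sq {b : ℝ} (hb : 0 < b) :
    Integrable fun x : EuclideanSpace ℝ (Fin d) => ‖x‖ ^ 2 * Real.exp (-b * ‖x‖ ^ 2) := by
  have hε : 0 < b / 2 := by positivity
  refine (((integrable_exp_neg_sq (d := d) (show 0 < b - b / 2 by linarith)).sub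
    (integrable_exp_neg_sq hb)).const_mul (b / 2)⁻¹).mono' (by fun_prop)
    (Filter.Eventually.of_forall fun x => ?_)
  rw [Real.norm_of_nonneg (by positivity)]
  exact sq_mul_exp_le hε _

theorem integral_sq_mul_exp_neg_sq_le {b : ℝ} (hb : 0 < b) :
    ∫ x : EuclideanSpace ℝ (Fin d), ‖x‖ ^ 2 * Real.exp (-b * ‖x‖ ^ 2) ≤
      (Real.pi / b) ^ ((d : ℝ) / 2) * (d / (2 * b)) := by
  set h : ℝ → ℝ := fun ε => (Real.pi / (b - ε)) ^ ((d : ℝ) / 2) with hh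
  have hbd : ∀ ε ∈ Set.Ioo 0 b, ∫ x : EuclideanSpace ℝ (Fin d), ‖x‖ ^ 2 * Real.exp (-b * ‖x‖ ^ 2) ≤
      ε⁻¹ * (h (0 + ε) - h 0) := by
    rintro ε ⟨h0, h1⟩
    have hbε : 0 < b - ε := by linarith
    have hi := (integrable_exp_neg_sq (d := d) hbε).sub (integrable_exp_neg_sq hb)
    calc ∫ x : EuclideanSpace ℝ (Fin d), ‖x‖ ^ 2 * Real.exp (-b * ‖x‖ ^ 2)
        ≤ ∫ x : EuclideanSpace ℝ (Fin d), ε⁻¹ * (Real.exp (-(b - ε) * ‖x‖ ^ 2) - Real.exp (-b * ‖x‖ ^ 2)) :=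
          integral_mono (integrable_sq_mul_exp_neg_sq hb) (hi.const_mul _)
            fun x => sq_mul_exp_le h0 _
      _ = ε⁻¹ * (h (0 + ε) - h 0) := by
          rw [integral_const_mul, integral_sub (integrable_exp_neg_sq hbε)
            (integrable_exp_neg_sq hb), integral_exp_neg_sq hbε, integral_exp_neg_sq hb]
          simp [hh]
  have hder : HasDerivAt h ((Real.pi / b) ^ ((d : ℝ) / 2) * (d / (2 * b))) 0 := by
    have h1 : HasDerivAt (fun ε : ℝ => b - ε) (-1) 0 := by
      simpa using (hasDerivAt_id (0 : ℝ)).const_sub b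
    have h2 := ((hasDerivAt_const (0 : ℝ) Real.pi).div h1 (by simpa using hb.ne')).rpow_const
      (p := (d : ℝ) / 2) (Or.inl (by simp [hb.ne', Real.pi_ne_zero]))
    convert! h2 using 1
    have hpb : 0 < Real.pi / b := by positivity
    simp only [sub_zero, Pi.div_apply]
    rw [Real.rpow_sub_one hpb.ne']
    field_simp
    ring
  have hlim := hder.tendsto_slope_zero_right
  refine ge_of_tendsto hlim ?_
  filter_upwards [Ioo_mem_nhdsGT hb] with ε hε
  simpa using hbd ε hε

end GaussianIntegrals

/-! ### Gaussian densities and sub-Gaussian square-exponential moments. -/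

section GaussianKernel

variable {d : ℕ}

/-- The centred Gaussian density with covariance `σ² I`. -/
noncomputable def gaussianDensity (d : ℕ) (σ : ℝ) (x : EuclideanSpace ℝ (Fin d)) : ℝ :=
  (1 / σ ^ d) * stdKernel d (σ⁻¹ • x)

theorem gaussianDensity_eq {σ : ℝ} (hσ : 0 < σ) (x : EuclideanSpace ℝ (Fin d)) :
    gaussianDensity d σ x =
      (2 * Real.pi * σ ^ 2) ^ (-((d : ℝ) / 2)) * Real.exp (-(1 / (2 * σ ^ 2)) * ‖x‖ ^ 2) := by
  have h1 : (1 / σ ^ d) = (σ ^ 2) ^ (-((d : ℝ) / 2)) := by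
    rw [Real.rpow_neg (by positivity), one_div, ← Real.rpow_natCast σ 2, ← Real.rpow_mul hσ.le,
      ← Real.rpow_natCast σ d]
    congr 2
    push_cast; ring
  rw [gaussianDensity, stdKernel, h1, norm_smul, Real.norm_of_nonneg (by positivity),
    Real.mul_rpow (by positivity) (by positivity) (x := 2 * Real.pi)]
  have h2 : -(σ⁻¹ * ‖x‖) ^ 2 / 2 = -(1 / (2 * σ ^ 2)) * ‖x‖ ^ 2 := by field_simp
  rw [h2, neg_div]
  ring

theorem gaussianDensity_pos {σ : ℝ} (hσ : 0 < σ) (x : EuclideanSpace ℝ (Fin d)) : 0 < gaussianDensity d σ x := by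
  rw [gaussianDensity_eq hσ]; positivity

theorem continuous_gaussianDensity (σ : ℝ) : Continuous (gaussianDensity d σ) := by
  unfold gaussianDensity stdKernel; fun_prop

theorem gaussianDensity_le {σ : ℝ} (hσ : 0 < σ) (x : EuclideanSpace ℝ (Fin d)) :
    gaussianDensity d σ x ≤ (2 * Real.pi * σ ^ 2) ^ (-((d : ℝ) / 2)) := by
  rw [gaussianDensity_eq hσ]
  refine mul_le_of_le_one_right (by positivity) (Real.exp_le_one_iff.2 ?_)
  have : 0 ≤ 1 / (2 * σ ^ 2) * ‖x‖ ^ 2 := by positivity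
  linarith

theorem integrable_gaussianDensity {σ : ℝ} (hσ : 0 < σ) : Integrable (gaussianDensity d σ) := by
  simp_rw [funext (gaussianDensity_eq hσ)]
  exact (integrable_exp_neg_sq (by positivity)).const_mul _

theorem gaussian_normalization {σ : ℝ} (hσ : 0 < σ) :
    (2 * Real.pi * σ ^ 2) ^ (-((d : ℝ) / 2)) *
      (Real.pi / (1 / (2 * σ ^ 2))) ^ ((d : ℝ) / 2) = 1 := by
  have : Real.pi / (1 / (2 * σ ^ 2)) = 2 * Real.pi * σ ^ 2 := by field_simp
  rw [this, ← Real.rpow_add (by positivity), neg_add_cancel, Real.rpow_zero]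

theorem integral_gaussianDensity {σ : ℝ} (hσ : 0 < σ) : ∫ x, gaussianDensity d σ x = 1 := by
  simp_rw [gaussianDensity_eq hσ]
  rw [integral_const_mul, integral_exp_neg_sq (by positivity), gaussian_normalization hσ]

theorem lintegral_gaussianDensity {σ : ℝ} (hσ : 0 < σ) :
    ∫⁻ x, ENNReal.ofReal (gaussianDensity d σ x) = 1 := by
  rw [← ofReal_integral_eq_lintegral_ofReal (integrable_gaussianDensity hσ)
    (Filter.Eventually.of_forall fun x => (gaussianDensity_pos hσ x).le),
    integral_gaussianDensity hσ, ENNReal.ofReal_one]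

theorem lintegral_sq_mul_gaussianDensity_le {σ : ℝ} (hσ : 0 < σ) :
    ∫⁻ x, ENNReal.ofReal (‖x‖ ^ 2 * gaussianDensity d σ x) ≤ ENNReal.ofReal (d * σ ^ 2) := by
  have hb : 0 < 1 / (2 * σ ^ 2) := by positivity
  have e : ∀ x : EuclideanSpace ℝ (Fin d), ‖x‖ ^ 2 * gaussianDensity d σ x = (2 * Real.pi * σ ^ 2) ^ (-((d : ℝ) / 2)) *
      (‖x‖ ^ 2 * Real.exp (-(1 / (2 * σ ^ 2)) * ‖x‖ ^ 2)) := fun x => by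
    rw [gaussianDensity_eq hσ]; ring
  simp_rw [e]
  rw [← ofReal_integral_eq_lintegral_ofReal ((integrable_sq_mul_exp_neg_sq hb).const_mul _)
    (Filter.Eventually.of_forall fun x => by positivity), integral_const_mul]
  refine ENNReal.ofReal_le_ofReal ?_
  refine (mul_le_mul_of_nonneg_left (integral_sq_mul_exp_neg_sq_le hb) (by positivity)).trans_eq ?_
  rw [← mul_assoc, gaussian_normalization hσ]
  field_simp

/-- The squared norm of a sub-Gaussian vector has exponential moments. -/
theorem IsSubGaussian.lintegral_exp_sq_le {P : Measure (EuclideanSpace ℝ (Fin d))} [IsProbabilityMeasure P] {v b : ℝ}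
    (hP : IsSubGaussian (fun x => x) v P) (hb : 0 < b) (hbv : v / 2 < b) :
    ∫⁻ y, ENNReal.ofReal (Real.exp (‖y - ∫ z, z ∂P‖ ^ 2 / (4 * b))) ∂P ≤
      ENNReal.ofReal ((b / (b - v / 2)) ^ ((d : ℝ) / 2)) := by
  set m := ∫ z, z ∂P
  have hbv' : 0 < b - v / 2 := by linarith
  have hC : 0 < (Real.pi / b) ^ ((d : ℝ) / 2) := by positivity
  have hC0 : ENNReal.ofReal ((Real.pi / b) ^ ((d : ℝ) / 2)) ≠ 0 := by
    rw [Ne, ENNReal.ofReal_eq_zero, not_le]; exact hC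
  -- Gaussian linearization: exp (‖a‖²/(4b)) is, up to a constant, the integral over x of exp
  -- (−b‖x‖² + ⟪a, x⟫). After Tonelli the sub-Gaussian bound applies for each x and lowers b by v/2.
  have key : ENNReal.ofReal ((Real.pi / b) ^ ((d : ℝ) / 2)) *
      ∫⁻ y, ENNReal.ofReal (Real.exp (‖y - m‖ ^ 2 / (4 * b))) ∂P ≤
      ENNReal.ofReal ((Real.pi / (b - v / 2)) ^ ((d : ℝ) / 2)) := by
    rw [← lintegral_const_mul' _ _ ENNReal.ofReal_ne_top]
    calc ∫⁻ y, ENNReal.ofReal ((Real.pi / b) ^ ((d : ℝ) / 2)) *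
          ENNReal.ofReal (Real.exp (‖y - m‖ ^ 2 / (4 * b))) ∂P
        = ∫⁻ y, ∫⁻ x : EuclideanSpace ℝ (Fin d), ENNReal.ofReal (Real.exp (-b * ‖x‖ ^ 2 + inner ℝ (y - m) x)) ∂volume ∂P := by
          refine lintegral_congr fun y => ?_
          rw [lintegral_exp_neg_sq_add_inner hb, ENNReal.ofReal_mul hC.le]
      _ = ∫⁻ x : EuclideanSpace ℝ (Fin d), ∫⁻ y, ENNReal.ofReal (Real.exp (-b * ‖x‖ ^ 2 + inner ℝ (y - m) x)) ∂P :=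
          lintegral_lintegral_swap (by fun_prop)
      _ ≤ ∫⁻ x : EuclideanSpace ℝ (Fin d), ENNReal.ofReal (Real.exp (-(b - v / 2) * ‖x‖ ^ 2)) := by
          refine lintegral_mono fun x => ?_
          obtain ⟨hi, hle⟩ := hP.2 x
          simp only
          have e : ∀ y : EuclideanSpace ℝ (Fin d), Real.exp (-b * ‖x‖ ^ 2 + inner ℝ (y - m) x) =
              Real.exp (-b * ‖x‖ ^ 2) * Real.exp (inner ℝ x (y - m)) := fun y => by
            rw [← Real.exp_add, real_inner_comm]
          simp_rw [e]
          rw [← ofReal_integral_eq_lintegral_ofReal (hi.const_mul _)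
            (Filter.Eventually.of_forall fun y => by positivity), integral_const_mul]
          refine ENNReal.ofReal_le_ofReal ?_
          refine (mul_le_mul_of_nonneg_left hle (Real.exp_pos _).le).trans_eq ?_
          rw [← Real.exp_add]; ring_nf
      _ = ENNReal.ofReal ((Real.pi / (b - v / 2)) ^ ((d : ℝ) / 2)) := by
          have := lintegral_exp_neg_sq_add_inner hbv' (0 : EuclideanSpace ℝ (Fin d))
          simpa using this
  rw [mul_comm, ← ENNReal.le_div_iff_mul_le (Or.inl hC0) (Or.inl ENNReal.ofReal_ne_top),
    ← ENNReal.ofReal_div_of_pos hC, ← Real.div_rpow (by positivity) (by positivity)] at key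
  refine key.trans_eq ?_
  congr 2
  field_simp

/-- Completing the square; σ² < 2s² is what keeps the quadratic coefficient negative. -/
theorem lintegral_sq_div_gaussianDensity {σ s : ℝ} (hσ : 0 < σ) (hs : 0 < s)
    (hσs : σ ^ 2 < 2 * s ^ 2) (a : EuclideanSpace ℝ (Fin d)) :
    ∫⁻ z, ENNReal.ofReal (gaussianDensity d σ z ^ 2 / gaussianDensity d s (z + a)) =
      ENNReal.ofReal ((s ^ 4 / (σ ^ 2 * (2 * s ^ 2 - σ ^ 2))) ^ ((d : ℝ) / 2) *
        Real.exp (‖a‖ ^ 2 / (2 * s ^ 2 - σ ^ 2))) := by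
  have hg : 0 < 2 * s ^ 2 - σ ^ 2 := by linarith
  set b := (2 * s ^ 2 - σ ^ 2) / (2 * s ^ 2 * σ ^ 2) with hb
  have hb0 : 0 < b := by positivity
  set K := ((2 * Real.pi * σ ^ 2) ^ (-((d : ℝ) / 2))) ^ 2 *
    (2 * Real.pi * s ^ 2) ^ ((d : ℝ) / 2) * Real.exp (‖a‖ ^ 2 / (2 * s ^ 2)) with hK
  have e : ∀ z : EuclideanSpace ℝ (Fin d), gaussianDensity d σ z ^ 2 / gaussianDensity d s (z + a) =
      K * Real.exp (-b * ‖z‖ ^ 2 + inner ℝ ((1 / s ^ 2) • a) z) := by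
    intro z
    rw [gaussianDensity_eq hσ, gaussianDensity_eq hs, hK, Real.rpow_neg (x := 2 * Real.pi * s ^ 2)
      (by positivity), mul_pow, ← Real.exp_nat_mul, inner_smul_left, norm_add_sq_real]
    have h1 : (-(1 / (2 * s ^ 2)) * (‖z‖ ^ 2 + 2 * inner ℝ z a + ‖a‖ ^ 2)) =
        -((‖z‖ ^ 2 + 2 * inner ℝ z a + ‖a‖ ^ 2) / (2 * s ^ 2)) := by ring
    rw [h1, Real.exp_neg, div_eq_mul_inv, mul_inv, inv_inv, inv_inv]
    have h2 : Real.exp (((2 : ℕ) : ℝ) * (-(1 / (2 * σ ^ 2)) * ‖z‖ ^ 2)) *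
        Real.exp ((‖z‖ ^ 2 + 2 * inner ℝ z a + ‖a‖ ^ 2) / (2 * s ^ 2)) =
        Real.exp (‖a‖ ^ 2 / (2 * s ^ 2)) *
          Real.exp (-b * ‖z‖ ^ 2 + (starRingEnd ℝ) (1 / s ^ 2) * inner ℝ a z) := by
      rw [← Real.exp_add, ← Real.exp_add, real_inner_comm z a, hb]
      congr 1
      simp only [conj_trivial]
      push_cast
      field_simp
      ring
    linear_combination (((2 * Real.pi * σ ^ 2) ^ (-((d : ℝ) / 2))) ^ 2 *
      (2 * Real.pi * s ^ 2) ^ ((d : ℝ) / 2)) * h2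
  have hK0 : 0 ≤ K := by positivity
  simp_rw [e, ENNReal.ofReal_mul hK0]
  rw [lintegral_const_mul' _ _ ENNReal.ofReal_ne_top, lintegral_exp_neg_sq_add_inner hb0,
    ← ENNReal.ofReal_mul hK0]
  congr 1
  have h1 : ((2 * Real.pi * σ ^ 2) ^ (-((d : ℝ) / 2))) ^ 2 =
      ((1 / (2 * Real.pi * σ ^ 2)) ^ 2) ^ ((d : ℝ) / 2) := by
    rw [Real.rpow_neg (by positivity), ← Real.inv_rpow (by positivity),
      Real.rpow_pow_comm (by positivity), one_div]
  have h2 : s ^ 4 / (σ ^ 2 * (2 * s ^ 2 - σ ^ 2)) = (1 / (2 * Real.pi * σ ^ 2)) ^ 2 *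
      (2 * Real.pi * s ^ 2) * (Real.pi / b) := by
    rw [hb]; field_simp
  have h3 : ‖a‖ ^ 2 / (2 * s ^ 2 - σ ^ 2) =
      ‖a‖ ^ 2 / (2 * s ^ 2) + ‖(1 / s ^ 2) • a‖ ^ 2 / (4 * b) := by
    rw [hb, norm_smul, Real.norm_of_nonneg (by positivity)]; field_simp; ring
  rw [hK, h1, h2, h3, Real.exp_add,
    Real.mul_rpow (x := (1 / (2 * Real.pi * σ ^ 2)) ^ 2 * (2 * Real.pi * s ^ 2)) (by positivity)
      (by positivity),
    Real.mul_rpow (x := (1 / (2 * Real.pi * σ ^ 2)) ^ 2) (by positivity) (by positivity)]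
  ring

end GaussianKernel

/-! ### Mean absolute error of an empirical mean. -/

section EmpiricalMean

variable {E : Type*} [MeasurableSpace E] {P : Measure E} [IsProbabilityMeasure P]

theorem integral_abs_le_sqrt {Ω : Type*} [MeasurableSpace Ω] {μ : Measure Ω}
    [IsProbabilityMeasure μ] {Z : Ω → ℝ} (hZ : MemLp Z 2 μ) :
    ∫ ω, |Z ω| ∂μ ≤ √(∫ ω, Z ω ^ 2 ∂μ) := by
  have h := variance_nonneg (fun ω => |Z ω|) μ
  rw [variance_eq_sub (X := fun ω => |Z ω|) hZ.abs] at h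
  refine Real.le_sqrt_of_sq_le ?_
  simp only [Pi.pow_apply, sq_abs] at h
  linarith

theorem integral_sq_empirical_mean_sub {g : E → ℝ} (hg : MemLp g 2 P) (hgm : Measurable g)
    {t : ℕ} (ht : 1 ≤ t) :
    ∫ x, ((t : ℝ)⁻¹ * ∑ i ∈ Finset.range t, g (x i) - ∫ y, g y ∂P) ^ 2
      ∂(Measure.infinitePi fun _ : ℕ => P) ≤ (t : ℝ)⁻¹ * ∫ y, g y ^ 2 ∂P := by
  set Q := Measure.infinitePi fun _ : ℕ => P
  have ht0 : (0 : ℝ) < t := by exact_mod_cast ht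
  have hmp : ∀ i : ℕ, MeasurePreserving (fun x : ℕ → E => x i) Q P := fun i =>
    measurePreserving_eval_infinitePi (fun _ : ℕ => P) i
  have hmem : ∀ i : ℕ, MemLp (fun x : ℕ → E => g (x i)) 2 Q := fun i =>
    hg.comp_measurePreserving (hmp i)
  have hmean : ∀ i : ℕ, ∫ x, g (x i) ∂Q = ∫ y, g y ∂P := fun i => by
    rw [← (hmp i).map_eq, integral_map (hmp i).aemeasurable hgm.aestronglyMeasurable]
  have hvar : ∀ i : ℕ, Var[fun x : ℕ → E => g (x i); Q] = Var[g; P] := fun i => by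
    rw [← (hmp i).map_eq, variance_map hgm.aemeasurable (hmp i).aemeasurable]
    rfl
  have hind : iIndepFun (fun (i : ℕ) (x : ℕ → E) => g (x i)) Q :=
    iIndepFun_infinitePi (P := fun _ : ℕ => P) (fun _ => hgm)
  have hsum : Var[∑ i ∈ Finset.range t, fun x : ℕ → E => g (x i); Q] = t * Var[g; P] := by
    rw [IndepFun.variance_sum (fun i _ => hmem i) (fun i _ j _ hij => hind.indepFun hij),
      Finset.sum_congr rfl fun i _ => hvar i]
    simp
  have hsummem : MemLp (fun x : ℕ → E => (t : ℝ)⁻¹ * ∑ i ∈ Finset.range t, g (x i)) 2 Q :=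
    (memLp_finsetSum _ fun i _ => hmem i).const_mul _
  have hm : ∫ x, (t : ℝ)⁻¹ * ∑ i ∈ Finset.range t, g (x i) ∂Q = ∫ y, g y ∂P := by
    rw [integral_const_mul, integral_finsetSum _ fun i _ => (hmem i).integrable one_le_two,
      Finset.sum_congr rfl fun i _ => hmean i]
    simp; field_simp
  have hv : Var[fun x : ℕ → E => (t : ℝ)⁻¹ * ∑ i ∈ Finset.range t, g (x i); Q] =
      (t : ℝ)⁻¹ * Var[g; P] := by
    have e : (fun x : ℕ → E => ∑ i ∈ Finset.range t, g (x i)) =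
      ∑ i ∈ Finset.range t, fun x : ℕ → E => g (x i) := by ext x; simp
    rw [variance_const_mul, e, hsum]
    field_simp
  rw [variance_eq_integral hsummem.aemeasurable, hm] at hv
  rw [hv, variance_eq_sub hg]
  refine mul_le_mul_of_nonneg_left ?_ (by positivity)
  simp only [Pi.pow_apply]
  nlinarith [sq_nonneg (∫ y, g y ∂P)]

theorem lintegral_abs_empirical_mean_sub_le {g : E → ℝ} {M : ℝ} (hgm : Measurable g)
    (hM : ∀ y, |g y| ≤ M) {t : ℕ} (ht : 1 ≤ t) :
    ∫⁻ x, ENNReal.ofReal |(t : ℝ)⁻¹ * ∑ i ∈ Finset.range t, g (x i) - ∫ y, g y ∂P|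
      ∂(Measure.infinitePi fun _ : ℕ => P) ≤
      ENNReal.ofReal (1 / √t) * (∫⁻ y, ENNReal.ofReal (g y ^ 2) ∂P) ^ (1 / 2 : ℝ) := by
  set Q := Measure.infinitePi fun _ : ℕ => P
  have hg : MemLp g 2 P := MemLp.of_bound hgm.aestronglyMeasurable M
    (Filter.Eventually.of_forall hM)
  have hmem : ∀ i : ℕ, MemLp (fun x : ℕ → E => g (x i)) 2 Q := fun i =>
    hg.comp_measurePreserving (measurePreserving_eval_infinitePi (fun _ : ℕ => P) i)
  have hZ : MemLp (fun x : ℕ → E => (t : ℝ)⁻¹ * ∑ i ∈ Finset.range t, g (x i) - ∫ y, g y ∂P) 2 Q :=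
    ((memLp_finsetSum _ fun i _ => hmem i).const_mul _).sub (memLp_const _)
  rw [← ofReal_integral_eq_lintegral_ofReal (hZ.integrable one_le_two).abs
      (Filter.Eventually.of_forall fun _ => abs_nonneg _),
    ← ofReal_integral_eq_lintegral_ofReal hg.integrable_sq
      (Filter.Eventually.of_forall fun _ => sq_nonneg _),
    ENNReal.ofReal_rpow_of_nonneg (integral_nonneg fun _ => sq_nonneg _) (by norm_num),
    ← Real.sqrt_eq_rpow, ← ENNReal.ofReal_mul (by positivity)]
  refine ENNReal.ofReal_le_ofReal ((integral_abs_le_sqrt hZ).trans ?_)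
  refine (Real.sqrt_le_sqrt (integral_sq_empirical_mean_sub hg hgm ht)).trans_eq ?_
  rw [Real.sqrt_mul (by positivity), Real.sqrt_inv, one_div]

end EmpiricalMean

/-! ### Expected weighted L¹ error of the kernel density estimator. -/

section SmoothDensity

variable {d : ℕ}

/-- The density of `P ∗ N(0, σ² I)`. -/
noncomputable def smoothDensity (σ : ℝ) (P : Measure (EuclideanSpace ℝ (Fin d)))
    (w : EuclideanSpace ℝ (Fin d)) : ℝ :=
  ∫ y, gaussianDensity d σ (w - y) ∂P

variable {σ : ℝ} {P : Measure (EuclideanSpace ℝ (Fin d))} [IsProbabilityMeasure P]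

theorem integrable_gaussianDensity_sub (hσ : 0 < σ) (w : EuclideanSpace ℝ (Fin d)) :
    Integrable (fun y => gaussianDensity d σ (w - y)) P :=
  (integrable_const ((2 * Real.pi * σ ^ 2) ^ (-((d : ℝ) / 2)))).mono'
    ((continuous_gaussianDensity σ).comp (by fun_prop)).aestronglyMeasurable
    (Filter.Eventually.of_forall fun y => by
      rw [Real.norm_of_nonneg (gaussianDensity_pos hσ _).le]; exact gaussianDensity_le hσ _)

theorem smoothDensity_nonneg (hσ : 0 < σ) (P : Measure (EuclideanSpace ℝ (Fin d))) (w : EuclideanSpace ℝ (Fin d)) : 0 ≤ smoothDensity σ P w :=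
  integral_nonneg fun _ => (gaussianDensity_pos hσ _).le

theorem measurable_gaussianDensity_sub (σ : ℝ) :
    Measurable fun p : EuclideanSpace ℝ (Fin d) × EuclideanSpace ℝ (Fin d) => gaussianDensity d σ (p.1 - p.2) :=
  ((continuous_gaussianDensity σ).comp (continuous_fst.sub continuous_snd)).measurable

theorem measurable_smoothDensity (σ : ℝ) (P : Measure (EuclideanSpace ℝ (Fin d))) [IsProbabilityMeasure P] :
    Measurable (smoothDensity σ P) :=
  (StronglyMeasurable.integral_prod_right' (ν := P)
    (measurable_gaussianDensity_sub σ).stronglyMeasurable).measurable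

theorem ofReal_smoothDensity (hσ : 0 < σ) (w : EuclideanSpace ℝ (Fin d)) :
    ENNReal.ofReal (smoothDensity σ P w) =
      ∫⁻ y, ENNReal.ofReal (gaussianDensity d σ (w - y)) ∂P :=
  ofReal_integral_eq_lintegral_ofReal (integrable_gaussianDensity_sub hσ w)
    (Filter.Eventually.of_forall fun _ => (gaussianDensity_pos hσ _).le)

theorem gaussianKernel_eq (d : ℕ) (σ : ℝ) : gaussianKernel d σ =
    volume.withDensity fun x => ENNReal.ofReal (gaussianDensity d σ x) := rfl

theorem isProbabilityMeasure_gaussianKernel (hσ : 0 < σ) :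
    IsProbabilityMeasure (gaussianKernel d σ) := by
  constructor
  rw [gaussianKernel_eq, withDensity_apply _ MeasurableSet.univ, Measure.restrict_univ,
    lintegral_gaussianDensity hσ]

theorem conv_gaussianKernel (hσ : 0 < σ) : P ∗ gaussianKernel d σ =
    volume.withDensity fun w => ENNReal.ofReal (smoothDensity σ P w) := by
  have := isProbabilityMeasure_gaussianKernel (d := d) hσ
  set k : EuclideanSpace ℝ (Fin d) → ℝ≥0∞ := fun x => ENNReal.ofReal (gaussianDensity d σ x)
    with hk
  have hkm : Measurable k := (continuous_gaussianDensity σ).measurable.ennreal_ofReal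
  have hS : Measurable fun w => ENNReal.ofReal (smoothDensity σ P w) :=
    (measurable_smoothDensity σ P).ennreal_ofReal
  refine Measure.ext_of_lintegral _ fun φ hφ => ?_
  rw [Measure.lintegral_conv hφ, lintegral_withDensity_eq_lintegral_mul _ hS hφ]
  have hinner : ∀ y, ∫⁻ z, φ (y + z) ∂(gaussianKernel d σ) = ∫⁻ w, k (w - y) * φ w := by
    intro y
    have hφy : Measurable fun z => φ (y + z) := by fun_prop
    rw [gaussianKernel_eq, lintegral_withDensity_eq_lintegral_mul _ hkm hφy,
      ← lintegral_sub_right_eq_self _ y]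
    refine lintegral_congr fun w => ?_
    simp only [Pi.mul_apply, add_sub_cancel]
  have hswap : ∫⁻ y, ∫⁻ w, k (w - y) * φ w ∂volume ∂P = ∫⁻ w, ∫⁻ y, k (w - y) * φ w ∂P := by
    refine lintegral_lintegral_swap ?_
    have : Measurable fun p : EuclideanSpace ℝ (Fin d) × EuclideanSpace ℝ (Fin d) =>
      k (p.2 - p.1) * φ p.2 := by fun_prop
    exact this.aemeasurable
  simp_rw [hinner]
  rw [hswap]
  refine lintegral_congr fun w => ?_
  have hkw : Measurable fun y => k (w - y) := by fun_prop
  rw [lintegral_mul_const _ hkw, Pi.mul_apply, ofReal_smoothDensity hσ]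

theorem lintegral_smoothDensity (hσ : 0 < σ) :
    ∫⁻ w, ENNReal.ofReal (smoothDensity σ P w) = 1 := by
  have := isProbabilityMeasure_gaussianKernel (d := d) hσ
  have h : (P ∗ gaussianKernel d σ) Set.univ = 1 := measure_univ
  rwa [conv_gaussianKernel hσ, withDensity_apply _ MeasurableSet.univ,
    Measure.restrict_univ] at h

theorem integrable_smoothDensity (hσ : 0 < σ) : Integrable (smoothDensity σ P) := by
  refine ⟨(measurable_smoothDensity σ P).aestronglyMeasurable, ?_⟩
  rw [hasFiniteIntegral_iff_ofReal (Filter.Eventually.of_forall (smoothDensity_nonneg hσ P)),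
    lintegral_smoothDensity hσ]
  exact ENNReal.one_lt_top

theorem integral_smoothDensity (hσ : 0 < σ) : ∫ w, smoothDensity σ P w = 1 := by
  rw [integral_eq_lintegral_of_nonneg_ae
    (Filter.Eventually.of_forall (smoothDensity_nonneg hσ P))
    (measurable_smoothDensity σ P).aestronglyMeasurable, lintegral_smoothDensity hσ]
  rfl

/-- Cauchy–Schwarz after inserting 1 = √q · √(1/q). -/
theorem lintegral_mul_sqrt_le {α : Type*} [MeasurableSpace α] {lam : Measure α}
    {h G : α → ℝ≥0∞} {q : α → ℝ} (hh : Measurable h) (hG : Measurable G) (hq : Measurable q)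
    (hq0 : ∀ x, 0 < q x) :
    ∫⁻ x, h x * G x ^ (1 / 2 : ℝ) ∂lam ≤
      (∫⁻ x, h x ^ 2 * ENNReal.ofReal (q x) ∂lam) ^ (1 / 2 : ℝ) *
        (∫⁻ x, G x * ENNReal.ofReal (1 / q x) ∂lam) ^ (1 / 2 : ℝ) := by
  have hqp : Measurable fun x => ENNReal.ofReal (q x) ^ (1 / 2 : ℝ) := by fun_prop
  have hqi : Measurable fun x => ENNReal.ofReal (1 / q x) ^ (1 / 2 : ℝ) := by fun_prop
  have hGp : Measurable fun x => G x ^ (1 / 2 : ℝ) := by fun_prop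
  have hold := ENNReal.lintegral_mul_le_Lp_mul_Lq lam (p := 2) (q := 2)
    Real.HolderConjugate.two_two (hh.mul hqp).aemeasurable (hGp.mul hqi).aemeasurable
  have hsq : ∀ a : ℝ≥0∞, (a ^ (1 / 2 : ℝ)) ^ (2 : ℝ) = a := fun a => by
    rw [← ENNReal.rpow_mul]; norm_num
  refine le_trans (le_of_eq ?_) (hold.trans (le_of_eq ?_))
  · refine lintegral_congr fun x => ?_
    simp only [Pi.mul_apply]
    have : ENNReal.ofReal (q x) ^ (1 / 2 : ℝ) * ENNReal.ofReal (1 / q x) ^ (1 / 2 : ℝ) = 1 := by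
      rw [← ENNReal.mul_rpow_of_nonneg _ _ (by norm_num), ← ENNReal.ofReal_mul (hq0 x).le,
        mul_one_div_cancel (hq0 x).ne', ENNReal.ofReal_one, ENNReal.one_rpow]
    calc h x * G x ^ (1 / 2 : ℝ) = h x * G x ^ (1 / 2 : ℝ) *
          (ENNReal.ofReal (q x) ^ (1 / 2 : ℝ) * ENNReal.ofReal (1 / q x) ^ (1 / 2 : ℝ)) := by
          rw [this, mul_one]
      _ = _ := by ring
  · congr 2
    · refine lintegral_congr fun x => ?_
      simp only [Pi.mul_apply]
      rw [ENNReal.mul_rpow_of_nonneg _ _ (by norm_num), hsq, ENNReal.rpow_ofNat]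
    · refine lintegral_congr fun x => ?_
      simp only [Pi.mul_apply]
      rw [ENNReal.mul_rpow_of_nonneg _ _ (by norm_num), hsq, hsq]

/-- The dimensional constant `(1/√2 + τ/σ)^(d/2) e^(3d/16)`. -/
noncomputable def dimConst (d : ℕ) (σ τ : ℝ) : ℝ :=
  (1 / √2 + τ / σ) ^ ((d : ℝ) / 2) * Real.exp (3 * d / 16)

/-- With x = τ/σ this compares 1 + 2x² with 1 + 2√2 x + 2x². -/
theorem ratio_le {τ : ℝ} (hσ : 0 < σ) (hτ : 0 < τ) :
    (σ ^ 2 + 2 * τ ^ 2) / σ ^ 2 ≤ 2 * (1 / √2 + τ / σ) ^ 2 := by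
  have h1 : (σ ^ 2 + 2 * τ ^ 2) / σ ^ 2 = 1 + 2 * (τ / σ) ^ 2 := by field_simp
  have h2 : (1 / √2) ^ 2 = 1 / 2 := by rw [div_pow, Real.sq_sqrt (by norm_num)]; norm_num
  have h3 : 0 ≤ 1 / √2 * (τ / σ) := by positivity
  rw [h1]
  nlinarith

/-- This is log 2 ≤ 3/4, the source of the exponent 3d/16. -/
theorem two_rpow_le (d : ℕ) : (2 : ℝ) ^ ((d : ℝ) / 4) ≤ Real.exp (3 * d / 16) := by
  rw [Real.rpow_def_of_pos (by norm_num), Real.exp_le_exp]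
  have := Real.log_two_lt_d9
  have hd : (0 : ℝ) ≤ d := d.cast_nonneg
  nlinarith

theorem sqrt_ratio_rpow_le {τ : ℝ} (d : ℕ) (hσ : 0 < σ) (hτ : 0 < τ) :
    √(((σ ^ 2 + 2 * τ ^ 2) / σ ^ 2) ^ ((d : ℝ) / 2)) ≤ dimConst d σ τ := by
  rw [Real.sqrt_eq_rpow, ← Real.rpow_mul (by positivity)]
  calc ((σ ^ 2 + 2 * τ ^ 2) / σ ^ 2) ^ ((d : ℝ) / 2 * (1 / 2))
      ≤ (2 * (1 / √2 + τ / σ) ^ 2) ^ ((d : ℝ) / 2 * (1 / 2)) :=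
        Real.rpow_le_rpow (by positivity) (ratio_le hσ hτ) (by positivity)
    _ = (1 / √2 + τ / σ) ^ ((d : ℝ) / 2) * 2 ^ ((d : ℝ) / 4) := by
        rw [Real.mul_rpow (by norm_num) (by positivity), ← Real.rpow_natCast (1 / √2 + τ / σ) 2,
          ← Real.rpow_mul (by positivity), mul_comm]
        congr 2 <;> (push_cast; ring)
    _ ≤ _ := mul_le_mul_of_nonneg_left (two_rpow_le d) (by positivity)

theorem measurable_lintegral_gaussianDensity_sq (σ : ℝ) (P : Measure (EuclideanSpace ℝ (Fin d))) [IsProbabilityMeasure P] :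
    Measurable fun w : EuclideanSpace ℝ (Fin d) => ∫⁻ y, ENNReal.ofReal (gaussianDensity d σ (w - y) ^ 2) ∂P :=
  Measurable.lintegral_prod_right' (f := fun p : EuclideanSpace ℝ (Fin d) × EuclideanSpace ℝ (Fin d) =>
    ENNReal.ofReal (gaussianDensity d σ (p.1 - p.2) ^ 2))
    ((measurable_gaussianDensity_sub σ).pow_const 2).ennreal_ofReal

/-- Here 4b = 2s² − σ² = σ² + 4τ², and s² = σ² + 2τ² gives b − τ²/2 = s²/4. The Gaussian factor and
the sub-Gaussian moment then cancel to exactly (s²/σ²)^(d/2). -/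
theorem lintegral_sq_ratio_le {τ s : ℝ} (hσ : 0 < σ) (hτ : 0 < τ) (hs : 0 < s)
    (hs2 : s ^ 2 = σ ^ 2 + 2 * τ ^ 2) (hP : IsSubGaussian (fun x => x) (τ ^ 2) P) :
    ∫⁻ w, (∫⁻ y, ENNReal.ofReal (gaussianDensity d σ (w - y) ^ 2) ∂P) *
      ENNReal.ofReal (1 / gaussianDensity d s (w - ∫ z, z ∂P)) ≤
      ENNReal.ofReal (((σ ^ 2 + 2 * τ ^ 2) / σ ^ 2) ^ ((d : ℝ) / 2)) := by
  set m := ∫ z, z ∂P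
  have hgs : Measurable fun w : EuclideanSpace ℝ (Fin d) => gaussianDensity d s (w - m) :=
    ((continuous_gaussianDensity s).comp (by fun_prop)).measurable
  have hjoint : Measurable fun p : EuclideanSpace ℝ (Fin d) × EuclideanSpace ℝ (Fin d) =>
      gaussianDensity d σ (p.1 - p.2) ^ 2 / gaussianDensity d s (p.1 - m) :=
    ((measurable_gaussianDensity_sub σ).pow_const 2).div (hgs.comp measurable_fst)
  have hσs : σ ^ 2 < 2 * s ^ 2 := by rw [hs2]; nlinarith [sq_pos_of_pos hσ, sq_pos_of_pos hτ]
  set b := (2 * s ^ 2 - σ ^ 2) / 4 with hb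
  have hb0 : 0 < b := by rw [hb]; linarith
  set K := (s ^ 4 / (σ ^ 2 * (2 * s ^ 2 - σ ^ 2))) ^ ((d : ℝ) / 2) with hK
  have hK0 : 0 ≤ K := Real.rpow_nonneg (div_nonneg (by positivity)
    (mul_nonneg (by positivity) (by linarith))) _
  calc ∫⁻ w, (∫⁻ y, ENNReal.ofReal (gaussianDensity d σ (w - y) ^ 2) ∂P) *
        ENNReal.ofReal (1 / gaussianDensity d s (w - m))
      = ∫⁻ w, ∫⁻ y, ENNReal.ofReal (gaussianDensity d σ (w - y) ^ 2 /
          gaussianDensity d s (w - m)) ∂P := by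
        refine lintegral_congr fun w => ?_
        rw [← lintegral_mul_const' _ _ ENNReal.ofReal_ne_top]
        refine lintegral_congr fun y => ?_
        rw [← ENNReal.ofReal_mul (sq_nonneg _), mul_one_div]
    _ = ∫⁻ y, ∫⁻ w, ENNReal.ofReal (gaussianDensity d σ (w - y) ^ 2 /
          gaussianDensity d s (w - m)) ∂volume ∂P :=
        lintegral_lintegral_swap (f := fun w y => ENNReal.ofReal (gaussianDensity d σ (w - y) ^ 2 /
          gaussianDensity d s (w - m)))
          hjoint.ennreal_ofReal.aemeasurable
    _ = ∫⁻ y, ENNReal.ofReal K * ENNReal.ofReal (Real.exp (‖y - m‖ ^ 2 / (4 * b))) ∂P := by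
        refine lintegral_congr fun y => ?_
        rw [← ENNReal.ofReal_mul hK0]
        have h4 : 4 * b = 2 * s ^ 2 - σ ^ 2 := by rw [hb]; ring
        rw [h4, hK, ← lintegral_sq_div_gaussianDensity hσ hs hσs (y - m),
          ← lintegral_sub_right_eq_self (fun z : EuclideanSpace ℝ (Fin d) => ENNReal.ofReal
            (gaussianDensity d σ z ^ 2 / gaussianDensity d s (z + (y - m)))) y]
        refine lintegral_congr fun w => ?_
        rw [sub_add_sub_cancel]
    _ ≤ ENNReal.ofReal K * ENNReal.ofReal ((b / (b - τ ^ 2 / 2)) ^ ((d : ℝ) / 2)) := by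
        rw [lintegral_const_mul' _ _ ENNReal.ofReal_ne_top]
        exact mul_le_mul_right (hP.lintegral_exp_sq_le hb0 (by
          rw [hb, hs2]; nlinarith [sq_pos_of_pos hσ, sq_pos_of_pos hτ])) _
    _ = _ := by
        rw [← ENNReal.ofReal_mul hK0, hK, hb]
        have e1 : (2 * s ^ 2 - σ ^ 2) = σ ^ 2 + 4 * τ ^ 2 := by rw [hs2]; ring
        have e2 : (σ ^ 2 + 4 * τ ^ 2) / 4 - τ ^ 2 / 2 = s ^ 2 / 4 := by rw [hs2]; ring
        rw [e1, e2, ← Real.mul_rpow (by positivity) (by positivity)]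
        congr 2
        rw [← hs2]
        field_simp

theorem lintegral_mul_sqrt_gaussianDensity_sq_le {τ s : ℝ} (hσ : 0 < σ) (hτ : 0 < τ) (hs : 0 < s)
    (hs2 : s ^ 2 = σ ^ 2 + 2 * τ ^ 2) (hP : IsSubGaussian (fun x => x) (τ ^ 2) P)
    {h : EuclideanSpace ℝ (Fin d) → ℝ≥0∞} (hh : Measurable h) :
    ∫⁻ w, h w * (∫⁻ y, ENNReal.ofReal (gaussianDensity d σ (w - y) ^ 2) ∂P) ^ (1 / 2 : ℝ) ≤
      (∫⁻ w, h w ^ 2 * ENNReal.ofReal (gaussianDensity d s (w - ∫ z, z ∂P))) ^ (1 / 2 : ℝ) *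
        ENNReal.ofReal (dimConst d σ τ) := by
  refine (lintegral_mul_sqrt_le hh (measurable_lintegral_gaussianDensity_sq σ P)
    (q := fun w => gaussianDensity d s (w - ∫ z, z ∂P))
    ((continuous_gaussianDensity s).comp (by fun_prop)).measurable
    (fun w => gaussianDensity_pos hs _)).trans ?_
  refine mul_le_mul_right ?_ _
  refine (ENNReal.rpow_le_rpow (lintegral_sq_ratio_le hσ hτ hs hs2 hP) (by norm_num)).trans ?_
  rw [ENNReal.ofReal_rpow_of_nonneg (by positivity) (by norm_num), ← Real.sqrt_eq_rpow]
  exact ENNReal.ofReal_le_ofReal (sqrt_ratio_rpow_le d hσ hτ)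

/-- Expected weighted `L¹` error of the Gaussian kernel density estimator. -/
theorem lintegral_weighted_error_le {τ s : ℝ} (hσ : 0 < σ) (hτ : 0 < τ) (hs : 0 < s)
    (hs2 : s ^ 2 = σ ^ 2 + 2 * τ ^ 2) (hP : IsSubGaussian (fun x => x) (τ ^ 2) P)
    {h : EuclideanSpace ℝ (Fin d) → ℝ≥0∞} (hh : Measurable h) {t : ℕ} (ht : 1 ≤ t) :
    ∫⁻ x, ∫⁻ w, h w * ENNReal.ofReal |(t : ℝ)⁻¹ * ∑ i ∈ Finset.range t,
      gaussianDensity d σ (w - x i) - smoothDensity σ P w| ∂volume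
      ∂(Measure.infinitePi fun _ : ℕ => P) ≤
      ENNReal.ofReal (1 / √t) *
      ((∫⁻ w, h w ^ 2 * ENNReal.ofReal (gaussianDensity d s (w - ∫ z, z ∂P))) ^ (1 / 2 : ℝ) *
        ENNReal.ofReal (dimConst d σ τ)) := by
  have hjoint : Measurable fun p : (ℕ → EuclideanSpace ℝ (Fin d)) × EuclideanSpace ℝ (Fin d) => (t : ℝ)⁻¹ * ∑ i ∈ Finset.range t,
      gaussianDensity d σ (p.2 - p.1 i) - smoothDensity σ P p.2 := by
    refine (Measurable.const_mul (Finset.measurable_sum _ fun i _ => ?_) _).sub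
      ((measurable_smoothDensity σ P).comp measurable_snd)
    exact (continuous_gaussianDensity σ).measurable.comp
      (measurable_snd.sub ((measurable_pi_apply i).comp measurable_fst))
  rw [lintegral_lintegral_swap (f := fun (x : ℕ → EuclideanSpace ℝ (Fin d)) (w : EuclideanSpace ℝ (Fin d)) => h w *
    ENNReal.ofReal |(t : ℝ)⁻¹ * ∑ i ∈ Finset.range t,
      gaussianDensity d σ (w - x i) - smoothDensity σ P w|)
    ((hh.comp measurable_snd).mul (by
      simpa only [← Real.norm_eq_abs] using hjoint.norm.ennreal_ofReal)).aemeasurable]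
  -- At each fixed w the estimator is an average of t bounded i.i.d. variables, so its mean error is
  -- at most t^(-1/2) times the root mean square of the kernel.
  calc ∫⁻ w, ∫⁻ x, h w * ENNReal.ofReal |(t : ℝ)⁻¹ * ∑ i ∈ Finset.range t,
        gaussianDensity d σ (w - x i) - smoothDensity σ P w|
        ∂(Measure.infinitePi fun _ : ℕ => P)
      ≤ ∫⁻ w, ENNReal.ofReal (1 / √t) * (h w *
        (∫⁻ y, ENNReal.ofReal (gaussianDensity d σ (w - y) ^ 2) ∂P) ^ (1 / 2 : ℝ)) := by
        refine lintegral_mono fun w => ?_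
        have hm : Measurable fun x : ℕ → EuclideanSpace ℝ (Fin d) => ENNReal.ofReal |(t : ℝ)⁻¹ *
            ∑ i ∈ Finset.range t, gaussianDensity d σ (w - x i) - smoothDensity σ P w| := by
          simpa only [← Real.norm_eq_abs, Function.comp_def] using
            (hjoint.comp (measurable_prodMk_right (y := w))).norm.ennreal_ofReal
        simp only
        rw [lintegral_const_mul _ hm, mul_left_comm]
        refine mul_le_mul_right ?_ _
        exact lintegral_abs_empirical_mean_sub_le (P := P)
          (g := fun y => gaussianDensity d σ (w - y))
          (M := (2 * Real.pi * σ ^ 2) ^ (-((d : ℝ) / 2)))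
          ((continuous_gaussianDensity σ).comp (by fun_prop)).measurable
          (fun y => by
            rw [abs_of_pos (gaussianDensity_pos hσ _)]; exact gaussianDensity_le hσ _) ht
    _ ≤ _ := by
        rw [lintegral_const_mul' _ _ ENNReal.ofReal_ne_top]
        exact mul_le_mul_right
          (lintegral_mul_sqrt_gaussianDensity_sq_le hσ hτ hs hs2 hP hh) _

end SmoothDensity

/-! ### Swaps, leave-one-out averages and updates of sums. -/

section EmpiricalSums

theorem sum_range_swap {M : Type*} [AddCommMonoid M] (g : ℕ → M) {t i j : ℕ} (hi : i < t)
    (hj : j < t) : ∑ k ∈ Finset.range t, g (Equiv.swap i j k) = ∑ k ∈ Finset.range t, g k := by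
  refine Finset.sum_equiv (Equiv.swap i j) (fun k => ?_) (fun _ _ => rfl)
  simp only [Finset.mem_range, Equiv.swap_apply_def]
  split_ifs <;> omega

/-- The transposition of i and t maps the first t indices onto the first t + 1 indices without i. -/
theorem sum_range_swap_last {M : Type*} [AddCommMonoid M] (g : ℕ → M) {t i : ℕ}
    (hi : i ∈ Finset.range (t + 1)) :
    ∑ k ∈ Finset.range t, g (Equiv.swap i t k) = ∑ k ∈ (Finset.range (t + 1)).erase i, g k := by
  rw [Finset.mem_range] at hi
  refine Finset.sum_equiv (Equiv.swap i t) (fun k => ?_) (fun _ _ => rfl)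
  simp only [Finset.mem_range, Finset.mem_erase, Equiv.swap_apply_def]
  split_ifs <;> omega

/-- Averaging the leave-one-out sums recovers the full sum. -/
theorem sum_leave_one_out {M : Type*} [AddCommMonoid M] (g : ℕ → M) (t : ℕ) :
    ∑ i ∈ Finset.range (t + 1), ∑ k ∈ Finset.range t, g (Equiv.swap i t k) =
      t • ∑ k ∈ Finset.range (t + 1), g k := by
  rw [Finset.sum_congr rfl fun i hi => sum_range_swap_last g hi,
    Finset.sum_comm' (t' := Finset.range (t + 1)) (s' := fun k => (Finset.range (t + 1)).erase k)
      (fun i k => by simp only [Finset.mem_erase]; tauto), Finset.smul_sum]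
  refine Finset.sum_congr rfl fun k hk => ?_
  rw [Finset.sum_const, Finset.card_erase_of_mem hk, Finset.card_range, Nat.add_sub_cancel]

theorem sum_range_update {E M : Type*} [AddCommGroup M] (g : E → M) (x : ℕ → E) {t i : ℕ}
    (hi : i < t) (y : E) : ∑ k ∈ Finset.range t, g (Function.update x i y k) =
      ∑ k ∈ Finset.range t, g (x k) + (g y - g (x i)) := by
  have hi' := Finset.mem_range.2 hi
  rw [← Finset.add_sum_erase _ _ hi', ← Finset.add_sum_erase _ (fun k => g (x k)) hi',
    Function.update_self, Finset.sum_congr rfl fun k hk => by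
      rw [Function.update_of_ne (Finset.ne_of_mem_erase hk)]]
  abel

end EmpiricalSums

/-! ### The total variation functional. -/

section TotalVariation

variable {d : ℕ} {σ : ℝ} {P : Measure (EuclideanSpace ℝ (Fin d))}

/-- The error of the Gaussian kernel density estimator at a point. -/
noncomputable def densityError (σ : ℝ) (P : Measure (EuclideanSpace ℝ (Fin d))) (t : ℕ)
    (x : ℕ → EuclideanSpace ℝ (Fin d)) (w : EuclideanSpace ℝ (Fin d)) : ℝ :=
  (t : ℝ)⁻¹ * ∑ i ∈ Finset.range t, gaussianDensity d σ (w - x i) - smoothDensity σ P w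

/-- Half the `L¹` error of the Gaussian kernel density estimator. -/
noncomputable def halfL1Error (σ : ℝ) (P : Measure (EuclideanSpace ℝ (Fin d))) (t : ℕ)
    (x : ℕ → EuclideanSpace ℝ (Fin d)) : ℝ :=
  (∫ w, |densityError σ P t x w|) / 2

theorem swapInvariant_halfL1Error (t : ℕ) : SwapInvariant t (halfL1Error σ P t) := by
  intro i j hi hj x
  simp only [halfL1Error, densityError]
  congr 2
  ext w
  rw [sum_range_swap (fun k => gaussianDensity d σ (w - x k)) hi hj]

theorem halfL1Error_congr (t : ℕ) {x y : ℕ → EuclideanSpace ℝ (Fin d)}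
    (h : ∀ i < t, x i = y i) : halfL1Error σ P t x = halfL1Error σ P t y := by
  simp only [halfL1Error, densityError]
  congr 2
  ext w
  rw [Finset.sum_congr rfl fun i hi => by rw [h i (Finset.mem_range.1 hi)]]

variable [IsProbabilityMeasure P]

theorem measurable_densityError (σ : ℝ) (P : Measure (EuclideanSpace ℝ (Fin d)))
    [IsProbabilityMeasure P] (t : ℕ) :
    Measurable fun p : (ℕ → EuclideanSpace ℝ (Fin d)) × EuclideanSpace ℝ (Fin d) =>
      densityError σ P t p.1 p.2 := by
  refine (Measurable.const_mul (Finset.measurable_sum _ fun i _ => ?_) _).sub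
    ((measurable_smoothDensity σ P).comp measurable_snd)
  exact (continuous_gaussianDensity σ).measurable.comp
    (measurable_snd.sub ((measurable_pi_apply i).comp measurable_fst))

theorem integrable_gaussianDensity_translate (hσ : 0 < σ) (y : EuclideanSpace ℝ (Fin d)) :
    Integrable fun w => gaussianDensity d σ (w - y) :=
  (integrable_gaussianDensity hσ).comp_sub_right y

theorem integrable_densityError (hσ : 0 < σ) (t : ℕ) (x : ℕ → EuclideanSpace ℝ (Fin d)) :
    Integrable (densityError σ P t x) :=
  ((integrable_finsetSum _ fun i _ => integrable_gaussianDensity_translate hσ (x i)).const_mul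
    _).sub (integrable_smoothDensity hσ)

theorem isProbabilityMeasure_empiricalMeasure {E Ω : Type*} [MeasurableSpace E] (X : ℕ → Ω → E)
    {t : ℕ} (ht : 1 ≤ t) (ω : Ω) : IsProbabilityMeasure (empiricalMeasure X t ω) := by
  constructor
  have h0 : (t : ℝ≥0∞) ≠ 0 := by simp; omega
  simp [empiricalMeasure, ENNReal.inv_mul_cancel h0]

theorem smoothDensity_empiricalMeasure {Ω : Type*} (hσ : 0 < σ)
    (X : ℕ → Ω → EuclideanSpace ℝ (Fin d)) (t : ℕ) (ω : Ω) (w : EuclideanSpace ℝ (Fin d)) :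
    smoothDensity σ (empiricalMeasure X t ω) w =
      (t : ℝ)⁻¹ * ∑ i ∈ Finset.range t, gaussianDensity d σ (w - X i ω) := by
  rw [smoothDensity, empiricalMeasure, integral_smul_measure, integral_finsetSum_measure]
  · simp
  · exact fun i _ => integrable_gaussianDensity_sub hσ w

/-- Replaces a supremum over uncountably many sets by a functional that is measurable in the sample;
domination is enough for an upper bound on the crossing probability. -/
theorem smoothedTV_le_halfL1Error {Ω : Type*} (hσ : 0 < σ)
    (X : ℕ → Ω → EuclideanSpace ℝ (Fin d)) {t : ℕ} (ht : 1 ≤ t) (ω : Ω) :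
    smoothedTV σ (empiricalMeasure X t ω) P ≤ halfL1Error σ P t (fun i => X i ω) := by
  have := isProbabilityMeasure_empiricalMeasure X ht ω
  rw [smoothedTV, conv_gaussianKernel hσ, conv_gaussianKernel hσ]
  refine (tvDistance_withDensity_le (integrable_smoothDensity hσ) (integrable_smoothDensity hσ)
    (smoothDensity_nonneg hσ _) (smoothDensity_nonneg hσ _)
    ((integral_smoothDensity hσ).trans (integral_smoothDensity hσ).symm)).trans_eq ?_
  simp only [smoothDensity_empiricalMeasure hσ]
  rfl

theorem measurable_halfL1Error (t : ℕ) : Measurable (halfL1Error σ P t) := by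
  have h : StronglyMeasurable fun x => ∫ w, |densityError σ P t x w| :=
    StronglyMeasurable.integral_prod_right' (f := fun p : (ℕ → EuclideanSpace ℝ (Fin d)) ×
      EuclideanSpace ℝ (Fin d) => |densityError σ P t p.1 p.2|)
      (by simpa only [← Real.norm_eq_abs] using
        (measurable_densityError σ P t).norm.stronglyMeasurable)
  exact h.measurable.div_const 2

/-- One Gaussian bump of mass 1/t is exchanged for another, so the L¹ norm moves by at most 2/t. -/
theorem abs_halfL1Error_sub_update_le (hσ : 0 < σ) {t i : ℕ} (hi : i < t)
    (x : ℕ → EuclideanSpace ℝ (Fin d)) (y : EuclideanSpace ℝ (Fin d)) :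
    |halfL1Error σ P t x - halfL1Error σ P t (Function.update x i y)| ≤ (t : ℝ)⁻¹ := by
  have i1 := integrable_densityError (P := P) hσ t x
  have i2 := integrable_densityError (P := P) hσ t (Function.update x i y)
  have j1 := integrable_gaussianDensity_translate hσ (x i)
  have j2 := integrable_gaussianDensity_translate hσ y
  rw [halfL1Error, halfL1Error, ← sub_div, ← integral_sub i1.abs i2.abs, abs_div,
    abs_of_pos (show (0 : ℝ) < 2 by norm_num), div_le_iff₀ (by norm_num)]
  calc |∫ w, (|densityError σ P t x w| - |densityError σ P t (Function.update x i y) w|)|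
      ≤ ∫ w, |(|densityError σ P t x w| - |densityError σ P t (Function.update x i y) w|)| :=
        abs_integral_le_integral_abs
    _ ≤ ∫ w, (t : ℝ)⁻¹ * (gaussianDensity d σ (w - x i) + gaussianDensity d σ (w - y)) := by
        refine integral_mono (i1.abs.sub i2.abs).abs ((j1.add j2).const_mul _) fun w => ?_
        refine (abs_abs_sub_abs_le_abs_sub _ _).trans ?_
        have e : densityError σ P t x w - densityError σ P t (Function.update x i y) w =
            (t : ℝ)⁻¹ * (gaussianDensity d σ (w - x i) - gaussianDensity d σ (w - y)) := by
          simp only [densityError]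
          rw [sum_range_update (fun z => gaussianDensity d σ (w - z)) x hi y]
          ring
        rw [e, abs_mul, abs_of_nonneg (by positivity : (0 : ℝ) ≤ (t : ℝ)⁻¹)]
        refine mul_le_mul_of_nonneg_left ?_ (by positivity)
        have a1 := gaussianDensity_pos hσ (w - x i)
        have a2 := gaussianDensity_pos hσ (w - y)
        rw [abs_le]
        constructor <;> linarith
    _ = (t : ℝ)⁻¹ * 2 := by
        rw [integral_const_mul, integral_add j1 j2,
          integral_sub_right_eq_self (gaussianDensity d σ),
          integral_sub_right_eq_self (gaussianDensity d σ), integral_gaussianDensity hσ]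
        norm_num

/-- The density error at time t + 1 is exactly the average of the leave-one-out errors; the triangle
inequality does the rest. -/
theorem halfL1Error_succ_le (hσ : 0 < σ) {t : ℕ} (ht : 1 ≤ t)
    (x : ℕ → EuclideanSpace ℝ (Fin d)) :
    halfL1Error σ P (t + 1) x ≤ ((t + 1 : ℕ) : ℝ)⁻¹ *
      ∑ i ∈ Finset.range (t + 1), halfL1Error σ P t (fun k => x (Equiv.swap i t k)) := by
  have ht0 : (0 : ℝ) < t := by exact_mod_cast ht
  have hi : ∀ i, Integrable (densityError σ P t (fun k => x (Equiv.swap i t k))) := fun i =>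
    integrable_densityError hσ t _
  simp only [halfL1Error]
  rw [← Finset.sum_div, ← mul_div_assoc, ← integral_finsetSum _ fun i _ => (hi i).abs,
    ← integral_const_mul]
  refine div_le_div_of_nonneg_right ?_ (by norm_num)
  refine integral_mono (integrable_densityError hσ _ x).abs
    ((integrable_finsetSum _ fun i _ => (hi i).abs).const_mul _) fun w => ?_
  have e : densityError σ P (t + 1) x w = ((t + 1 : ℕ) : ℝ)⁻¹ *
      ∑ i ∈ Finset.range (t + 1), densityError σ P t (fun k => x (Equiv.swap i t k)) w := by
    simp only [densityError]
    rw [Finset.sum_sub_distrib, ← Finset.mul_sum,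
      sum_leave_one_out (fun k => gaussianDensity d σ (w - x k)) t]
    simp only [Finset.sum_const, Finset.card_range, nsmul_eq_mul]
    field_simp
  simp only [e]
  rw [abs_mul, abs_of_nonneg (by positivity)]
  exact mul_le_mul_of_nonneg_left (Finset.abs_sum_le_sum_abs _ _) (by positivity)

theorem integral_halfL1Error_le {τ : ℝ} (hσ : 0 < σ) (hτ : 0 < τ)
    (hP : IsSubGaussian (fun x => x) (τ ^ 2) P) {t : ℕ} (ht : 1 ≤ t) :
    ∫ x, halfL1Error σ P t x ∂(Measure.infinitePi fun _ : ℕ => P) ≤ dimConst d σ τ / 2 / √t := by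
  have hA : 0 ≤ dimConst d σ τ := by unfold dimConst; positivity
  have hs2 : √(σ ^ 2 + 2 * τ ^ 2) ^ 2 = σ ^ 2 + 2 * τ ^ 2 := Real.sq_sqrt (by positivity)
  have h := lintegral_weighted_error_le hσ hτ (s := √(σ ^ 2 + 2 * τ ^ 2)) (by positivity) hs2 hP
    (h := fun _ => 1) measurable_const ht
  have hone : ∫⁻ w, ENNReal.ofReal (gaussianDensity d √(σ ^ 2 + 2 * τ ^ 2) (w - ∫ z, z ∂P)) = 1 := by
    rw [lintegral_sub_right_eq_self
      (fun w => ENNReal.ofReal (gaussianDensity d √(σ ^ 2 + 2 * τ ^ 2) w)),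
      lintegral_gaussianDensity (by positivity)]
  simp only [one_mul, one_pow, hone, ENNReal.one_rpow] at h
  rw [← ENNReal.ofReal_mul (by positivity)] at h
  have hconv : ∀ x : ℕ → EuclideanSpace ℝ (Fin d), ENNReal.ofReal (∫ w, |densityError σ P t x w|) =
      ∫⁻ w, ENNReal.ofReal |densityError σ P t x w| := fun x =>
    ofReal_integral_eq_lintegral_ofReal (integrable_densityError hσ t x).abs
      (Filter.Eventually.of_forall fun _ => abs_nonneg _)
  have h2 : ∫⁻ x, ENNReal.ofReal (∫ w, |densityError σ P t x w|)
      ∂(Measure.infinitePi fun _ : ℕ => P) ≤ ENNReal.ofReal (1 / √t * dimConst d σ τ) := by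
    simp_rw [hconv]; exact h
  simp only [halfL1Error]
  have hmeas : Measurable fun x => ∫ w, |densityError σ P t x w| := by
    have := (measurable_halfL1Error (σ := σ) (P := P) t).mul_const 2
    simpa [halfL1Error] using this
  rw [integral_div, integral_eq_lintegral_of_nonneg_ae
    (Filter.Eventually.of_forall fun x => integral_nonneg fun w => abs_nonneg _)
    hmeas.aestronglyMeasurable]
  have h3 := ENNReal.toReal_le_of_le_ofReal (by positivity) h2
  calc _ ≤ (1 / √t * dimConst d σ τ) / 2 := div_le_div_of_nonneg_right h3 (by norm_num)
    _ = _ := by ring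

end TotalVariation

/-! ### Continuity from coordinatewise Lipschitz bounds. -/

section CoordinatewiseLipschitz

open Filter Topology

theorem abs_sub_le_of_update_le {E : Type*} [PseudoMetricSpace E] {F : (ℕ → E) → ℝ} {c : ℝ} {n : ℕ}
    (hdep : ∀ x y : ℕ → E, (∀ i < n, x i = y i) → F x = F y)
    (hbd : ∀ x, ∀ i < n, ∀ y, |F x - F (Function.update x i y)| ≤ c * dist (x i) y)
    (x y : ℕ → E) : |F x - F y| ≤ c * ∑ i ∈ Finset.range n, dist (x i) (y i) := by
  have key : ∀ k ≤ n, |F x - F (fun i => if i < k then y i else x i)| ≤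
      c * ∑ i ∈ Finset.range k, dist (x i) (y i) := by
    intro k hk
    induction k with
    | zero => simp
    | succ k ih =>
      have h1 := ih (by omega)
      have h2 := hbd (fun i => if i < k then y i else x i) k (by omega) (y k)
      have e : Function.update (fun i => if i < k then y i else x i) k (y k) =
          fun i => if i < k + 1 then y i else x i := by
        ext i
        by_cases hi : i = k
        · subst hi; simp
        · rw [Function.update_of_ne hi]
          have : i < k + 1 ↔ i < k := by omega
          simp only [this]
      rw [e] at h2
      simp only [lt_irrefl, if_false] at h2
      rw [Finset.sum_range_succ, mul_add]
      exact (abs_sub_le _ _ _).trans (add_le_add h1 h2)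
  have h := key n le_rfl
  rwa [hdep (fun i => if i < n then y i else x i) y fun i hi => by simp [hi]] at h

/-- Used for measurability of the Wasserstein functional, whose definition as an infimum over
couplings does not provide it. -/
theorem continuous_of_update_le {E : Type*} [PseudoMetricSpace E] {F : (ℕ → E) → ℝ} {c : ℝ} {n : ℕ}
    (hdep : ∀ x y : ℕ → E, (∀ i < n, x i = y i) → F x = F y)
    (hbd : ∀ x, ∀ i < n, ∀ y, |F x - F (Function.update x i y)| ≤ c * dist (x i) y) :
    Continuous F := by
  rw [continuous_iff_continuousAt]
  intro x
  have hlim : Tendsto (fun z : ℕ → E => c * ∑ i ∈ Finset.range n, dist (z i) (x i)) (𝓝 x) (𝓝 0) := by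
    have hc : Continuous fun z : ℕ → E => c * ∑ i ∈ Finset.range n, dist (z i) (x i) := by fun_prop
    simpa using hc.tendsto x
  rw [ContinuousAt, tendsto_iff_dist_tendsto_zero]
  refine squeeze_zero (fun _ => dist_nonneg) (fun z => ?_) hlim
  rw [Real.dist_eq]
  exact abs_sub_le_of_update_le hdep hbd z x

end CoordinatewiseLipschitz

/-! ### Algebra of empirical measures and their convolutions. -/

section EmpiricalMeasure

variable {E Ω : Type*} [MeasurableSpace E]

theorem finiteFirstMoment_empiricalMeasure [PseudoEMetricSpace E] [OpensMeasurableSpace E]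
    (hE : ∀ a b : E, edist a b ≠ ∞) (X : ℕ → Ω → E) {t : ℕ} (ht : 1 ≤ t) (ω : Ω) (m : E) :
    ∫⁻ y, edist y m ∂(empiricalMeasure X t ω) ≠ ∞ := by
  have h0 : (t : ℝ≥0∞) ≠ 0 := by simp; omega
  have hm : Measurable fun y => edist y m := measurable_edist_left
  rw [empiricalMeasure, lintegral_smul_measure, lintegral_finsetSum_measure]
  refine ENNReal.mul_ne_top (ENNReal.inv_ne_top.2 h0) (ENNReal.sum_ne_top.2 fun i _ => ?_)
  rw [lintegral_dirac' _ hm]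
  exact hE _ _

theorem empiricalMeasure_swap (X : ℕ → Ω → E) {t i j : ℕ} (hi : i < t) (hj : j < t) (ω : Ω) :
    empiricalMeasure (fun k => X (Equiv.swap i j k)) t ω = empiricalMeasure X t ω := by
  rw [empiricalMeasure, empiricalMeasure, sum_range_swap (fun k => Measure.dirac (X k ω)) hi hj]

theorem empiricalMeasure_succ (X : ℕ → Ω → E) {t : ℕ} (ht : 1 ≤ t) (ω : Ω) :
    empiricalMeasure X (t + 1) ω = ∑ i ∈ Finset.range (t + 1), ((t + 1 : ℕ) : ℝ≥0∞)⁻¹ •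
      empiricalMeasure (fun k => X (Equiv.swap i t k)) t ω := by
  have h0 : (t : ℝ≥0∞) ≠ 0 := by simp; omega
  simp only [empiricalMeasure]
  rw [← Finset.smul_sum, ← Finset.smul_sum,
    sum_leave_one_out (fun k => Measure.dirac (X k ω)) t, ← Nat.cast_smul_eq_nsmul ℝ≥0∞,
    smul_smul (t : ℝ≥0∞)⁻¹, ENNReal.inv_mul_cancel h0 (by simp), one_smul]

theorem empiricalMeasure_eq_add_erase (X : ℕ → Ω → E) {t i : ℕ} (hi : i < t) (ω : Ω) :
    empiricalMeasure X t ω = (t : ℝ≥0∞)⁻¹ • Measure.dirac (X i ω) +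
      (t : ℝ≥0∞)⁻¹ • ∑ k ∈ (Finset.range t).erase i, Measure.dirac (X k ω) := by
  rw [empiricalMeasure, ← Finset.add_sum_erase _ _ (Finset.mem_range.2 hi), smul_add]

end EmpiricalMeasure

section Convolution

variable {E : Type*} [AddMonoid E] [MeasurableSpace E] [MeasurableAdd₂ E]

theorem sum_smul_conv {ι : Type*} (s : Finset ι) (w : ι → ℝ≥0∞) (μ : ι → Measure E)
    (G : Measure E) [SFinite G] :
    (∑ i ∈ s, w i • μ i) ∗ G = ∑ i ∈ s, w i • (μ i ∗ G) := by
  refine Measure.ext_of_lintegral _ fun φ hφ => ?_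
  rw [Measure.lintegral_conv hφ, lintegral_finsetSum_measure, lintegral_finsetSum_measure]
  simp_rw [lintegral_smul_measure, Measure.lintegral_conv hφ]

end Convolution

/-! ### The smoothed Wasserstein functional. -/

section Wasserstein

variable {d : ℕ} {σ : ℝ} {P : Measure (EuclideanSpace ℝ (Fin d))}

/-- The smoothed Wasserstein distance of the empirical measure as a function of the sample. -/
noncomputable def sampleW1 (σ : ℝ) (P : Measure (EuclideanSpace ℝ (Fin d))) (t : ℕ)
    (x : ℕ → EuclideanSpace ℝ (Fin d)) : ℝ :=
  (smoothedW1 σ (empiricalMeasure (fun i (_ : Unit) => x i) t ()) P).toReal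

theorem swapInvariant_sampleW1 (t : ℕ) : SwapInvariant t (sampleW1 σ P t) := by
  intro i j hi hj x
  rw [sampleW1, sampleW1, empiricalMeasure_swap (fun k (_ : Unit) => x k) hi hj]

theorem sampleW1_congr (t : ℕ) {x y : ℕ → EuclideanSpace ℝ (Fin d)}
    (h : ∀ i < t, x i = y i) : sampleW1 σ P t x = sampleW1 σ P t y := by
  simp only [sampleW1, empiricalMeasure]
  rw [Finset.sum_congr rfl fun i hi => by rw [h i (Finset.mem_range.1 hi)]]

/-- After smoothing, the two empirical measures differ by a translation by y − x_i of one Gaussian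
component of mass 1/t. -/
theorem smoothedW1_update_le (hσ : 0 < σ) {t i : ℕ} (hi : i < t)
    (x : ℕ → EuclideanSpace ℝ (Fin d)) (y : EuclideanSpace ℝ (Fin d)) :
    smoothedW1 σ (empiricalMeasure (fun k (_ : Unit) => Function.update x i y k) t ()) P ≤
      smoothedW1 σ (empiricalMeasure (fun k (_ : Unit) => x k) t ()) P +
        (t : ℝ≥0∞)⁻¹ * edist (x i) y := by
  have := isProbabilityMeasure_gaussianKernel (d := d) hσ
  have h0 : (t : ℝ≥0∞) ≠ 0 := by simp; omega
  have htop : (t : ℝ≥0∞)⁻¹ ≠ ∞ := ENNReal.inv_ne_top.2 h0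
  set G := gaussianKernel d σ
  set S : Measure (EuclideanSpace ℝ (Fin d)) := (t : ℝ≥0∞)⁻¹ •
    ∑ k ∈ (Finset.range t).erase i, Measure.dirac (x k) with hS
  have hSf : IsFiniteMeasure S := by
    have : IsFiniteMeasure (∑ k ∈ (Finset.range t).erase i, Measure.dirac (x k)) := inferInstance
    exact Measure.smul_finite _ htop
  have hdf : ∀ z, IsFiniteMeasure ((t : ℝ≥0∞)⁻¹ • Measure.dirac z :
      Measure (EuclideanSpace ℝ (Fin d))) := fun z => Measure.smul_finite _ htop
  have hdG : ∀ z, ((t : ℝ≥0∞)⁻¹ • Measure.dirac z) ∗ G =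
      (t : ℝ≥0∞)⁻¹ • G.map (fun u => z + u) := fun z => by
    rw [Measure.conv_smul_left, Measure.dirac_conv]
  have e1 : empiricalMeasure (fun k (_ : Unit) => x k) t () ∗ G =
      (t : ℝ≥0∞)⁻¹ • G.map (fun u => x i + u) + S ∗ G := by
    have := hdf (x i)
    rw [empiricalMeasure_eq_add_erase _ hi, Measure.add_conv, hdG]
  have e2 : empiricalMeasure (fun k (_ : Unit) => Function.update x i y k) t () ∗ G =
      ((t : ℝ≥0∞)⁻¹ • G.map (fun u => x i + u)).map (fun w => w + (y - x i)) + S ∗ G := by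
    have := hdf y
    have hS' : (t : ℝ≥0∞)⁻¹ • ∑ k ∈ (Finset.range t).erase i,
        Measure.dirac (Function.update x i y k) = S := by
      rw [hS, Finset.sum_congr rfl fun k hk => by
        rw [Function.update_of_ne (Finset.ne_of_mem_erase hk)]]
    rw [empiricalMeasure_eq_add_erase _ hi, hS', Function.update_self, Measure.add_conv, hdG,
      Measure.map_smul, Measure.map_map (by fun_prop) (by fun_prop)]
    congr 3
    ext u : 1
    simp only [Function.comp_apply]
    abel
  have hGm : IsProbabilityMeasure (G.map (fun u => x i + u)) :=
    Measure.isProbabilityMeasure_map (by fun_prop)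
  have hf1 : IsFiniteMeasure ((t : ℝ≥0∞)⁻¹ • G.map (fun u => x i + u)) :=
    Measure.smul_finite _ htop
  rw [smoothedW1, smoothedW1, e1, e2]
  refine (wasserstein1_map_add_le (by fun_prop)).trans (add_le_add_right (le_of_eq ?_) _)
  have hc : ∀ w : EuclideanSpace ℝ (Fin d), edist (w + (y - x i)) w = edist (x i) y := fun w => by
    rw [edist_dist, edist_dist, dist_eq_norm, dist_eq_norm, add_sub_cancel_left, norm_sub_rev]
  simp_rw [hc]
  rw [lintegral_const, Measure.smul_apply, measure_univ, smul_eq_mul, mul_one, mul_comm]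

variable [IsProbabilityMeasure P]

theorem lintegral_edist_gaussianKernel_ne_top (hσ : 0 < σ) :
    ∫⁻ z, edist z 0 ∂(gaussianKernel d σ) ≠ ∞ := by
  have := isProbabilityMeasure_gaussianKernel (d := d) hσ
  have hgm : Measurable fun x => ENNReal.ofReal (gaussianDensity d σ x) :=
    (continuous_gaussianDensity σ).measurable.ennreal_ofReal
  have hsq : ∫⁻ z, ENNReal.ofReal (‖z‖ ^ 2) ∂(gaussianKernel d σ) ≠ ∞ := by
    rw [gaussianKernel_eq, lintegral_withDensity_eq_lintegral_mul _ hgm (by fun_prop)]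
    refine ne_top_of_le_ne_top ENNReal.ofReal_ne_top
      (le_trans (le_of_eq ?_) (lintegral_sq_mul_gaussianDensity_le (d := d) hσ))
    refine lintegral_congr fun z => ?_
    rw [Pi.mul_apply, ← ENNReal.ofReal_mul (gaussianDensity_pos hσ z).le, mul_comm]
  refine ne_top_of_le_ne_top (b := ∫⁻ z, (1 + ENNReal.ofReal (‖z‖ ^ 2)) ∂(gaussianKernel d σ)) ?_ ?_
  · rw [lintegral_add_left measurable_const, lintegral_const, measure_univ, mul_one]
    exact ENNReal.add_ne_top.2 ⟨ENNReal.one_ne_top, hsq⟩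
  · refine lintegral_mono fun z => ?_
    rw [edist_dist, dist_zero_right, ← ENNReal.ofReal_one, ← ENNReal.ofReal_add zero_le_one
      (sq_nonneg _)]
    refine ENNReal.ofReal_le_ofReal ?_
    nlinarith [sq_nonneg (‖z‖ - 1)]

theorem lintegral_edist_conv_ne_top (hσ : 0 < σ) {ν : Measure (EuclideanSpace ℝ (Fin d))}
    [IsProbabilityMeasure ν] {m : EuclideanSpace ℝ (Fin d)} (hR : ∫⁻ y, edist y m ∂ν ≠ ∞) :
    ∫⁻ w, edist w m ∂(ν ∗ gaussianKernel d σ) ≠ ∞ := by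
  have := isProbabilityMeasure_gaussianKernel (d := d) hσ
  rw [Measure.lintegral_conv measurable_edist_left]
  refine ne_top_of_le_ne_top (b := ∫⁻ y, ∫⁻ z, (edist z 0 + edist y m)
    ∂(gaussianKernel d σ) ∂ν) ?_ ?_
  · simp_rw [lintegral_add_right _ measurable_const, lintegral_const, measure_univ, mul_one]
    rw [lintegral_add_left measurable_const, lintegral_const, measure_univ, mul_one]
    exact ENNReal.add_ne_top.2 ⟨lintegral_edist_gaussianKernel_ne_top hσ, hR⟩
  · refine lintegral_mono fun y => lintegral_mono fun z => ?_
    refine (edist_triangle (y + z) y m).trans (add_le_add_left ?_ _)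
    rw [edist_dist, edist_dist, dist_eq_norm, dist_eq_norm, add_sub_cancel_left, sub_zero]

theorem FiniteFirstMoment.lintegral_ne_top {ν : Measure (EuclideanSpace ℝ (Fin d))}
    [IsProbabilityMeasure ν] (h : FiniteFirstMoment ν) (m : EuclideanSpace ℝ (Fin d)) :
    ∫⁻ y, edist y m ∂ν ≠ ∞ := by
  obtain ⟨x₀, hx₀⟩ := h
  refine ne_top_of_le_ne_top (b := ∫⁻ y, (edist y x₀ + edist x₀ m) ∂ν) ?_
    (lintegral_mono fun y => edist_triangle _ _ _)
  rw [lintegral_add_right _ measurable_const, lintegral_const, measure_univ, mul_one]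
  exact ENNReal.add_ne_top.2 ⟨hx₀, edist_ne_top _ _⟩

theorem smoothedW1_le (hσ : 0 < σ) (ν : Measure (EuclideanSpace ℝ (Fin d)))
    [IsProbabilityMeasure ν] (m : EuclideanSpace ℝ (Fin d)) :
    smoothedW1 σ ν P ≤ ∫⁻ w, edist w m *
      ENNReal.ofReal |smoothDensity σ ν w - smoothDensity σ P w| := by
  rw [smoothedW1, conv_gaussianKernel hσ, conv_gaussianKernel hσ]
  exact wasserstein1_withDensity_le (measurable_smoothDensity σ ν) (measurable_smoothDensity σ P)
    (lintegral_smoothDensity hσ) (lintegral_smoothDensity hσ) m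

/-- The weighted L¹ bound is finite because |p − q| ≤ p + q and both smoothed laws have finite first
moments. -/
theorem smoothedW1_ne_top (hσ : 0 < σ) (hP : FiniteFirstMoment P)
    {ν : Measure (EuclideanSpace ℝ (Fin d))} [IsProbabilityMeasure ν] (hR : FiniteFirstMoment ν) :
    smoothedW1 σ ν P ≠ ∞ := by
  have hm1 : ∀ S : Measure (EuclideanSpace ℝ (Fin d)), IsProbabilityMeasure S →
      FiniteFirstMoment S → ∫⁻ w, ENNReal.ofReal (smoothDensity σ S w) * edist w 0 ≠ ∞ := by
    intro S _ hS
    have h := lintegral_edist_conv_ne_top (σ := σ) hσ (hS.lintegral_ne_top 0)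
    rwa [conv_gaussianKernel hσ, lintegral_withDensity_eq_lintegral_mul _
      (measurable_smoothDensity σ S).ennreal_ofReal measurable_edist_left] at h
  refine ne_top_of_le_ne_top ?_ (smoothedW1_le hσ ν 0)
  refine ne_top_of_le_ne_top (b := ∫⁻ w, (ENNReal.ofReal (smoothDensity σ ν w) * edist w 0 +
    ENNReal.ofReal (smoothDensity σ P w) * edist w 0)) ?_ (lintegral_mono fun w => ?_)
  · rw [lintegral_add_left (f := fun w => ENNReal.ofReal (smoothDensity σ ν w) * edist w 0)
      ((measurable_smoothDensity σ ν).ennreal_ofReal.mul measurable_edist_left)]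
    exact ENNReal.add_ne_top.2 ⟨hm1 ν inferInstance hR, hm1 P inferInstance hP⟩
  · rw [← add_mul, mul_comm]
    refine mul_le_mul_left ?_ _
    have a := smoothDensity_nonneg hσ ν w
    have b := smoothDensity_nonneg hσ P w
    rw [← ENNReal.ofReal_add a b]
    refine ENNReal.ofReal_le_ofReal (abs_le.2 ⟨by linarith, by linarith⟩)

theorem smoothedW1_empiricalMeasure_ne_top {Ω : Type*} (hσ : 0 < σ) (hP : FiniteFirstMoment P)
    (X : ℕ → Ω → EuclideanSpace ℝ (Fin d)) {t : ℕ} (ht : 1 ≤ t) (ω : Ω) :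
    smoothedW1 σ (empiricalMeasure X t ω) P ≠ ∞ := by
  have := isProbabilityMeasure_empiricalMeasure X ht ω
  exact smoothedW1_ne_top hσ hP
    ⟨0, finiteFirstMoment_empiricalMeasure (fun _ _ => edist_ne_top _ _) X ht ω 0⟩

theorem abs_sampleW1_sub_update_le (hσ : 0 < σ) (hP : FiniteFirstMoment P) {t i : ℕ} (hi : i < t)
    (x : ℕ → EuclideanSpace ℝ (Fin d)) (y : EuclideanSpace ℝ (Fin d)) :
    |sampleW1 σ P t x - sampleW1 σ P t (Function.update x i y)| ≤ (t : ℝ)⁻¹ * dist (x i) y := by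
  have ht : 1 ≤ t := by omega
  have key : ∀ (x : ℕ → EuclideanSpace ℝ (Fin d)) (y : EuclideanSpace ℝ (Fin d)),
      sampleW1 σ P t (Function.update x i y) ≤ sampleW1 σ P t x + (t : ℝ)⁻¹ * dist (x i) y := by
    intro x y
    have hfin := smoothedW1_empiricalMeasure_ne_top hσ hP (fun k (_ : Unit) => x k) ht ()
    have h0 : (t : ℝ≥0∞)⁻¹ ≠ ∞ := ENNReal.inv_ne_top.2 (by simp; omega)
    have hd : (t : ℝ≥0∞)⁻¹ * edist (x i) y ≠ ∞ := ENNReal.mul_ne_top h0 (edist_ne_top _ _)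
    have h := ENNReal.toReal_mono (ENNReal.add_ne_top.2 ⟨hfin, hd⟩)
      (smoothedW1_update_le (P := P) hσ hi x y)
    rw [ENNReal.toReal_add hfin hd, ENNReal.toReal_mul, ENNReal.toReal_inv,
      ENNReal.toReal_natCast, edist_dist, ENNReal.toReal_ofReal dist_nonneg] at h
    exact h
  have h1 := key x y
  -- Restoring the old value of coordinate i gives the reverse inequality.
  have h2 := key (Function.update x i y) (x i)
  rw [Function.update_idem, Function.update_eq_self, Function.update_self, dist_comm] at h2
  rw [abs_le]
  constructor <;> linarith

theorem measurable_sampleW1 (hσ : 0 < σ) (hP : FiniteFirstMoment P) (t : ℕ) :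
    Measurable (sampleW1 σ P t) :=
  (continuous_of_update_le (fun _ _ h => sampleW1_congr t h)
    (fun x _ hi y => abs_sampleW1_sub_update_le hσ hP hi x y)).measurable

/-- Convexity of the transport cost in its first argument, applied to the leave-one-out
decomposition. -/
theorem sampleW1_succ_le (hσ : 0 < σ) (hP : FiniteFirstMoment P) {t : ℕ} (ht : 1 ≤ t)
    (x : ℕ → EuclideanSpace ℝ (Fin d)) :
    sampleW1 σ P (t + 1) x ≤ ((t + 1 : ℕ) : ℝ)⁻¹ *
      ∑ i ∈ Finset.range (t + 1), sampleW1 σ P t (fun k => x (Equiv.swap i t k)) := by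
  have := isProbabilityMeasure_gaussianKernel (d := d) hσ
  have hfin : ∀ i ∈ Finset.range (t + 1), smoothedW1 σ (empiricalMeasure
      (fun k (_ : Unit) => x (Equiv.swap i t k)) t ()) P ≠ ∞ := fun i _ =>
    smoothedW1_empiricalMeasure_ne_top hσ hP _ ht ()
  have hw : ∑ _i ∈ Finset.range (t + 1), ((t + 1 : ℕ) : ℝ≥0∞)⁻¹ = 1 := by
    rw [Finset.sum_const, Finset.card_range, nsmul_eq_mul,
      ENNReal.mul_inv_cancel (by simp) (by simp)]
  have h : smoothedW1 σ (empiricalMeasure (fun k (_ : Unit) => x k) (t + 1) ()) P ≤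
      ∑ i ∈ Finset.range (t + 1), ((t + 1 : ℕ) : ℝ≥0∞)⁻¹ *
        smoothedW1 σ (empiricalMeasure (fun k (_ : Unit) => x (Equiv.swap i t k)) t ()) P := by
    rw [smoothedW1, empiricalMeasure_succ _ ht, sum_smul_conv]
    exact transportCost_sum_le _ hw _ _ hfin
  have hterm : ∀ i ∈ Finset.range (t + 1), ((t + 1 : ℕ) : ℝ≥0∞)⁻¹ *
      smoothedW1 σ (empiricalMeasure (fun k (_ : Unit) => x (Equiv.swap i t k)) t ()) P ≠ ∞ :=
    fun i hi => ENNReal.mul_ne_top (ENNReal.inv_ne_top.2 (by simp)) (hfin i hi)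
  have h2 := ENNReal.toReal_mono (ENNReal.sum_ne_top.2 hterm) h
  rw [ENNReal.toReal_sum hterm] at h2
  simp only [ENNReal.toReal_mul, ENNReal.toReal_inv, ENNReal.toReal_natCast] at h2
  rw [Finset.mul_sum]
  exact h2

/-- Linear functionals are Lipschitz. This makes the mean estimate for sub-Gaussian P available
under T₁. -/
theorem SatisfiesT1.isSubGaussian {v : ℝ} (hv : 0 < v) (h : SatisfiesT1 P v) :
    IsSubGaussian (fun x => x) v P := by
  have hnorm : Integrable (fun x : EuclideanSpace ℝ (Fin d) => ‖x‖) P :=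
    h.integrable_of_lipschitz (c := 1) measurable_norm fun x y => by
      rw [one_mul, dist_eq_norm]; exact abs_norm_sub_norm_le x y
  have hint : Integrable (fun x : EuclideanSpace ℝ (Fin d) => x) P :=
    (integrable_norm_iff measurable_id.aestronglyMeasurable).1 hnorm
  refine ⟨hint, fun u => ?_⟩
  set m := ∫ x, x ∂P
  obtain ⟨-, h2, h3⟩ := h.laplaceBound hv ‖u‖
    (fun x => inner ℝ u (x - m)) (norm_nonneg u) (by fun_prop) (fun x y => by
      simp only [dist_eq_norm]
      rw [← inner_sub_right, sub_sub_sub_cancel_right]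
      exact abs_real_inner_le_norm u (x - y))
  refine ⟨h2, h3.trans_eq ?_⟩
  have hmean : ∫ x, inner ℝ u (x - m) ∂P = 0 := by
    have hxm : Integrable (fun x => x - m) P := hint.sub (integrable_const m)
    rw [integral_inner hxm u, integral_sub hint (integrable_const m)]
    simp [m]
  rw [hmean, zero_add]

theorem integral_sampleW1_le {τ : ℝ} (hσ : 0 < σ) (hτ : 0 < τ) (hP : SatisfiesT1 P (τ ^ 2))
    {t : ℕ} (ht : 1 ≤ t) :
    ∫ x, sampleW1 σ P t x ∂(Measure.infinitePi fun _ : ℕ => P) ≤ constW1 d σ τ / 2 / √t := by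
  set s := √(σ ^ 2 + 2 * τ ^ 2) with hs
  have hs0 : 0 < s := by positivity
  have hs2 : s ^ 2 = σ ^ 2 + 2 * τ ^ 2 := Real.sq_sqrt (by positivity)
  have hA : 0 ≤ dimConst d σ τ := by unfold dimConst; positivity
  set m := ∫ z, z ∂P
  have hed : Measurable fun w : EuclideanSpace ℝ (Fin d) => edist w m := measurable_edist_left
  have h := lintegral_weighted_error_le hσ hτ hs0 hs2 (hP.isSubGaussian (by positivity)) hed ht
  -- The weight contributes the root second moment √d · s of the auxiliary Gaussian; `ratio_le`
  -- bounds s/σ and produces the extra factor of C_d.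
  have hmom : (∫⁻ w, edist w m ^ 2 * ENNReal.ofReal (gaussianDensity d s (w - m))) ^ (1 / 2 : ℝ) ≤
      ENNReal.ofReal (√(d * σ ^ 2) * (√2 * (1 / √2 + τ / σ))) := by
    have e : ∀ w : EuclideanSpace ℝ (Fin d), edist w m ^ 2 *
        ENNReal.ofReal (gaussianDensity d s (w - m)) =
        ENNReal.ofReal (‖w - m‖ ^ 2 * gaussianDensity d s (w - m)) := fun w => by
      rw [edist_dist, dist_eq_norm, ← ENNReal.ofReal_pow (norm_nonneg _),
        ← ENNReal.ofReal_mul (by positivity)]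
    simp_rw [e]
    rw [lintegral_sub_right_eq_self
      (fun w => ENNReal.ofReal (‖w‖ ^ 2 * gaussianDensity d s w)) m]
    refine (ENNReal.rpow_le_rpow (lintegral_sq_mul_gaussianDensity_le hs0) (by norm_num)).trans ?_
    rw [ENNReal.ofReal_rpow_of_nonneg (by positivity) (by norm_num), ← Real.sqrt_eq_rpow]
    refine ENNReal.ofReal_le_ofReal (Real.sqrt_le_iff.2 ⟨by positivity, ?_⟩)
    rw [hs2, mul_pow, mul_pow, Real.sq_sqrt (by positivity), Real.sq_sqrt (by norm_num), mul_assoc]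
    refine mul_le_mul_of_nonneg_left ?_ (by positivity)
    have := ratio_le hσ hτ
    rw [div_le_iff₀ (by positivity)] at this
    linarith
  have hC : √(d * σ ^ 2) * (√2 * (1 / √2 + τ / σ)) * dimConst d σ τ = constW1 d σ τ / 2 := by
    rw [constW1, constTV, dimConst]; ring
  have hB : 0 ≤ constW1 d σ τ / 2 := by rw [← hC]; positivity
  have hW : ∫⁻ x, smoothedW1 σ (empiricalMeasure (fun i (_ : Unit) => x i) t ()) P
      ∂(Measure.infinitePi fun _ : ℕ => P) ≤ ENNReal.ofReal (constW1 d σ τ / 2 / √t) := by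
    refine (lintegral_mono fun x => ?_).trans (h.trans ?_)
    · have := isProbabilityMeasure_empiricalMeasure (fun i (_ : Unit) => x i) ht ()
      refine (smoothedW1_le hσ _ m).trans_eq ?_
      simp only [smoothDensity_empiricalMeasure hσ]
    · refine (mul_le_mul_right (mul_le_mul_left hmom _) _).trans_eq ?_
      rw [← ENNReal.ofReal_mul (by positivity), hC, ← ENNReal.ofReal_mul (by positivity)]
      congr 1
      ring
  have hnn : ∀ x, 0 ≤ sampleW1 σ P t x := fun x => ENNReal.toReal_nonneg
  rw [integral_eq_lintegral_of_nonneg_ae (Filter.Eventually.of_forall hnn)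
    (measurable_sampleW1 hσ hP.1 t).aestronglyMeasurable]
  refine ENNReal.toReal_le_of_le_ofReal (by positivity) ((lintegral_mono fun x => ?_).trans hW)
  exact ENNReal.ofReal_toReal_le

end Wasserstein

/-! ### Lower bounds on the constants, giving the margins for stitching. -/

section Constants

theorem rpow_le_dimConst {σ τ : ℝ} (hσ : 0 < σ) (hτ : 0 < τ) (d : ℕ) :
    (1 + √2 * (τ / σ)) ^ ((d : ℝ) / 2) ≤ dimConst d σ τ := by
  have h2 : (0 : ℝ) < √2 := by positivity
  have e : 1 + √2 * (τ / σ) = √2 * (1 / √2 + τ / σ) := by field_simp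
  have e2 : (√2 : ℝ) ^ ((d : ℝ) / 2) = 2 ^ ((d : ℝ) / 4) := by
    rw [Real.sqrt_eq_rpow, ← Real.rpow_mul (by norm_num)]; congr 1; ring
  rw [e, Real.mul_rpow h2.le (by positivity), e2, dimConst, mul_comm]
  exact mul_le_mul_of_nonneg_left (two_rpow_le d) (by positivity)

theorem one_le_dimConst {σ τ : ℝ} (hσ : 0 < σ) (hτ : 0 < τ) (d : ℕ) : 1 ≤ dimConst d σ τ := by
  refine le_trans (Real.one_le_rpow ?_ (by positivity)) (rpow_le_dimConst hσ hτ d)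
  have : 0 ≤ √2 * (τ / σ) := by positivity
  linarith

/-- With y = √2 τ/σ, half of C_d is at least σ(1 + y)^(3/2) when d ≥ 1, while 2τ = σ√2 y. It remains
to see 2y² ≤ (1 + y)³. -/
theorem two_mul_le_constW1 {σ τ : ℝ} (hσ : 0 < σ) (hτ : 0 < τ) {d : ℕ} (hd : 1 ≤ d) :
    2 * τ ≤ constW1 d σ τ / 2 := by
  have hd' : (1 : ℝ) ≤ d := by exact_mod_cast hd
  have hs2 : √2 ^ 2 = (2 : ℝ) := Real.sq_sqrt (by norm_num)
  set y := √2 * (τ / σ) with hy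
  have hy0 : 0 ≤ y := by positivity
  have hA : √(1 + y) ≤ dimConst d σ τ := by
    refine le_trans ?_ (rpow_le_dimConst hσ hτ d)
    rw [Real.sqrt_eq_rpow]
    exact Real.rpow_le_rpow_of_exponent_le (by linarith) (by linarith)
  have hσd : σ ≤ √(d * σ ^ 2) := Real.le_sqrt_of_sq_le (by nlinarith [sq_nonneg σ])
  have hC : constW1 d σ τ / 2 = √(d * σ ^ 2) * (1 + y) * dimConst d σ τ := by
    rw [constW1, constTV, dimConst, hy]
    have e : 1 + √2 * (τ / σ) = √2 * (1 / √2 + τ / σ) := by field_simp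
    rw [e]; ring
  have hkey : √2 * y ≤ (1 + y) * √(1 + y) := by
    refine le_of_sq_le_sq ?_ (by positivity)
    rw [mul_pow (√2) y, hs2, mul_pow (1 + y), Real.sq_sqrt (by linarith)]
    nlinarith [sq_nonneg (y - 1), pow_nonneg hy0 3]
  have h2τ : 2 * τ = σ * (√2 * y) := by
    rw [hy, ← mul_assoc, ← mul_assoc, mul_assoc σ, ← sq, hs2]; field_simp
  rw [hC, h2τ, mul_assoc]
  exact mul_le_mul hσd (hkey.trans (mul_le_mul_of_nonneg_left hA (by linarith))) (by positivity)
    (by positivity)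

theorem sqrt_two_bounds : (1.4142 : ℝ) ≤ √2 ∧ √2 ≤ 1.4143 :=
  ⟨Real.le_sqrt_of_sq_le (by norm_num), by rw [Real.sqrt_le_iff]; norm_num⟩

end Constants

/-! ### Transfer to the sample space and conclusion. -/

section Main

variable {Ω : Type*} [MeasurableSpace Ω] {μ : Measure Ω} {d : ℕ} {P : Measure (EuclideanSpace ℝ (Fin d))}
  {X : ℕ → Ω → EuclideanSpace ℝ (Fin d)} {σ τ δ : ℝ} {ℓ : ℝ → ℝ}

theorem measurePreserving_sample (hXm : ∀ i, Measurable (X i)) (hXindep : iIndepFun X μ)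
    (hXlaw : ∀ i, μ.map (X i) = P) :
    MeasurePreserving (fun ω i => X i ω) μ (Measure.infinitePi fun _ : ℕ => P) := by
  refine ⟨by fun_prop, ?_⟩
  rw [hXindep.map_fun_eq_infinitePi_map hXm]
  simp only [hXlaw]

variable [IsProbabilityMeasure P]

theorem smoothedTV_time_uniform (hσ : 0 < σ) (hτ : 0 < τ) (hXm : ∀ i, Measurable (X i))
    (hXindep : iIndepFun X μ) (hXlaw : ∀ i, μ.map (X i) = P) (hℓ : IsStitching ℓ)
    (hP : IsSubGaussian (fun x => x) (τ ^ 2) P) (hδ : 0 < δ) (hδ1 : δ < 1)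
    (h : MonotoneOn ℓ (Set.Ici 0) ∨ AntitoneOn (boundaryTV ℓ d σ τ δ) (Set.Ici 1)) :
    μ {ω | ∃ t : ℕ, 1 ≤ t ∧ boundaryTV ℓ d σ τ δ t ≤ smoothedTV σ (empiricalMeasure X t ω) P} ≤
      ENNReal.ofReal δ := by
  have hmp := measurePreserving_sample hXm hXindep hXlaw
  have hA := one_le_dimConst hσ hτ d
  obtain ⟨h2l, h2u⟩ := sqrt_two_bounds
  have hc : constTV d σ τ = √2 * dimConst d σ τ := by rw [constTV, dimConst, mul_assoc]
  have hv : √(1 / 4 : ℝ) = 1 / 2 := by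
    rw [show (1 / 4 : ℝ) = (1 / 2) ^ 2 by norm_num, Real.sqrt_sq (by norm_num)]
  have hbound := stitched_bound (Q := Measure.infinitePi fun _ : ℕ => P)
    (F := halfL1Error σ P) (a := dimConst d σ τ / 2) (v := 1 / 4) (by norm_num)
    (fun s hs u hu => time_uniform_tail (by norm_num) laplaceBound_one
      (fun t _ => measurable_halfL1Error t) (fun t _ => swapInvariant_halfL1Error t)
      (fun t _ x y hxy => halfL1Error_congr t hxy)
      (fun t _ x i hi y => by
        rw [mul_one]; exact abs_halfL1Error_sub_update_le hσ hi x y)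
      (fun t ht x => halfL1Error_succ_le hσ ht x)
      (fun t ht => integral_halfL1Error_le hσ hτ hP ht) hs hu)
    -- Write A ≥ 1 for `dimConst`, so that a = A/2 and c = √2 A. The margins are c − a ≥ 0.91 A
    -- against √(3/4) < 0.87, and c/√2 − a = A/2 against √(1/6) < 0.41.
    hℓ (c := constTV d σ τ) (k := 4 * √2) hδ hδ1 (by rw [hc]; positivity)
    (by rw [hv]; linarith)
    (by
      rw [hc, Real.sqrt_le_iff]
      have : 0.9 ≤ √2 * dimConst d σ τ - dimConst d σ τ / 2 := by nlinarith
      constructor <;> nlinarith)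
    (by
      rw [hc, mul_div_cancel_left₀ _ (by positivity), Real.sqrt_le_iff]
      constructor <;> nlinarith)
    (b := boundaryTV ℓ d σ τ δ)
    (fun t _ => by
      rw [boundaryTV, mul_assoc, ← Real.sqrt_mul (by norm_num)]
      congr 3
      ring) h
  -- `Measure.le_map_apply` holds for arbitrary sets, so no measurability of the crossing event is
  -- required.
  refine (measure_mono ?_).trans ((Measure.le_map_apply hmp.aemeasurable
    {x | ∃ t : ℕ, 1 ≤ t ∧ boundaryTV ℓ d σ τ δ t ≤ halfL1Error σ P t x}).trans
      (by rw [hmp.map_eq]; exact hbound))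
  rintro ω ⟨t, ht, hle⟩
  exact ⟨t, ht, hle.trans (smoothedTV_le_halfL1Error hσ X ht ω)⟩

theorem smoothedW1_isSubGaussian (hσ : 0 < σ) (hτ : 0 < τ) (hXm : ∀ i, Measurable (X i))
    (hXindep : iIndepFun X μ) (hXlaw : ∀ i, μ.map (X i) = P) (hP : SatisfiesT1 P (τ ^ 2))
    {t : ℕ} (ht : 1 ≤ t) :
    IsSubGaussian (fun ω => (smoothedW1 σ (empiricalMeasure X t ω) P).toReal) (τ ^ 2 / t) μ := by
  have hmp := measurePreserving_sample hXm hXindep hXlaw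
  have ht0 : (0 : ℝ) < t := by exact_mod_cast ht
  have hlap := hP.laplaceBound (by positivity)
  have hm := measurable_sampleW1 (P := P) hσ hP.1 t
  -- The increments of u F_t have constant |u|/t, and t (|u|/t)² τ² = u² τ²/t.
  have hscaled : ∀ u : ℝ, _ := fun u => hlap.infinitePi (c := |u| / t) (by positivity) t
    (fun x => u * sampleW1 σ P t x) (hm.const_mul u)
    (fun x y hxy => by rw [sampleW1_congr t hxy])
    (fun x i hi y => by
      rw [← mul_sub, abs_mul, div_eq_mul_inv, mul_assoc]
      exact mul_le_mul_of_nonneg_left (abs_sampleW1_sub_update_le hσ hP.1 hi x y) (abs_nonneg u))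
  have hint : Integrable (sampleW1 σ P t) (Measure.infinitePi fun _ : ℕ => P) := by
    simpa using (hscaled 1).1
  have hmean : ∫ ω, sampleW1 σ P t (fun i => X i ω) ∂μ =
      ∫ x, sampleW1 σ P t x ∂(Measure.infinitePi fun _ : ℕ => P) := by
    rw [← hmp.map_eq, integral_map hmp.aemeasurable hm.aestronglyMeasurable]
  change IsSubGaussian (fun ω => sampleW1 σ P t (fun i => X i ω)) (τ ^ 2 / t) μ
  refine ⟨hmp.integrable_comp_of_integrable hint, fun u => ?_⟩
  rw [hmean]
  set M := ∫ x, sampleW1 σ P t x ∂(Measure.infinitePi fun _ : ℕ => P) with hM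
  obtain ⟨-, h2, h3⟩ := hscaled u
  have e : ∀ x, Real.exp (inner ℝ u (sampleW1 σ P t x - M)) =
      Real.exp (-(u * M)) * Real.exp (u * sampleW1 σ P t x) := fun x => by
    rw [← Real.exp_add]
    congr 1
    simp only [RCLike.inner_apply, conj_trivial]
    ring
  have hexp : Measurable fun x => Real.exp (-(u * M)) * Real.exp (u * sampleW1 σ P t x) :=
    ((hm.const_mul u).exp).const_mul _
  simp only [e]
  refine ⟨hmp.integrable_comp_of_integrable (h2.const_mul (Real.exp (-(u * M)))), ?_⟩
  have emap : ∫ ω, Real.exp (-(u * M)) * Real.exp (u * sampleW1 σ P t (fun i => X i ω)) ∂μ =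
      ∫ x, Real.exp (-(u * M)) * Real.exp (u * sampleW1 σ P t x)
        ∂(Measure.infinitePi fun _ : ℕ => P) := by
    rw [← hmp.map_eq, integral_map hmp.aemeasurable hexp.aestronglyMeasurable]
  rw [emap, integral_const_mul]
  refine (mul_le_mul_of_nonneg_left h3 (Real.exp_pos _).le).trans_eq ?_
  rw [← Real.exp_add, integral_const_mul, ← hM]
  congr 1
  rw [div_pow, sq_abs, Real.norm_eq_abs, sq_abs]
  field_simp
  ring

theorem boundaryW1_eq (hτ : 0 < τ) (t : ℕ) : boundaryW1 ℓ d σ τ δ t = constW1 d σ τ / √t +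
    2 * τ * √((Real.log (ℓ (Real.logb 2 t)) + Real.log (1 / δ)) / t) := by
  rw [boundaryW1, div_mul_eq_mul_div, mul_div_assoc, Real.sqrt_mul (by positivity),
    Real.sqrt_sq hτ.le, mul_assoc]

theorem smoothedW1_time_uniform_of_pos (hσ : 0 < σ) (hτ : 0 < τ) (hd : 1 ≤ d)
    (hXm : ∀ i, Measurable (X i))
    (hXindep : iIndepFun X μ) (hXlaw : ∀ i, μ.map (X i) = P) (hℓ : IsStitching ℓ)
    (hP : SatisfiesT1 P (τ ^ 2)) (hδ : 0 < δ) (hδ1 : δ < 1)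
    (h : MonotoneOn ℓ (Set.Ici 0) ∨ AntitoneOn (boundaryW1 ℓ d σ τ δ) (Set.Ici 1)) :
    μ {ω | ∃ t : ℕ, 1 ≤ t ∧ ENNReal.ofReal (boundaryW1 ℓ d σ τ δ t) ≤
      smoothedW1 σ (empiricalMeasure X t ω) P} ≤ ENNReal.ofReal δ := by
  have hmp := measurePreserving_sample hXm hXindep hXlaw
  have hB := two_mul_le_constW1 hσ hτ hd
  obtain ⟨h2l, h2u⟩ := sqrt_two_bounds
  have hs2 : √2 * √2 = (2 : ℝ) := Real.mul_self_sqrt (by norm_num)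
  have hlap := hP.laplaceBound (by positivity)
  have hcdiv : constW1 d σ τ / √2 = √2 * (constW1 d σ τ / 2) := by
    rw [div_eq_iff (by positivity)]; linear_combination (-(constW1 d σ τ / 2)) * hs2
  have hbound := stitched_bound (Q := Measure.infinitePi fun _ : ℕ => P)
    (F := sampleW1 σ P) (a := constW1 d σ τ / 2) (v := τ ^ 2) (by positivity)
    (fun s hs u hu => time_uniform_tail (by positivity) hlap
      (fun t _ => measurable_sampleW1 hσ hP.1 t) (fun t _ => swapInvariant_sampleW1 t)
      (fun t _ x y hxy => sampleW1_congr t hxy)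
      (fun t _ x i hi y => abs_sampleW1_sub_update_le hσ hP.1 hi x y)
      (fun t ht x => sampleW1_succ_le hσ hP.1 ht x)
      (fun t ht => integral_sampleW1_le hσ hτ hP ht) hs hu)
    -- Here a = C_d/2 ≥ 2τ and c = 2a. The margins are c − a ≥ 2τ against √3 τ, and c/√2 − a = (√2 −
    -- 1)a ≥ 0.828 τ against √(2/3) τ < 0.817 τ.
    hℓ (c := constW1 d σ τ) (k := 2 * τ) hδ hδ1 (by linarith)
    (by rw [Real.sqrt_sq hτ.le])
    (by
      rw [Real.sqrt_le_iff]
      constructor <;> nlinarith)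
    (by
      rw [hcdiv, Real.sqrt_le_iff]
      have : 0.82 * τ ≤ √2 * (constW1 d σ τ / 2) - constW1 d σ τ / 2 := by nlinarith
      constructor <;> nlinarith)
    (b := boundaryW1 ℓ d σ τ δ) (fun t _ => boundaryW1_eq hτ t) h
  refine (measure_mono ?_).trans ((Measure.le_map_apply hmp.aemeasurable
    {x | ∃ t : ℕ, 1 ≤ t ∧ boundaryW1 ℓ d σ τ δ t ≤ sampleW1 σ P t x}).trans
      (by rw [hmp.map_eq]; exact hbound))
  rintro ω ⟨t, ht, hle⟩
  exact ⟨t, ht, (ENNReal.ofReal_le_iff_le_toReal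
    (smoothedW1_empiricalMeasure_ne_top hσ hP.1 X ht ω)).1 hle⟩

theorem smoothedW1_eq_zero_of_subsingleton [Subsingleton (EuclideanSpace ℝ (Fin d))] (hσ : 0 < σ)
    (ν : Measure (EuclideanSpace ℝ (Fin d))) [IsProbabilityMeasure ν] : smoothedW1 σ ν P = 0 := by
  refine le_antisymm ((smoothedW1_le hσ ν 0).trans (le_of_eq ?_)) zero_le
  have : ∀ w : EuclideanSpace ℝ (Fin d), edist w 0 = 0 := fun w => by
    rw [Subsingleton.elim w 0, edist_self]
  simp [this]

theorem boundaryW1_pos (hσ : 0 < σ) (hτ : 0 < τ) (hℓ : IsStitching ℓ) (hδ : 0 < δ) (hδ1 : δ < 1)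
    {t : ℕ} (ht : 1 ≤ t) : 0 < boundaryW1 ℓ d σ τ δ t := by
  have ht0 : (1 : ℝ) ≤ t := by exact_mod_cast ht
  have h1 : 0 ≤ Real.log (ℓ (Real.logb 2 t)) :=
    Real.log_nonneg (hℓ.one_le _ (Real.logb_nonneg (by norm_num) ht0))
  have h2 : 0 < Real.log (1 / δ) := Real.log_pos (by rw [lt_div_iff₀ hδ]; linarith)
  have h3 : 0 ≤ constW1 d σ τ := by unfold constW1 constTV; positivity
  rw [boundaryW1_eq hτ]
  positivity

theorem smoothedW1_time_uniform (hσ : 0 < σ) (hτ : 0 < τ) (hXm : ∀ i, Measurable (X i))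
    (hXindep : iIndepFun X μ) (hXlaw : ∀ i, μ.map (X i) = P) (hℓ : IsStitching ℓ)
    (hP : SatisfiesT1 P (τ ^ 2)) (hδ : 0 < δ) (hδ1 : δ < 1)
    (h : MonotoneOn ℓ (Set.Ici 0) ∨ AntitoneOn (boundaryW1 ℓ d σ τ δ) (Set.Ici 1)) :
    μ {ω | ∃ t : ℕ, 1 ≤ t ∧ ENNReal.ofReal (boundaryW1 ℓ d σ τ δ t) ≤
      smoothedW1 σ (empiricalMeasure X t ω) P} ≤ ENNReal.ofReal δ := by
  rcases Nat.eq_zero_or_pos d with rfl | hd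
  -- In dimension 0 the constant C_d vanishes and the margins fail, but the space is a point: the
  -- distance is 0 while the boundary stays positive because δ < 1.
  · have hempty : {ω | ∃ t : ℕ, 1 ≤ t ∧ ENNReal.ofReal (boundaryW1 ℓ 0 σ τ δ t) ≤
        smoothedW1 σ (empiricalMeasure X t ω) P} = ∅ := by
      refine Set.eq_empty_of_forall_notMem ?_
      rintro ω ⟨t, ht, hle⟩
      have := isProbabilityMeasure_empiricalMeasure X ht ω
      rw [smoothedW1_eq_zero_of_subsingleton hσ, nonpos_iff_eq_zero, ENNReal.ofReal_eq_zero] at hle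
      exact absurd (boundaryW1_pos (d := 0) hσ hτ hℓ hδ hδ1 ht) (not_lt.2 hle)
    rw [hempty, measure_empty]
    exact zero_le
  · exact smoothedW1_time_uniform_of_pos hσ hτ hd hXm hXindep hXlaw hℓ hP hδ hδ1 h

end Main

end SmoothedDivergence

theorem proposition4p8 {Ω : Type*} [MeasurableSpace Ω] (μ : Measure Ω) [IsProbabilityMeasure μ]
    (d : ℕ) (σ : ℝ) (hσ : 0 < σ)
    (P : Measure (EuclideanSpace ℝ (Fin d))) [IsProbabilityMeasure P]
    (X : ℕ → Ω → EuclideanSpace ℝ (Fin d)) (hXm : ∀ i, Measurable (X i))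
    (hXindep : iIndepFun X μ) (hXlaw : ∀ i, μ.map (X i) = P)
    (ℓ : ℝ → ℝ) (hℓ : SmoothedDivergence.IsStitching ℓ)
    (τ : ℝ) (hτ : 0 < τ) :
    (SmoothedDivergence.IsSubGaussian (fun x => x) (τ ^ 2) P →
      ∀ δ : ℝ, 0 < δ → δ < 1 →
        (MonotoneOn ℓ (Set.Ici 0) ∨
          AntitoneOn (SmoothedDivergence.boundaryTV ℓ d σ τ δ) (Set.Ici 1)) →
        μ {ω | ∃ t : ℕ, 1 ≤ t ∧
          SmoothedDivergence.boundaryTV ℓ d σ τ δ t ≤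
            SmoothedDivergence.smoothedTV σ (SmoothedDivergence.empiricalMeasure X t ω) P}
          ≤ ENNReal.ofReal δ) ∧
    (SmoothedDivergence.SatisfiesT1 P (τ ^ 2) →
      (∀ t : ℕ, 1 ≤ t →
        (∀ ω, SmoothedDivergence.smoothedW1 σ
          (SmoothedDivergence.empiricalMeasure X t ω) P ≠ ∞) ∧
        SmoothedDivergence.IsSubGaussian
          (fun ω => (SmoothedDivergence.smoothedW1 σ
            (SmoothedDivergence.empiricalMeasure X t ω) P).toReal) (τ ^ 2 / t) μ) ∧
      ∀ δ : ℝ, 0 < δ → δ < 1 →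
        (MonotoneOn ℓ (Set.Ici 0) ∨
          AntitoneOn (SmoothedDivergence.boundaryW1 ℓ d σ τ δ) (Set.Ici 1)) →
        μ {ω | ∃ t : ℕ, 1 ≤ t ∧
          ENNReal.ofReal (SmoothedDivergence.boundaryW1 ℓ d σ τ δ t) ≤
            SmoothedDivergence.smoothedW1 σ (SmoothedDivergence.empiricalMeasure X t ω) P}
          ≤ ENNReal.ofReal δ) := by

  refine ⟨fun hP δ hδ hδ1 h => ?_, fun hP => ⟨fun t ht => ⟨fun ω => ?_, ?_⟩,
    fun δ hδ hδ1 h => ?_⟩⟩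
  · exact SmoothedDivergence.smoothedTV_time_uniform hσ hτ hXm hXindep hXlaw hℓ hP hδ hδ1 h
  · exact SmoothedDivergence.smoothedW1_empiricalMeasure_ne_top hσ hP.1 X ht ω
  · exact SmoothedDivergence.smoothedW1_isSubGaussian hσ hτ hXm hXindep hXlaw hP ht
  · exact SmoothedDivergence.smoothedW1_time_uniform hσ hτ hXm hXindep hXlaw hℓ hP hδ hδ1 h
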